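/- All algebras are unital and over $\mathbb{C}$; $\Delta(a)=a_{(1)}\otimes a_{(2)}$, and left coactions are written $m\mapsto m_{(-1)}\otimes m_{(0)}$. **Setting.** Let $A$ be a Hopf $*$-algebra with antipode $S$, and let $B$ be a left $A$-comodule $*$-algebra, that is, a $*$-algebra with a coaction of $A$ which is a homomorphism of $*$-algebras. Let $(\Omega^\bullet,\wedge,d)$ be an $A$-covariant $*$-differential calculus on $B$: a graded algebra $\Omega^\bullet=\bigoplus_{k\ge 0}\Omega^k$ with $\Omega^0=B$, generated by $B$ and $dB$, with a degree-one map $d$ satisfying $d^2=0$ and the graded Leibniz rule, with a coaction of $A$ by graded algebra homomorphisms that extends the coaction on $B$ and commutes with $d$, and with a conjugate-linear involution $*$ that preserves degrees, extends the involution of $B$, commutes with $d$, satisfies $(\omega\wedge\nu)^*=(-1)^{kl}\nu^*\wedge\omega^*$ for $\omega\in\Omega^k$, $\nu\in\Omega^l$, and is compatible with the coaction. Let $\gamma:A\otimes A\to\mathbb{C}$ be a unital unitary $2$-cocycle: it has a convolution inverse $\bar\gamma$, and for all $a,b,c\in A$, $$\gamma(a_{(1)}\otimes b_{(1)})\gamma(a_{(2)}b_{(2)}\otimes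 c)=\gamma(b_{(1)}\otimes c_{(1)})\gamma(a\otimes b_{(2)}c_{(2)}),\qquad \gamma(a\otimes 1)=\varepsilon(a)=\gamma(1\otimes a),$$ $$\overline{\gamma(a\otimes b)}=\bar\gamma(S(a)^*\otimes S(b)^*).$$ Put $V(a)=\gamma(S^{-1}(a_{(2)})\otimes a_{(1)})$ and $\bar V(a)=\bar\gamma(a_{(2)}\otimes S^{-1}(a_{(1)}))$. Let $A_\gamma$ be the Hopf $*$-algebra with the coalgebra structure of $A$, the product $a\cdot_\gamma b=\gamma(a_{(1)}\otimes b_{(1)})a_{(2)}b_{(2)}\bar\gamma(a_{(3)}\otimes b_{(3)})$ and the involution $a^{*_\gamma}=\bar V(a_{(1)}^*)\,a_{(2)}^*\,V(a_{(3)}^*)$. Let $B_\gamma$ and $\Omega_\gamma^\bullet$ be the spaces $B$ and $\Omega^\bullet$ with the same coactions, grading and differential, the products $x\cdot_\gamma y=\gamma(x_{(-1)}\otimes y_{(-1)})x_{(0)}y_{(0)}$ and the involutions $x^{*_\gamma}=\bar V(x_{(-1)}^*)x_{(0)}^*$. Then $B_\gamma$ is a left $A_\gamma$-comodule $*$-algebra,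 and $\Omega_\gamma^\bullet$ is an $A_\gamma$-covariant $*$-differential calculus on it. Let $\varphi:\Omega^1_\gamma\otimes_{B_\gamma}\Omega^1_\gamma\to\Omega^1\otimes_B\Omega^1$ be the map $\varphi(\omega\otimes_{B_\gamma}\eta)=\gamma(\omega_{(-1)}\otimes\eta_{(-1)})\,\omega_{(0)}\otimes_B\eta_{(0)}$. **Metrics.** A *metric* on $\Omega^1$ is a pair $(g,(\,,))$ of an element $g\in\Omega^1\otimes_B\Omega^1$ and a $B$-bimodule map $(\,,):\Omega^1\otimes_B\Omega^1\to B$ such that $((\omega,\,)\otimes_B\mathrm{id})g=\omega=(\mathrm{id}\otimes_B(\,,\omega))g$ for all $\omega\in\Omega^1$. It is *$A$-covariant* if $(\,,)$ and the map $B\to\Omega^1\otimes_B\Omega^1$, $b\mapsto bg$, are morphisms of $A$-comodules. It is *real* if $g=\sum_i\omega_i\otimes_B\eta_i$ satisfies $g=\sum_i\eta_i^*\otimes_B\omega_i^*$. An *$A$-covariant Hermitian metric* on $\Omega^1$ exists only if $\Omega^1$ is finitely generated and projective as a left $B$-module; it is then an isomorphism $\mathcal H:\overline{\Omega^1}\to{}_B\mathrm{Hom}(\Omega^1,B)$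 of $B$-bimodules and left $A$-comodules such that $\langle x,\bar y\rangle:=\mathcal H(\bar y)(x)$ satisfies $\langle y,\bar x\rangle^*=\langle x,\bar y\rangle$ for all $x,y\in\Omega^1$. Here the conjugate $\overline{\Omega^1}$ has the structure $b\,\bar e=\overline{e\,b^*}$, $\bar e\,b=\overline{b^*e}$, $\bar e\mapsto e_{(-1)}^*\otimes\overline{e_{(0)}}$, and the space ${}_B\mathrm{Hom}(\Omega^1,B)$ of left $B$-linear maps has the structure $(bf)(e)=f(eb)$, $(fb)(e)=f(e)b$, $f_{(-1)}\otimes f_{(0)}(e)=S(e_{(-1)})f(e_{(0)})_{(-1)}\otimes f(e_{(0)})_{(0)}$. The same definitions apply to $\Omega^1_\gamma$ over $A_\gamma$ and $B_\gamma$. **Statement.** The following four sets are in one-to-one correspondence: 1. the $A$-covariant real metrics on $\Omega^1$; 2. the $A$-covariant Hermitian metrics on $\Omega^1$; 3. the $A_\gamma$-covariant real metrics on $\Omega^1_\gamma$; 4. the $A_\gamma$-covariant Hermitian metrics on $\Omega^1_\gamma$. More precisely, there are a bijection from (1) to (2) that sends $(g,(\,,))$ to $\mathcal H_g$ with $\mathcal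 H_g(\bar\omega)(\eta)=(\eta,\omega^*)$; a bijection from (3) to (4) given by the same formula for $\Omega^1_\gamma$ and $*_\gamma$; a bijection from (1) to (3) that sends $(g,(\,,))$ to $(g_\gamma,(\,,)_\gamma)$ with $\varphi(g_\gamma)=g$ and $(\,,)_\gamma=(\,,)\circ\varphi$; and a bijection from (2) to (4) that sends $\mathcal H_g$ to $\mathcal H_{g_\gamma}$. -/

import Mathlib

set_option linter.unusedSectionVars false
open scoped TensorProduct ComplexConjugate

namespace CocycleTwist

open Coalgebra WithConv

universe u v w

section Shortcuts

variable {M : Type*} [AddCommMonoid M] [Module ℂ M] {N : Type*} [AddCommMonoid N] [Module ℂ N]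

instance linearMapZeroHomClass : ZeroHomClass (M →ₗ[ℂ] N) M N := inferInstance

instance linearMapAddHomClass : AddHomClass (M →ₗ[ℂ] N) M N := inferInstance

instance linearMapAddMonoidHomClass : AddMonoidHomClass (M →ₗ[ℂ] N) M N := inferInstance

instance linearEquivZeroHomClass : ZeroHomClass (M ≃ₗ[ℂ] N) M N := inferInstance

instance linearEquivAddHomClass : AddHomClass (M ≃ₗ[ℂ] N) M N := inferInstance

instance linearEquivAddMonoidHomClass : AddMonoidHomClass (M ≃ₗ[ℂ] N) M N := inferInstance

end Shortcuts

section Coactions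

variable {C : Type*} [AddCommGroup C] [Module ℂ C] [Coalgebra ℂ C]
variable {D : Type*} [AddCommGroup D] [Module ℂ D] [Coalgebra ℂ D]
variable {M : Type*} [AddCommGroup M] [Module ℂ M]
variable {N : Type*} [AddCommGroup N] [Module ℂ N]

/-- `δ : M → C ⊗ M` is a left coaction of the coalgebra `C`: it is coassociative and counital. -/
structure IsCoaction (δ : M →ₗ[ℂ] C ⊗[ℂ] M) : Prop where
  coassoc : ∀ m, TensorProduct.assoc ℂ C C M ((comul (R := ℂ) (A := C)).rTensor M (δ m)) =
    δ.lTensor C (δ m)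
  counit : ∀ m, TensorProduct.lid ℂ M ((Coalgebra.counit (R := ℂ) (A := C)).rTensor M (δ m)) = m

/-- The linear functionals on a coalgebra; the ring structure is the convolution product. -/
abbrev Fn (C : Type*) [AddCommGroup C] [Module ℂ C] := WithConv (C →ₗ[ℂ] ℂ)

/-- `m ↦ f(m₍₋₁₎) m₍₀₎`. -/
noncomputable def act (δ : M →ₗ[ℂ] C ⊗[ℂ] M) (f : Fn C) : M →ₗ[ℂ] M :=
  (TensorProduct.lid ℂ M).toLinearMap ∘ₗ f.ofConv.rTensor M ∘ₗ δ

/-- `c ↦ f(c₍₁₎) c₍₂₎`. -/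
noncomputable def lact (f : Fn C) : C →ₗ[ℂ] C := act comul f

/-- `c ↦ c₍₁₎ f(c₍₂₎)`. -/
noncomputable def ract (f : Fn C) : C →ₗ[ℂ] C :=
  (TensorProduct.rid ℂ C).toLinearMap ∘ₗ f.ofConv.lTensor C ∘ₗ comul

/-- The codiagonal coaction `m ⊗ n ↦ (m₍₋₁₎ ⊗ n₍₋₁₎) ⊗ (m₍₀₎ ⊗ n₍₀₎)` of `C ⊗ D` on `M ⊗ N`. -/
noncomputable def tcoact (δ : M →ₗ[ℂ] C ⊗[ℂ] M) (δ' : N →ₗ[ℂ] D ⊗[ℂ] N) :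
    M ⊗[ℂ] N →ₗ[ℂ] (C ⊗[ℂ] D) ⊗[ℂ] (M ⊗[ℂ] N) :=
  (TensorProduct.tensorTensorTensorComm ℂ C M D N).toLinearMap ∘ₗ TensorProduct.map δ δ'

/-- The functional `c ⊗ d ↦ f(c) g(d)`. -/
noncomputable def extFn (f : Fn C) (g : Fn D) : Fn (C ⊗[ℂ] D) :=
  toConv (LinearMap.mul' ℂ ℂ ∘ₗ TensorProduct.map f.ofConv g.ofConv)

/-- Composition of a functional with a linear map. -/
noncomputable def Fn.pre (f : Fn D) (π : C →ₗ[ℂ] D) : Fn C := toConv (f.ofConv ∘ₗ π)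

end Coactions

section Maps

variable {C : Type*} [AddCommGroup C] [Module ℂ C]
variable {D : Type*} [AddCommGroup D] [Module ℂ D]
variable {M : Type*} [AddCommGroup M] [Module ℂ M]
variable {N : Type*} [AddCommGroup N] [Module ℂ N]

theorem act_map {δ : M →ₗ[ℂ] C ⊗[ℂ] M} {δ' : N →ₗ[ℂ] D ⊗[ℂ] N} (π : C →ₗ[ℂ] D) (φ : M →ₗ[ℂ] N)
    (h : ∀ m, δ' (φ m) = TensorProduct.map π φ (δ m)) (f : Fn D) (m : M) :
    act δ' f (φ m) = φ (act δ (f.pre π) m) := by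
  simp only [act, LinearMap.comp_apply, h, LinearEquiv.coe_coe]
  induction δ m with
  | zero => simp
  | add x y hx hy => simp only [map_add, hx, hy]
  | tmul c m => simp [Fn.pre]

theorem tcoact_tmul (δ : M →ₗ[ℂ] C ⊗[ℂ] M) (δ' : N →ₗ[ℂ] D ⊗[ℂ] N) (m : M) (n : N) :
    tcoact δ δ' (m ⊗ₜ n) = TensorProduct.tensorTensorTensorComm ℂ C M D N (δ m ⊗ₜ δ' n) := rfl

theorem act_tcoact (δ : M →ₗ[ℂ] C ⊗[ℂ] M) (δ' : N →ₗ[ℂ] D ⊗[ℂ] N) (f : Fn C) (g : Fn D) (m : M)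
    (n : N) : act (tcoact δ δ') (extFn f g) (m ⊗ₜ n) = act δ f m ⊗ₜ act δ' g n := by
  simp only [act, LinearMap.comp_apply, tcoact_tmul, LinearEquiv.coe_coe]
  induction δ m with
  | zero => simp
  | add x y hx hy => simp only [map_add, TensorProduct.add_tmul, hx, hy]
  | tmul c m =>
    induction δ' n with
    | zero => simp
    | add x y hx hy => simp only [map_add, TensorProduct.tmul_add, hx, hy]
    | tmul d n => simp [extFn, TensorProduct.smul_tmul', smul_smul, mul_comm]

end Maps

section CoactionLemmas

variable {C : Type*} [AddCommGroup C] [Module ℂ C] [Coalgebra ℂ C]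
variable {D : Type*} [AddCommGroup D] [Module ℂ D] [Coalgebra ℂ D]
variable {M : Type*} [AddCommGroup M] [Module ℂ M]
variable {N : Type*} [AddCommGroup N] [Module ℂ N]

theorem conv_apply (f g : Fn C) (c : C) :
    (f * g).ofConv c = LinearMap.mul' ℂ ℂ (TensorProduct.map f.ofConv g.ofConv (comul c)) := rfl

theorem one_apply (c : C) : (1 : Fn C).ofConv c = Coalgebra.counit c := rfl

theorem act_one {δ : M →ₗ[ℂ] C ⊗[ℂ] M} (h : IsCoaction δ) (m : M) : act δ 1 m = m := h.counit m

theorem act_mul {δ : M →ₗ[ℂ] C ⊗[ℂ] M} (h : IsCoaction δ) (f g : Fn C) (m : M) :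
    act δ (f * g) m = act δ g (act δ f m) := by
  have key : ∀ t : C ⊗[ℂ] M, act δ g (TensorProduct.lid ℂ M (f.ofConv.rTensor M t)) =
      TensorProduct.lid ℂ M (TensorProduct.map f.ofConv
        ((TensorProduct.lid ℂ M).toLinearMap ∘ₗ g.ofConv.rTensor M) (δ.lTensor C t)) := by
    intro t
    induction t with
    | zero => simp
    | add x y hx hy => simp only [map_add, hx, hy]
    | tmul c m => simp [act]
  have key2 : ∀ t : C ⊗[ℂ] M, TensorProduct.lid ℂ M ((f * g).ofConv.rTensor M t) =
      TensorProduct.lid ℂ M (TensorProduct.map f.ofConv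
        ((TensorProduct.lid ℂ M).toLinearMap ∘ₗ g.ofConv.rTensor M)
          (TensorProduct.assoc ℂ C C M (comul.rTensor M t))) := by
    intro t
    induction t with
    | zero => simp
    | add x y hx hy => simp only [map_add, hx, hy]
    | tmul c m =>
      simp only [LinearMap.rTensor_tmul, conv_apply]
      induction comul (R := ℂ) c with
      | zero => simp
      | add x y hx hy => simp only [map_add, TensorProduct.add_tmul, hx, hy]
      | tmul c d => simp [smul_smul, mul_comm]
  calc act δ (f * g) m = TensorProduct.lid ℂ M ((f * g).ofConv.rTensor M (δ m)) := rfl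
    _ = _ := by rw [key2, h.coassoc, ← key]; rfl

theorem isCoaction_comul : IsCoaction (comul (R := ℂ) (A := C)) where
  coassoc m := coassoc_apply m
  counit m := by simp

theorem lact_one (c : C) : lact 1 c = c := act_one isCoaction_comul c

theorem lact_mul (f g : Fn C) (c : C) : lact (f * g) c = lact g (lact f c) :=
  act_mul isCoaction_comul f g c

theorem ract_one (c : C) : ract 1 c = c := by
  have := lTensor_counit_comul (R := ℂ) c
  calc ract 1 c = TensorProduct.rid ℂ C ((Coalgebra.counit (R := ℂ)).lTensor C (comul c)) := rfl
    _ = c := by rw [this]; simp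

theorem ract_mul (f g : Fn C) (c : C) : ract (f * g) c = ract f (ract g c) := by
  have key : ∀ t : C ⊗[ℂ] C, ract f (TensorProduct.rid ℂ C (g.ofConv.lTensor C t)) =
      TensorProduct.rid ℂ C ((LinearMap.mul' ℂ ℂ ∘ₗ TensorProduct.map f.ofConv g.ofConv).lTensor C
        (TensorProduct.assoc ℂ C C C (comul.rTensor C t))) := by
    intro t
    induction t with
    | zero => simp
    | add x y hx hy => simp only [map_add, hx, hy]
    | tmul c d =>
      simp only [ract, LinearMap.lTensor_tmul, LinearMap.rTensor_tmul, TensorProduct.rid_tmul,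
        LinearMap.comp_apply, map_smul, LinearEquiv.coe_coe]
      induction comul (R := ℂ) c with
      | zero => simp
      | add x y hx hy => simp only [map_add, TensorProduct.add_tmul, smul_add, hx, hy]
      | tmul c d =>
        simp [smul_smul]
        rw [mul_comm]
  calc ract (f * g) c = TensorProduct.rid ℂ C ((LinearMap.mul' ℂ ℂ ∘ₗ
        TensorProduct.map f.ofConv g.ofConv).lTensor C (comul.lTensor C (comul c))) := by
        simp only [ract, LinearMap.comp_apply]
        rw [← LinearMap.comp_apply (LinearMap.lTensor C _) (LinearMap.lTensor C _),
          ← LinearMap.lTensor_comp]; rfl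
    _ = _ := by rw [← coassoc_apply, ← key]; rfl

theorem lact_ract (f g : Fn C) (c : C) : lact f (ract g c) = ract g (lact f c) := by
  have key : ∀ t : C ⊗[ℂ] C, lact f (TensorProduct.rid ℂ C (g.ofConv.lTensor C t)) =
      TensorProduct.lid ℂ C (TensorProduct.map f.ofConv
        ((TensorProduct.rid ℂ C).toLinearMap ∘ₗ g.ofConv.lTensor C)
        (TensorProduct.assoc ℂ C C C (comul.rTensor C t))) := by
    intro t
    induction t with
    | zero => simp
    | add x y hx hy => simp only [map_add, hx, hy]
    | tmul c d =>
      simp only [lact, act, LinearMap.lTensor_tmul, LinearMap.rTensor_tmul, TensorProduct.rid_tmul,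
        LinearMap.comp_apply, map_smul, LinearEquiv.coe_coe]
      induction comul (R := ℂ) c with
      | zero => simp
      | add x y hx hy => simp only [map_add, TensorProduct.add_tmul, smul_add, hx, hy]
      | tmul c d => simp [smul_smul, mul_comm]
  have key2 : ∀ t : C ⊗[ℂ] C, ract g (TensorProduct.lid ℂ C (f.ofConv.rTensor C t)) =
      TensorProduct.lid ℂ C (TensorProduct.map f.ofConv
        ((TensorProduct.rid ℂ C).toLinearMap ∘ₗ g.ofConv.lTensor C)
        (comul.lTensor C t)) := by
    intro t
    induction t with
    | zero => simp
    | add x y hx hy => simp only [map_add, hx, hy]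
    | tmul c d => simp [ract]
  calc lact f (ract g c) = lact f (TensorProduct.rid ℂ C (g.ofConv.lTensor C (comul c))) := rfl
    _ = ract g (TensorProduct.lid ℂ C (f.ofConv.rTensor C (comul c))) := by
        rw [key, key2, coassoc_apply]
    _ = _ := rfl

theorem coact_act {δ : M →ₗ[ℂ] C ⊗[ℂ] M} (h : IsCoaction δ) (f : Fn C) (m : M) :
    δ (act δ f m) = (lact f).rTensor M (δ m) := by
  have key : ∀ t : C ⊗[ℂ] M, δ (TensorProduct.lid ℂ M (f.ofConv.rTensor M t)) =
      TensorProduct.lid ℂ (C ⊗[ℂ] M) (f.ofConv.rTensor (C ⊗[ℂ] M) (δ.lTensor C t)) := by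
    intro t
    induction t with
    | zero => simp
    | add x y hx hy => simp only [map_add, hx, hy]
    | tmul c m => simp
  have key2 : ∀ t : C ⊗[ℂ] M, (lact f).rTensor M t =
      TensorProduct.lid ℂ (C ⊗[ℂ] M) (f.ofConv.rTensor (C ⊗[ℂ] M)
        (TensorProduct.assoc ℂ C C M (comul.rTensor M t))) := by
    intro t
    induction t with
    | zero => simp
    | add x y hx hy => simp only [map_add, hx, hy]
    | tmul c m =>
      simp only [lact, act, LinearMap.rTensor_tmul, LinearMap.comp_apply, LinearEquiv.coe_coe]
      induction comul (R := ℂ) c with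
      | zero => simp
      | add x y hx hy => simp only [map_add, TensorProduct.add_tmul, hx, hy]
      | tmul c d => simp [TensorProduct.smul_tmul']
  calc δ (act δ f m) = δ (TensorProduct.lid ℂ M (f.ofConv.rTensor M (δ m))) := rfl
    _ = _ := by rw [key, key2, h.coassoc]

theorem lTensor_act {δ : M →ₗ[ℂ] C ⊗[ℂ] M} (h : IsCoaction δ) (f : Fn C) (m : M) :
    (act δ f).lTensor C (δ m) = (ract f).rTensor M (δ m) := by
  have key : ∀ t : C ⊗[ℂ] M, (act δ f).lTensor C t =
      ((TensorProduct.lid ℂ M).toLinearMap ∘ₗ f.ofConv.rTensor M).lTensor C (δ.lTensor C t) := by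
    intro t
    induction t with
    | zero => simp
    | add x y hx hy => simp only [map_add, hx, hy]
    | tmul c m => simp [act]
  have key2 : ∀ t : C ⊗[ℂ] M, (ract f).rTensor M t =
      ((TensorProduct.lid ℂ M).toLinearMap ∘ₗ f.ofConv.rTensor M).lTensor C
        (TensorProduct.assoc ℂ C C M (comul.rTensor M t)) := by
    intro t
    induction t with
    | zero => simp
    | add x y hx hy => simp only [map_add, hx, hy]
    | tmul c m =>
      simp only [ract, LinearMap.rTensor_tmul, LinearMap.comp_apply, LinearEquiv.coe_coe]
      induction comul (R := ℂ) c with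
      | zero => simp
      | add x y hx hy => simp only [map_add, TensorProduct.add_tmul, hx, hy]
      | tmul c d => simp [TensorProduct.smul_tmul]
  rw [key, key2, h.coassoc]

theorem ract_map (π : C →ₗ[ℂ] D) (h : ∀ c, comul (R := ℂ) (π c) = TensorProduct.map π π (comul c))
    (f : Fn D) (c : C) : ract f (π c) = π (ract (f.pre π) c) := by
  simp only [ract, LinearMap.comp_apply, h, LinearEquiv.coe_coe]
  induction comul (R := ℂ) c with
  | zero => simp
  | add x y hx hy => simp only [map_add, hx, hy]
  | tmul c m => simp [Fn.pre]

theorem lact_map (π : C →ₗ[ℂ] D) (h : ∀ c, comul (R := ℂ) (π c) = TensorProduct.map π π (comul c))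
    (f : Fn D) (c : C) : lact f (π c) = π (lact (f.pre π) c) := act_map π π h f c

theorem pre_mul (π : C →ₗ[ℂ] D) (h : ∀ c, comul (R := ℂ) (π c) = TensorProduct.map π π (comul c))
    (f g : Fn D) : (f * g).pre π = f.pre π * g.pre π := by
  apply WithConv.ext
  ext c
  simp only [Fn.pre, conv_apply, LinearMap.comp_apply, h]
  induction comul (R := ℂ) c with
  | zero => simp
  | add x y hx hy => simp only [map_add, hx, hy]
  | tmul c m => simp

theorem pre_one (π : C →ₗ[ℂ] D) (h : ∀ c, Coalgebra.counit (R := ℂ) (π c) = Coalgebra.counit c) :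
    (1 : Fn D).pre π = 1 := by
  apply WithConv.ext
  ext c
  exact h c

theorem comul_tensor : comul (R := ℂ) (A := C ⊗[ℂ] D) = tcoact comul comul := rfl

theorem lact_extFn (f : Fn C) (g : Fn D) (c : C) (d : D) :
    lact (extFn f g) (c ⊗ₜ d) = lact f c ⊗ₜ lact g d := act_tcoact comul comul f g c d

theorem ract_extFn (f : Fn C) (g : Fn D) (c : C)
    (d : D) : ract (extFn f g) (c ⊗ₜ d) = ract f c ⊗ₜ ract g d := by
  simp only [ract, LinearMap.comp_apply, comul_tensor, tcoact_tmul, LinearEquiv.coe_coe]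
  induction comul (R := ℂ) c with
  | zero => simp
  | add x y hx hy => simp only [map_add, TensorProduct.add_tmul, hx, hy]
  | tmul c m =>
    induction comul (R := ℂ) d with
    | zero => simp
    | add x y hx hy => simp only [map_add, TensorProduct.tmul_add, hx, hy]
    | tmul d n => simp [extFn, TensorProduct.smul_tmul', smul_smul, mul_comm]

theorem extFn_mul (f f' : Fn C) (g g' : Fn D) :
    extFn f g * extFn f' g' = extFn (f * f') (g * g') := by
  apply WithConv.ext
  ext c d
  simp only [conv_apply, comul_tensor, tcoact_tmul, TensorProduct.AlgebraTensorModule.curry_apply,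
    TensorProduct.curry_apply, LinearMap.coe_restrictScalars, extFn, LinearMap.comp_apply,
    TensorProduct.map_tmul]
  induction comul (R := ℂ) c with
  | zero => simp
  | add x y hx hy => simp only [map_add, TensorProduct.add_tmul, hx, hy]
  | tmul c m =>
    induction comul (R := ℂ) d with
    | zero => simp
    | add x y hx hy => simp only [map_add, TensorProduct.tmul_add, hx, hy]
    | tmul d n => simp; ring

theorem extFn_one : extFn (1 : Fn C) (1 : Fn D) = 1 := by
  apply WithConv.ext
  ext c d
  simp [extFn, LinearMap.convOne_def, mul_comm]

theorem isCoaction_tcoact {δ : M →ₗ[ℂ] C ⊗[ℂ] M} {δ' : N →ₗ[ℂ] D ⊗[ℂ] N} (h : IsCoaction δ)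
    (h' : IsCoaction δ') : IsCoaction (tcoact δ δ') where
  counit t := by
    change act (tcoact δ δ') 1 t = t
    rw [← extFn_one]
    induction t with
    | zero => simp
    | add x y hx hy => rw [map_add, hx, hy]
    | tmul m n => rw [act_tcoact, act_one h, act_one h']
  coassoc t := by
    let F : (C ⊗[ℂ] (C ⊗[ℂ] M)) ⊗[ℂ] (D ⊗[ℂ] (D ⊗[ℂ] N)) →ₗ[ℂ]
        (C ⊗[ℂ] D) ⊗[ℂ] ((C ⊗[ℂ] D) ⊗[ℂ] (M ⊗[ℂ] N)) :=
      (TensorProduct.tensorTensorTensorComm ℂ C M D N).toLinearMap.lTensor _ ∘ₗ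
      (TensorProduct.tensorTensorTensorComm ℂ C (C ⊗[ℂ] M) D (D ⊗[ℂ] N)).toLinearMap
    induction t with
    | zero => simp
    | add x y hx hy => simp only [map_add, hx, hy]
    | tmul m n =>
      have := congrArg F (congrArg₂ (fun a b => a ⊗ₜ[ℂ] b) (h.coassoc m) (h'.coassoc n))
      convert this using 1
      · rw [tcoact_tmul]
        generalize δ m = s
        generalize δ' n = t
        induction s with
        | zero => simp
        | add x y hx hy => simp only [map_add, TensorProduct.add_tmul, hx, hy]
        | tmul c m =>
          induction t with
          | zero => simp
          | add x y hx hy => simp only [map_add, TensorProduct.tmul_add, hx, hy]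
          | tmul d n =>
            simp only [TensorProduct.tensorTensorTensorComm_tmul, LinearMap.rTensor_tmul,
              comul_tensor, tcoact_tmul]
            generalize comul (R := ℂ) c = s
            generalize comul (R := ℂ) d = t
            induction s with
            | zero => simp
            | add x y hx hy => simp only [map_add, TensorProduct.add_tmul, hx, hy]
            | tmul c m =>
              induction t with
              | zero => simp
              | add x y hx hy => simp only [map_add, TensorProduct.add_tmul, TensorProduct.tmul_add, hx, hy]
              | tmul d n => simp [F]
      · rw [tcoact_tmul]
        generalize δ m = s
        generalize δ' n = t
        induction s with
        | zero => simp
        | add x y hx hy => simp only [map_add, TensorProduct.add_tmul, hx, hy]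
        | tmul c m =>
          induction t with
          | zero => simp
          | add x y hx hy => simp only [map_add, TensorProduct.tmul_add, hx, hy]
          | tmul d n =>
            simp [F, tcoact]

end CoactionLemmas

section TensorLemmas

variable {C : Type*} [AddCommGroup C] [Module ℂ C]
variable {D : Type*} [AddCommGroup D] [Module ℂ D]
variable {E : Type*} [AddCommGroup E] [Module ℂ E]
variable {M : Type*} [AddCommGroup M] [Module ℂ M]
variable {N : Type*} [AddCommGroup N] [Module ℂ N]
variable {P : Type*} [AddCommGroup P] [Module ℂ P]
variable {C' : Type*} [AddCommGroup C'] [Module ℂ C']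
variable {D' : Type*} [AddCommGroup D'] [Module ℂ D']
variable {M' : Type*} [AddCommGroup M'] [Module ℂ M']
variable {N' : Type*} [AddCommGroup N'] [Module ℂ N']

theorem tcoact_map {δ : M →ₗ[ℂ] C ⊗[ℂ] M} {δ' : N →ₗ[ℂ] D ⊗[ℂ] N}
    {η : M' →ₗ[ℂ] C' ⊗[ℂ] M'} {η' : N' →ₗ[ℂ] D' ⊗[ℂ] N'}
    (π : C →ₗ[ℂ] C') (ρ : D →ₗ[ℂ] D') (p : M →ₗ[ℂ] M') (q : N →ₗ[ℂ] N')
    (hp : ∀ m, η (p m) = TensorProduct.map π p (δ m))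
    (hq : ∀ n, η' (q n) = TensorProduct.map ρ q (δ' n)) (t : M ⊗[ℂ] N) :
    tcoact η η' (TensorProduct.map p q t) =
      TensorProduct.map (TensorProduct.map π ρ) (TensorProduct.map p q) (tcoact δ δ' t) := by
  induction t with
  | zero => simp
  | add x y hx hy => simp only [map_add, hx, hy]
  | tmul m n =>
    simp only [TensorProduct.map_tmul, tcoact_tmul, hp, hq]
    induction δ m with
    | zero => simp
    | add x y hx hy => simp only [map_add, TensorProduct.add_tmul, hx, hy]
    | tmul c m =>
      induction δ' n with
      | zero => simp
      | add x y hx hy => simp only [map_add, TensorProduct.tmul_add, hx, hy]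
      | tmul d n => simp

theorem tcoact_assoc (δ : M →ₗ[ℂ] C ⊗[ℂ] M) (δ' : N →ₗ[ℂ] D ⊗[ℂ] N) (δ'' : P →ₗ[ℂ] E ⊗[ℂ] P)
    (t : (M ⊗[ℂ] N) ⊗[ℂ] P) :
    tcoact δ (tcoact δ' δ'') (TensorProduct.assoc ℂ M N P t) =
      TensorProduct.map (TensorProduct.assoc ℂ C D E).toLinearMap
        (TensorProduct.assoc ℂ M N P).toLinearMap (tcoact (tcoact δ δ') δ'' t) := by
  induction t with
  | zero => simp
  | add x y hx hy => simp only [map_add, hx, hy]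
  | tmul t p =>
    induction t with
    | zero => simp
    | add x y hx hy => simp only [map_add, TensorProduct.add_tmul, hx, hy]
    | tmul m n =>
      simp only [TensorProduct.assoc_tmul, tcoact_tmul]
      generalize δ m = s, δ' n = t, δ'' p = u
      induction s with
      | zero => simp
      | add x y hx hy => simp only [map_add, TensorProduct.add_tmul, hx, hy]
      | tmul c m =>
        induction t with
        | zero => simp
        | add x y hx hy =>
          simp only [map_add, TensorProduct.add_tmul, TensorProduct.tmul_add, hx, hy]
        | tmul d n =>
          induction u with
          | zero => simp
          | add x y hx hy => simp only [map_add, TensorProduct.tmul_add, hx, hy]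
          | tmul e p => simp

theorem tcoact_comm (δ : M →ₗ[ℂ] C ⊗[ℂ] M) (δ' : N →ₗ[ℂ] D ⊗[ℂ] N) (t : M ⊗[ℂ] N) :
    tcoact δ' δ (TensorProduct.comm ℂ M N t) =
      TensorProduct.map (TensorProduct.comm ℂ C D).toLinearMap
        (TensorProduct.comm ℂ M N).toLinearMap (tcoact δ δ' t) := by
  induction t with
  | zero => simp
  | add x y hx hy => simp only [map_add, hx, hy]
  | tmul m n =>
    simp only [TensorProduct.comm_tmul, tcoact_tmul]
    generalize δ m = s, δ' n = t
    induction s with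
    | zero => simp
    | add x y hx hy => simp only [map_add, TensorProduct.add_tmul, TensorProduct.tmul_add, hx, hy]
    | tmul c m =>
      induction t with
      | zero => simp
      | add x y hx hy => simp only [map_add, TensorProduct.add_tmul, TensorProduct.tmul_add, hx, hy]
      | tmul d n => simp

theorem map_id_coact {δ : M →ₗ[ℂ] C ⊗[ℂ] M} (m : M) :
    δ ((LinearMap.id : M →ₗ[ℂ] M) m) = TensorProduct.map (LinearMap.id : C →ₗ[ℂ] C)
      (LinearMap.id : M →ₗ[ℂ] M) (δ m) := by simp

theorem pre_id (f : Fn C) : f.pre LinearMap.id = f := rfl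

theorem act_assoc (δ : M →ₗ[ℂ] C ⊗[ℂ] M) (δ' : N →ₗ[ℂ] D ⊗[ℂ] N) (δ'' : P →ₗ[ℂ] E ⊗[ℂ] P)
    (f : Fn (C ⊗[ℂ] (D ⊗[ℂ] E))) (t : (M ⊗[ℂ] N) ⊗[ℂ] P) :
    act (tcoact δ (tcoact δ' δ'')) f (TensorProduct.assoc ℂ M N P t) =
      TensorProduct.assoc ℂ M N P (act (tcoact (tcoact δ δ') δ'')
        (f.pre (TensorProduct.assoc ℂ C D E).toLinearMap) t) :=
  act_map (TensorProduct.assoc ℂ C D E).toLinearMap (TensorProduct.assoc ℂ M N P).toLinearMap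
    (tcoact_assoc δ δ' δ'') f t

end TensorLemmas

section Cocycles

variable {A : Type u} [Ring A] [HopfAlgebra ℂ A]

/-- The `2`-cocycle condition
`γ(g₍₁₎ ⊗ h₍₁₎) γ(g₍₂₎ h₍₂₎ ⊗ k) = γ(h₍₁₎ ⊗ k₍₁₎) γ(g ⊗ h₍₂₎ k₍₂₎)`,
an equality of two convolution products of functionals on `A ⊗ A ⊗ A`. -/
def IsCocycle (f : Fn (A ⊗[ℂ] A)) : Prop :=
  extFn f 1 * f.pre ((LinearMap.mul' ℂ A).rTensor A) =
    (extFn 1 f * f.pre ((LinearMap.mul' ℂ A).lTensor A)).pre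
      (TensorProduct.assoc ℂ A A A).toLinearMap

/-- A unital `2`-cocycle on a Hopf algebra, together with its convolution inverse. -/
structure TwoCocycle (A : Type u) [Ring A] [HopfAlgebra ℂ A] where
  /-- the functional `γ` on `A ⊗ A` -/
  fn : Fn (A ⊗[ℂ] A)
  /-- the convolution inverse of `γ` -/
  inv : Fn (A ⊗[ℂ] A)
  fn_mul_inv : fn * inv = 1
  inv_mul_fn : inv * fn = 1
  isCocycle : IsCocycle fn
  fn_tmul_one : ∀ h : A, fn.ofConv (h ⊗ₜ 1) = Coalgebra.counit h
  fn_one_tmul : ∀ h : A, fn.ofConv (1 ⊗ₜ h) = Coalgebra.counit h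

theorem TwoCocycle.cocycle (γ : TwoCocycle A) :
    extFn γ.fn 1 * γ.fn.pre ((LinearMap.mul' ℂ A).rTensor A) =
    (extFn 1 γ.fn * γ.fn.pre ((LinearMap.mul' ℂ A).lTensor A)).pre
      (TensorProduct.assoc ℂ A A A).toLinearMap := γ.isCocycle

theorem comul_mul' (t : A ⊗[ℂ] A) : comul (R := ℂ) (LinearMap.mul' ℂ A t) =
    TensorProduct.map (LinearMap.mul' ℂ A) (LinearMap.mul' ℂ A) (comul t) := by
  induction t with
  | zero => simp
  | add x y hx hy => simp only [map_add, hx, hy]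
  | tmul a b =>
    simp only [LinearMap.mul'_apply, Bialgebra.comul_mul, comul_tensor, tcoact_tmul]
    generalize comul (R := ℂ) a = s, comul (R := ℂ) b = t
    induction s with
    | zero => simp
    | add x y hx hy => simp only [map_add, add_mul, TensorProduct.add_tmul, hx, hy]
    | tmul c m =>
      induction t with
      | zero => simp
      | add x y hx hy => simp only [map_add, mul_add, TensorProduct.tmul_add, hx, hy]
      | tmul d n => simp

theorem counit_mul' (t : A ⊗[ℂ] A) : Coalgebra.counit (R := ℂ) (LinearMap.mul' ℂ A t) =
    Coalgebra.counit t := by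
  induction t with
  | zero => simp
  | add x y hx hy => simp only [map_add, hx, hy]
  | tmul a b => simp [mul_comm]

theorem comul_assoc (t : (A ⊗[ℂ] A) ⊗[ℂ] A) :
    comul (R := ℂ) ((TensorProduct.assoc ℂ A A A).toLinearMap t) =
    TensorProduct.map (TensorProduct.assoc ℂ A A A).toLinearMap
      (TensorProduct.assoc ℂ A A A).toLinearMap (comul t) :=
  tcoact_assoc comul comul comul t

theorem comul_map {C D C' D' : Type*} [AddCommGroup C] [Module ℂ C] [Coalgebra ℂ C]
    [AddCommGroup D] [Module ℂ D] [Coalgebra ℂ D] [AddCommGroup C'] [Module ℂ C'] [Coalgebra ℂ C']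
    [AddCommGroup D'] [Module ℂ D'] [Coalgebra ℂ D'] (π : C →ₗ[ℂ] C') (ρ : D →ₗ[ℂ] D')
    (hp : ∀ m, comul (R := ℂ) (π m) = TensorProduct.map π π (comul m))
    (hq : ∀ n, comul (R := ℂ) (ρ n) = TensorProduct.map ρ ρ (comul n)) (t : C ⊗[ℂ] D) :
    comul (R := ℂ) (TensorProduct.map π ρ t) =
      TensorProduct.map (TensorProduct.map π ρ) (TensorProduct.map π ρ) (comul t) :=
  tcoact_map (δ := comul) (δ' := comul) (η := comul) (η' := comul) π ρ π ρ hp hq t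

theorem comul_mul_rTensor (t : (A ⊗[ℂ] A) ⊗[ℂ] A) :
    comul (R := ℂ) ((LinearMap.mul' ℂ A).rTensor A t) =
    TensorProduct.map ((LinearMap.mul' ℂ A).rTensor A) ((LinearMap.mul' ℂ A).rTensor A)
      (comul t) :=
  comul_map (LinearMap.mul' ℂ A) LinearMap.id comul_mul' (fun n => by simp) t

theorem comul_mul_lTensor (t : A ⊗[ℂ] (A ⊗[ℂ] A)) :
    comul (R := ℂ) ((LinearMap.mul' ℂ A).lTensor A t) =
    TensorProduct.map ((LinearMap.mul' ℂ A).lTensor A) ((LinearMap.mul' ℂ A).lTensor A)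
      (comul t) :=
  comul_map LinearMap.id (LinearMap.mul' ℂ A) (fun n => by simp) comul_mul' t

theorem extFn_pre {C D C' D' : Type*} [AddCommGroup C] [Module ℂ C]
    [AddCommGroup D] [Module ℂ D] [AddCommGroup C'] [Module ℂ C']
    [AddCommGroup D'] [Module ℂ D'] (π : C →ₗ[ℂ] C') (ρ : D →ₗ[ℂ] D') (f : Fn C') (g : Fn D') :
    (extFn f g).pre (TensorProduct.map π ρ) = extFn (f.pre π) (g.pre ρ) := by
  apply WithConv.ext
  ext c d
  simp [extFn, Fn.pre]

variable (γ : TwoCocycle A)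

theorem inv_unique {R : Type*} [Ring R] {a b a' b' c d c' d' : R} (h : a * b = c * d)
    (ha : a * a' = 1) (hb : b * b' = 1) (hc : c' * c = 1) (hd : d' * d = 1) :
    b' * a' = d' * c' := by
  have h1 : (a * b) * (b' * a') = 1 := by
    rw [mul_assoc, ← mul_assoc b, hb, one_mul, ha]
  have h2 : (d' * c') * (a * b) = 1 := by
    rw [h, mul_assoc, ← mul_assoc c', hc, one_mul, hd]
  exact (left_inv_eq_right_inv h2 h1).symm

/-- A morphism of coalgebras, as a property of a linear map. -/
def IsCoalgMap {C D : Type*} [AddCommGroup C] [Module ℂ C] [Coalgebra ℂ C]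
    [AddCommGroup D] [Module ℂ D] [Coalgebra ℂ D] (π : C →ₗ[ℂ] D) : Prop :=
  (∀ c, comul (R := ℂ) (π c) = TensorProduct.map π π (comul c)) ∧
    ∀ c, Coalgebra.counit (R := ℂ) (π c) = Coalgebra.counit c

theorem IsCoalgMap.pre_mul {C D : Type*} [AddCommGroup C] [Module ℂ C] [Coalgebra ℂ C]
    [AddCommGroup D] [Module ℂ D] [Coalgebra ℂ D] {π : C →ₗ[ℂ] D} (h : IsCoalgMap π)
    (f g : Fn D) : (f * g).pre π = f.pre π * g.pre π := CocycleTwist.pre_mul π h.1 f g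

theorem pre_pair_one {C D : Type*} [AddCommGroup C] [Module ℂ C] [Coalgebra ℂ C]
    [AddCommGroup D] [Module ℂ D] [Coalgebra ℂ D] {π : C →ₗ[ℂ] D} (h : IsCoalgMap π) {f g : Fn D}
    (hfg : f * g = 1) : f.pre π * g.pre π = 1 := by
  rw [← h.pre_mul, hfg, pre_one π h.2]

theorem counit_mul_rTensor (t : (A ⊗[ℂ] A) ⊗[ℂ] A) :
    Coalgebra.counit (R := ℂ) ((LinearMap.mul' ℂ A).rTensor A t) = Coalgebra.counit t := by
  induction t with
  | zero => simp
  | add x y hx hy => simp only [map_add, hx, hy]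
  | tmul s c => simp [counit_mul', TensorProduct.counit_tmul]

theorem counit_mul_lTensor (t : A ⊗[ℂ] (A ⊗[ℂ] A)) :
    Coalgebra.counit (R := ℂ) ((LinearMap.mul' ℂ A).lTensor A t) = Coalgebra.counit t := by
  induction t with
  | zero => simp
  | add x y hx hy => simp only [map_add, hx, hy]
  | tmul s c => simp [counit_mul', TensorProduct.counit_tmul]

theorem counit_assoc (t : (A ⊗[ℂ] A) ⊗[ℂ] A) :
    Coalgebra.counit (R := ℂ) ((TensorProduct.assoc ℂ A A A).toLinearMap t) =
      Coalgebra.counit t := by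
  induction t with
  | zero => simp
  | add x y hx hy => simp only [map_add, hx, hy]
  | tmul s c =>
    induction s with
    | zero => simp
    | add x y hx hy => simp only [map_add, TensorProduct.add_tmul, hx, hy]
    | tmul a b => simp [mul_assoc]

theorem isCoalgMap_mul (A : Type*) [Ring A] [HopfAlgebra ℂ A] :
    IsCoalgMap (LinearMap.mul' ℂ A) :=
  ⟨comul_mul' (A := A), counit_mul' (A := A)⟩

theorem isCoalgMap_rTensor (A : Type*) [Ring A] [HopfAlgebra ℂ A] :
    IsCoalgMap ((LinearMap.mul' ℂ A).rTensor A) :=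
  ⟨comul_mul_rTensor (A := A), counit_mul_rTensor (A := A)⟩

theorem isCoalgMap_lTensor (A : Type*) [Ring A] [HopfAlgebra ℂ A] :
    IsCoalgMap ((LinearMap.mul' ℂ A).lTensor A) :=
  ⟨comul_mul_lTensor (A := A), counit_mul_lTensor (A := A)⟩

theorem isCoalgMap_assoc (A : Type*) [Ring A] [HopfAlgebra ℂ A] :
    IsCoalgMap (TensorProduct.assoc ℂ A A A).toLinearMap :=
  ⟨comul_assoc (A := A), counit_assoc (A := A)⟩

theorem TwoCocycle.cocycle' :
    extFn γ.fn 1 * γ.fn.pre ((LinearMap.mul' ℂ A).rTensor A) =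
    (extFn 1 γ.fn).pre (TensorProduct.assoc ℂ A A A).toLinearMap *
      (γ.fn.pre ((LinearMap.mul' ℂ A).lTensor A)).pre
      (TensorProduct.assoc ℂ A A A).toLinearMap := by
  rw [γ.cocycle, (isCoalgMap_assoc A).pre_mul]

theorem extFn_pair_one {C D : Type*} [AddCommGroup C] [Module ℂ C] [Coalgebra ℂ C]
    [AddCommGroup D] [Module ℂ D] [Coalgebra ℂ D] {f f' : Fn C} {g g' : Fn D} (h : f * f' = 1)
    (h' : g * g' = 1) : extFn f g * extFn f' g' = 1 := by
  rw [extFn_mul, h, h', extFn_one]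

theorem TwoCocycle.inv_cocycle :
    γ.inv.pre ((LinearMap.mul' ℂ A).rTensor A) * extFn γ.inv 1 =
    (γ.inv.pre ((LinearMap.mul' ℂ A).lTensor A)).pre (TensorProduct.assoc ℂ A A A).toLinearMap *
      (extFn 1 γ.inv).pre (TensorProduct.assoc ℂ A A A).toLinearMap :=
  inv_unique γ.cocycle' (extFn_pair_one γ.fn_mul_inv (one_mul 1))
    (pre_pair_one (isCoalgMap_rTensor A) γ.fn_mul_inv)
    (pre_pair_one (isCoalgMap_assoc A) (extFn_pair_one (one_mul 1) γ.inv_mul_fn))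
    (pre_pair_one (isCoalgMap_assoc A)
      (pre_pair_one (isCoalgMap_lTensor A) γ.inv_mul_fn))

/-- The identity `γ(g₍₁₎ ⊗ h₍₁₎k₍₁₎) γ̄(g₍₂₎h₍₂₎ ⊗ k₍₂₎) = γ(g ⊗ h₍₂₎) γ̄(h₍₁₎ ⊗ k)`. -/
theorem TwoCocycle.mixed₁ :
    (γ.fn.pre ((LinearMap.mul' ℂ A).lTensor A)).pre (TensorProduct.assoc ℂ A A A).toLinearMap *
      γ.inv.pre ((LinearMap.mul' ℂ A).rTensor A) =
    (extFn 1 γ.inv).pre (TensorProduct.assoc ℂ A A A).toLinearMap * extFn γ.fn 1 := by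
  have h1 := γ.cocycle'
  have h2 : (extFn 1 γ.inv).pre (TensorProduct.assoc ℂ A A A).toLinearMap *
      (extFn 1 γ.fn).pre (TensorProduct.assoc ℂ A A A).toLinearMap = 1 :=
    pre_pair_one (isCoalgMap_assoc A) (extFn_pair_one (one_mul 1) γ.inv_mul_fn)
  have h3 : γ.fn.pre ((LinearMap.mul' ℂ A).rTensor A) *
      γ.inv.pre ((LinearMap.mul' ℂ A).rTensor A) = 1 :=
    pre_pair_one (isCoalgMap_rTensor A) γ.fn_mul_inv
  calc _ = ((extFn 1 γ.inv).pre (TensorProduct.assoc ℂ A A A).toLinearMap *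
      ((extFn 1 γ.fn).pre (TensorProduct.assoc ℂ A A A).toLinearMap *
      (γ.fn.pre ((LinearMap.mul' ℂ A).lTensor A)).pre (TensorProduct.assoc ℂ A A A).toLinearMap)) *
      γ.inv.pre ((LinearMap.mul' ℂ A).rTensor A) := by rw [← mul_assoc, h2, one_mul]
    _ = _ := by rw [← h1, mul_assoc, mul_assoc, h3, mul_one]

/-- The identity `γ(g₍₁₎h₍₁₎ ⊗ k₍₁₎) γ̄(g₍₂₎ ⊗ h₍₂₎k₍₂₎) = γ̄(g ⊗ h₍₁₎) γ(h₍₂₎ ⊗ k)`. -/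
theorem TwoCocycle.mixed₂ :
    γ.fn.pre ((LinearMap.mul' ℂ A).rTensor A) *
      (γ.inv.pre ((LinearMap.mul' ℂ A).lTensor A)).pre (TensorProduct.assoc ℂ A A A).toLinearMap =
    extFn γ.inv 1 * (extFn 1 γ.fn).pre (TensorProduct.assoc ℂ A A A).toLinearMap := by
  have h1 := γ.cocycle'
  have h2 : extFn γ.inv 1 * extFn γ.fn 1 = (1 : Fn ((A ⊗[ℂ] A) ⊗[ℂ] A)) :=
    extFn_pair_one γ.inv_mul_fn (one_mul 1)
  have h3 : (γ.fn.pre ((LinearMap.mul' ℂ A).lTensor A)).pre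
        (TensorProduct.assoc ℂ A A A).toLinearMap *
      (γ.inv.pre ((LinearMap.mul' ℂ A).lTensor A)).pre
        (TensorProduct.assoc ℂ A A A).toLinearMap = 1 :=
    pre_pair_one (isCoalgMap_assoc A)
      (pre_pair_one (isCoalgMap_lTensor A) γ.fn_mul_inv)
  calc _ = (extFn γ.inv 1 * (extFn γ.fn 1 * γ.fn.pre ((LinearMap.mul' ℂ A).rTensor A))) *
      (γ.inv.pre ((LinearMap.mul' ℂ A).lTensor A)).pre
        (TensorProduct.assoc ℂ A A A).toLinearMap := by
        rw [← mul_assoc (extFn γ.inv 1), h2, one_mul]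
    _ = _ := by rw [h1, mul_assoc, mul_assoc, h3, mul_one]

variable {V W Y B : Type*} [AddCommGroup V] [Module ℂ V] [AddCommGroup W] [Module ℂ W]
  [AddCommGroup Y] [Module ℂ Y] [AddCommGroup B] [Module ℂ B]

/-- Associativity of twisted bilinear operations. -/
theorem twist_assoc {δV : V →ₗ[ℂ] A ⊗[ℂ] V} {δW : W →ₗ[ℂ] A ⊗[ℂ] W} {δB : B →ₗ[ℂ] A ⊗[ℂ] B}
    (hV : IsCoaction δV) (hW : IsCoaction δW) (hB : IsCoaction δB)
    (p : V ⊗[ℂ] B →ₗ[ℂ] V) (q : B ⊗[ℂ] W →ₗ[ℂ] W) (r : V ⊗[ℂ] W →ₗ[ℂ] Y)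
    (hp : ∀ t, δV (p t) = TensorProduct.map (LinearMap.mul' ℂ A) p (tcoact δV δB t))
    (hq : ∀ t, δW (q t) = TensorProduct.map (LinearMap.mul' ℂ A) q (tcoact δB δW t))
    (hr : ∀ v b w, r (p (v ⊗ₜ b) ⊗ₜ w) = r (v ⊗ₜ q (b ⊗ₜ w))) (v : V) (b : B) (w : W) :
    r (act (tcoact δV δW) γ.fn (p (act (tcoact δV δB) γ.fn (v ⊗ₜ b)) ⊗ₜ w)) =
    r (act (tcoact δV δW) γ.fn (v ⊗ₜ q (act (tcoact δB δW) γ.fn (b ⊗ₜ w)))) := by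
  have h3 := isCoaction_tcoact (isCoaction_tcoact hV hB) hW
  have e1 : act (tcoact δV δW) γ.fn (p (act (tcoact δV δB) γ.fn (v ⊗ₜ b)) ⊗ₜ w) =
      TensorProduct.map p LinearMap.id (act (tcoact (tcoact δV δB) δW)
        (extFn γ.fn 1 * γ.fn.pre ((LinearMap.mul' ℂ A).rTensor A)) ((v ⊗ₜ b) ⊗ₜ w)) := by
    rw [act_mul h3, act_tcoact, act_one hW]
    exact act_map ((LinearMap.mul' ℂ A).rTensor A) (TensorProduct.map p LinearMap.id)
      (fun t => tcoact_map (LinearMap.mul' ℂ A) LinearMap.id p LinearMap.id hp map_id_coact t)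
      γ.fn (act (tcoact δV δB) γ.fn (v ⊗ₜ b) ⊗ₜ w)
  have e2 : act (tcoact δV δW) γ.fn (v ⊗ₜ q (act (tcoact δB δW) γ.fn (b ⊗ₜ w))) =
      TensorProduct.map LinearMap.id q (TensorProduct.assoc ℂ V B W
        (act (tcoact (tcoact δV δB) δW)
        (extFn γ.fn 1 * γ.fn.pre ((LinearMap.mul' ℂ A).rTensor A)) ((v ⊗ₜ b) ⊗ₜ w))) := by
    rw [γ.cocycle, ← act_assoc, act_mul (isCoaction_tcoact hV (isCoaction_tcoact hB hW)),
      TensorProduct.assoc_tmul, act_tcoact, act_one hV]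
    exact act_map ((LinearMap.mul' ℂ A).lTensor A) (TensorProduct.map LinearMap.id q)
      (fun t => tcoact_map LinearMap.id (LinearMap.mul' ℂ A) LinearMap.id q map_id_coact hq t)
      γ.fn (v ⊗ₜ act (tcoact δB δW) γ.fn (b ⊗ₜ w))
  rw [e1, e2]
  generalize act (tcoact (tcoact δV δB) δW) _ ((v ⊗ₜ b) ⊗ₜ w) = t
  induction t with
  | zero => simp
  | add x y hx hy => simp only [map_add, hx, hy]
  | tmul s w =>
    induction s with
    | zero => simp
    | add x y hx hy => simp only [map_add, TensorProduct.add_tmul, hx, hy]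
    | tmul v b => simpa using hr v b w

/-- The twisted product `h ·_γ k = γ(h₍₁₎ ⊗ k₍₁₎) h₍₂₎ k₍₂₎ γ̄(h₍₃₎ ⊗ k₍₃₎)` on `A`. -/
noncomputable def hopfMul : A ⊗[ℂ] A →ₗ[ℂ] A :=
  LinearMap.mul' ℂ A ∘ₗ lact γ.fn ∘ₗ ract γ.inv

theorem hopfMul_apply (t : A ⊗[ℂ] A) :
    hopfMul γ t = LinearMap.mul' ℂ A (lact γ.fn (ract γ.inv t)) := rfl

theorem lact_ract_mul {C : Type*} [AddCommGroup C] [Module ℂ C] [Coalgebra ℂ C]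
    (f g h k : Fn C) (x : C) :
    lact (f * g) (ract (h * k) x) = lact g (ract h (lact f (ract k x))) := by
  rw [lact_mul, ract_mul, lact_ract f]

theorem lact_ract_map {C D : Type*} [AddCommGroup C] [Module ℂ C] [Coalgebra ℂ C]
    [AddCommGroup D] [Module ℂ D] [Coalgebra ℂ D] {π : C →ₗ[ℂ] D} (h : IsCoalgMap π) (f g : Fn D)
    (c : C) : π (lact (f.pre π) (ract (g.pre π) c)) = lact f (ract g (π c)) := by
  rw [ract_map π h.1, lact_map π h.1]

theorem lact_ract_left {C D : Type*} [AddCommGroup C] [Module ℂ C] [Coalgebra ℂ C]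
    [AddCommGroup D] [Module ℂ D] [Coalgebra ℂ D] (f g : Fn C) (c : C) (d : D) :
    lact (extFn f 1) (ract (extFn g 1) (c ⊗ₜ d)) = lact f (ract g c) ⊗ₜ d := by
  rw [ract_extFn, ract_one, lact_extFn, lact_one]

theorem lact_ract_right {C D : Type*} [AddCommGroup C] [Module ℂ C] [Coalgebra ℂ C]
    [AddCommGroup D] [Module ℂ D] [Coalgebra ℂ D] (f g : Fn D) (c : C) (d : D) :
    lact (extFn 1 f) (ract (extFn 1 g) (c ⊗ₜ d)) = c ⊗ₜ lact f (ract g d) := by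
  rw [ract_extFn, ract_one, lact_extFn, lact_one]

theorem lact_ract_step {C D : Type*} [AddCommGroup C] [Module ℂ C] [Coalgebra ℂ C]
    [AddCommGroup D] [Module ℂ D] [Coalgebra ℂ D] {π : C →ₗ[ℂ] D} (h : IsCoalgMap π)
    (f k : Fn C) (g l : Fn D) (x y : C) (hy : lact f (ract k x) = y) :
    π (lact (f * g.pre π) (ract (l.pre π * k) x)) = lact g (ract l (π y)) := by
  rw [lact_ract_mul, lact_ract_map h, hy]

theorem assoc_core {T T' P Q : Type*} [AddCommGroup T] [Module ℂ T] [Coalgebra ℂ T]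
    [AddCommGroup T'] [Module ℂ T'] [Coalgebra ℂ T'] [AddCommGroup P] [Module ℂ P] [Coalgebra ℂ P]
    [AddCommGroup Q] [Module ℂ Q] (μ : P →ₗ[ℂ] Q) {ρ : T →ₗ[ℂ] P} {κ : T' →ₗ[ℂ] P}
    {α : T →ₗ[ℂ] T'} (hρ : IsCoalgMap ρ) (hκ : IsCoalgMap κ) (hα : IsCoalgMap α) {f g : Fn P}
    {F₁ G₁ : Fn T} {F₂ G₂ : Fn T'} (hF : F₁ * f.pre ρ = (F₂ * f.pre κ).pre α)
    (hG : g.pre ρ * G₁ = (g.pre κ * G₂).pre α) (hμ : ∀ t, μ (ρ t) = μ (κ (α t))) {x y : T} {z : T'}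
    (hy : lact F₁ (ract G₁ x) = y) (hz : lact F₂ (ract G₂ (α x)) = z) :
    μ (lact f (ract g (ρ y))) = μ (lact f (ract g (κ z))) := by
  rw [← lact_ract_step hρ F₁ G₁ f g x y hy, ← lact_ract_step hκ F₂ G₂ f g (α x) z hz, hF, hG, hμ,
    lact_ract_map hα]

theorem mul_rTensor_lTensor (t : (A ⊗[ℂ] A) ⊗[ℂ] A) :
    LinearMap.mul' ℂ A ((LinearMap.mul' ℂ A).rTensor A t) = LinearMap.mul' ℂ A
      ((LinearMap.mul' ℂ A).lTensor A ((TensorProduct.assoc ℂ A A A).toLinearMap t)) := by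
  induction t with
  | zero => simp
  | add x y hx hy => simp only [map_add, hx, hy]
  | tmul s w =>
    induction s with
    | zero => simp
    | add x y hx hy => simp only [map_add, TensorProduct.add_tmul, hx, hy]
    | tmul v b => simp [mul_assoc]

theorem hopfMul_assoc (a b c : A) :
    hopfMul γ (hopfMul γ (a ⊗ₜ b) ⊗ₜ c) = hopfMul γ (a ⊗ₜ hopfMul γ (b ⊗ₜ c)) := by
  have hG := γ.inv_cocycle.trans ((isCoalgMap_assoc A).pre_mul
    (γ.inv.pre ((LinearMap.mul' ℂ A).lTensor A)) (extFn 1 γ.inv)).symm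
  have h := assoc_core (LinearMap.mul' ℂ A) (isCoalgMap_rTensor A) (isCoalgMap_lTensor A)
    (isCoalgMap_assoc A) (f := γ.fn) (g := γ.inv) γ.cocycle hG mul_rTensor_lTensor
    (x := (a ⊗ₜ b) ⊗ₜ c) (lact_ract_left γ.fn γ.inv (a ⊗ₜ b) c)
    (lact_ract_right γ.fn γ.inv a (b ⊗ₜ c))
  exact h

end Cocycles


section TwistBialgebra

variable {C : Type*} [AddCommGroup C] [Module ℂ C] [Coalgebra ℂ C]

theorem comul_lact (f : Fn C) (c : C) : comul (R := ℂ) (lact f c) = (lact f).rTensor C (comul c) :=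
  coact_act isCoaction_comul f c

theorem comul_ract (f : Fn C) (c : C) :
    comul (R := ℂ) (ract f c) = (ract f).lTensor C (comul c) := by
  have key : ∀ t : C ⊗[ℂ] C, comul (R := ℂ) (TensorProduct.rid ℂ C (f.ofConv.lTensor C t)) =
      LinearMap.lTensor C ((TensorProduct.rid ℂ C).toLinearMap ∘ₗ f.ofConv.lTensor C)
        (TensorProduct.assoc ℂ C C C (comul.rTensor C t)) := by
    intro t
    induction t with
    | zero => simp
    | add x y hx hy => simp only [map_add, hx, hy]
    | tmul c m =>
      simp only [LinearMap.lTensor_tmul, TensorProduct.rid_tmul, map_smul, LinearMap.rTensor_tmul]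
      induction comul (R := ℂ) c with
      | zero => simp
      | add x y hx hy => simp only [map_add, TensorProduct.add_tmul, smul_add, hx, hy]
      | tmul c d => simp
  calc comul (R := ℂ) (ract f c) =
      comul (R := ℂ) (TensorProduct.rid ℂ C (f.ofConv.lTensor C (comul c))) := rfl
    _ = _ := by
      rw [key, coassoc_apply, ← LinearMap.comp_apply, ← LinearMap.lTensor_comp]; rfl

theorem lTensor_lact (f : Fn C) (c : C) :
    (lact f).lTensor C (comul (R := ℂ) c) = (ract f).rTensor C (comul c) :=
  lTensor_act isCoaction_comul f c

theorem counit_lact (f : Fn C) (c : C) : Coalgebra.counit (R := ℂ) (lact f c) = f.ofConv c := by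
  have key : ∀ t : C ⊗[ℂ] C, Coalgebra.counit (R := ℂ) (TensorProduct.lid ℂ C (f.ofConv.rTensor C t)) =
      f.ofConv (TensorProduct.rid ℂ C ((Coalgebra.counit (R := ℂ)).lTensor C t)) := by
    intro t
    induction t with
    | zero => simp
    | add x y hx hy => simp only [map_add, hx, hy]
    | tmul c m => simp [mul_comm]
  calc _ = Coalgebra.counit (R := ℂ) (TensorProduct.lid ℂ C (f.ofConv.rTensor C (comul c))) := rfl
    _ = _ := by rw [key, lTensor_counit_comul]; simp

theorem counit_ract (f : Fn C) (c : C) : Coalgebra.counit (R := ℂ) (ract f c) = f.ofConv c := by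
  have key : ∀ t : C ⊗[ℂ] C, Coalgebra.counit (R := ℂ) (TensorProduct.rid ℂ C (f.ofConv.lTensor C t)) =
      f.ofConv (TensorProduct.lid ℂ C ((Coalgebra.counit (R := ℂ)).rTensor C t)) := by
    intro t
    induction t with
    | zero => simp
    | add x y hx hy => simp only [map_add, hx, hy]
    | tmul c m => simp [mul_comm]
  calc _ = Coalgebra.counit (R := ℂ) (TensorProduct.rid ℂ C (f.ofConv.lTensor C (comul c))) := rfl
    _ = _ := by rw [key, rTensor_counit_comul]; simp

theorem ofConv_lact (f g : Fn C) (c : C) : g.ofConv (lact f c) = (f * g).ofConv c := by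
  rw [← counit_lact, ← lact_mul, counit_lact]

theorem ofConv_ract (f g : Fn C) (c : C) : g.ofConv (ract f c) = (g * f).ofConv c := by
  rw [← counit_ract, ← ract_mul, counit_ract]

variable {A : Type u} [Ring A] [HopfAlgebra ℂ A] (γ : TwoCocycle A)

theorem comul_tmul_one (a : A) : comul (R := ℂ) ((TensorProduct.mk ℂ A A).flip 1 a) =
    TensorProduct.map ((TensorProduct.mk ℂ A A).flip 1) ((TensorProduct.mk ℂ A A).flip 1)
      (comul a) := by
  simp only [LinearMap.flip_apply, TensorProduct.mk_apply, comul_tensor, tcoact_tmul,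
    Bialgebra.comul_one]
  induction comul (R := ℂ) a with
  | zero => simp
  | add x y hx hy => simp only [map_add, TensorProduct.add_tmul, hx, hy]
  | tmul c m => simp [Algebra.TensorProduct.one_def]

theorem comul_one_tmul (a : A) : comul (R := ℂ) (TensorProduct.mk ℂ A A 1 a) =
    TensorProduct.map (TensorProduct.mk ℂ A A 1) (TensorProduct.mk ℂ A A 1) (comul a) := by
  simp only [TensorProduct.mk_apply, comul_tensor, tcoact_tmul, Bialgebra.comul_one]
  induction comul (R := ℂ) a with
  | zero => simp
  | add x y hx hy => simp only [map_add, TensorProduct.tmul_add, hx, hy]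
  | tmul c m => simp [Algebra.TensorProduct.one_def]

theorem TwoCocycle.fn_pre_right : γ.fn.pre ((TensorProduct.mk ℂ A A).flip 1) = 1 :=
  WithConv.ext (LinearMap.ext fun a => γ.fn_tmul_one a)

theorem TwoCocycle.fn_pre_left : γ.fn.pre (TensorProduct.mk ℂ A A 1) = 1 :=
  WithConv.ext (LinearMap.ext fun a => γ.fn_one_tmul a)

theorem TwoCocycle.inv_pre_right : γ.inv.pre ((TensorProduct.mk ℂ A A).flip 1) = 1 := by
  have := pre_mul ((TensorProduct.mk ℂ A A).flip 1) comul_tmul_one γ.fn γ.inv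
  rw [γ.fn_pre_right, γ.fn_mul_inv, one_mul] at this
  rw [← this, pre_one]
  intro c; simp

theorem TwoCocycle.inv_pre_left : γ.inv.pre (TensorProduct.mk ℂ A A 1) = 1 := by
  have := pre_mul (TensorProduct.mk ℂ A A 1) comul_one_tmul γ.fn γ.inv
  rw [γ.fn_pre_left, γ.fn_mul_inv, one_mul] at this
  rw [← this, pre_one]
  intro c; simp

theorem TwoCocycle.inv_tmul_one (a : A) : γ.inv.ofConv (a ⊗ₜ 1) = Coalgebra.counit a :=
  congrArg (fun f : Fn A => f.ofConv a) γ.inv_pre_right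

theorem TwoCocycle.inv_one_tmul (a : A) : γ.inv.ofConv (1 ⊗ₜ a) = Coalgebra.counit a :=
  congrArg (fun f : Fn A => f.ofConv a) γ.inv_pre_left

theorem hopfMul_one (a : A) : hopfMul γ (a ⊗ₜ 1) = a := by
  change hopfMul γ ((TensorProduct.mk ℂ A A).flip 1 a) = a
  rw [hopfMul_apply, ract_map _ comul_tmul_one, γ.inv_pre_right, ract_one, lact_map _ comul_tmul_one,
    γ.fn_pre_right, lact_one]
  simp

theorem one_hopfMul (a : A) : hopfMul γ (1 ⊗ₜ a) = a := by
  change hopfMul γ (TensorProduct.mk ℂ A A 1 a) = a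
  rw [hopfMul_apply, ract_map _ comul_one_tmul, γ.inv_pre_left, ract_one, lact_map _ comul_one_tmul,
    γ.fn_pre_left, lact_one]
  simp

theorem comul_hopfMul (t : A ⊗[ℂ] A) : comul (R := ℂ) (hopfMul γ t) =
    TensorProduct.map (hopfMul γ) (hopfMul γ) (comul t) := by
  have e1 : comul (R := ℂ) (hopfMul γ t) = TensorProduct.map (LinearMap.mul' ℂ A ∘ₗ lact γ.fn)
      (LinearMap.mul' ℂ A ∘ₗ ract γ.inv) (comul t) := by
    rw [hopfMul_apply, comul_mul', comul_lact, comul_ract]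
    generalize comul (R := ℂ) t = s
    induction s with
    | zero => simp
    | add x y hx hy => simp only [map_add, hx, hy]
    | tmul c m => simp
  have e2 : ∀ s, TensorProduct.map (hopfMul γ) (hopfMul γ) s =
      TensorProduct.map (LinearMap.mul' ℂ A ∘ₗ lact γ.fn ∘ₗ ract γ.inv)
      (LinearMap.mul' ℂ A ∘ₗ ract γ.inv) ((lact γ.fn).lTensor (A ⊗[ℂ] A) s) := by
    intro s
    induction s with
    | zero => simp
    | add x y hx hy => simp only [map_add, hx, hy]
    | tmul c m =>
      simp only [TensorProduct.map_tmul, LinearMap.comp_apply, LinearMap.lTensor_tmul,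
        hopfMul_apply, lact_ract]
  rw [e1, e2, lTensor_lact]
  generalize comul (R := ℂ) t = s
  induction s with
  | zero => simp
  | add x y hx hy => simp only [map_add, hx, hy]
  | tmul c m =>
    simp only [TensorProduct.map_tmul, LinearMap.comp_apply, LinearMap.rTensor_tmul]
    rw [← ract_mul, γ.inv_mul_fn, ract_one]

theorem counit_hopfMul (t : A ⊗[ℂ] A) : Coalgebra.counit (R := ℂ) (hopfMul γ t) =
    Coalgebra.counit t := by
  rw [hopfMul_apply, counit_mul', counit_lact, ofConv_ract, γ.fn_mul_inv, one_apply]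

theorem mul'_lact (t : A ⊗[ℂ] A) :
    LinearMap.mul' ℂ A (lact γ.fn t) = hopfMul γ (ract γ.fn t) := by
  rw [hopfMul_apply, ← ract_mul, γ.inv_mul_fn, ract_one]

theorem mul'_ract (t : A ⊗[ℂ] A) :
    LinearMap.mul' ℂ A (ract γ.inv t) = hopfMul γ (lact γ.inv t) := by
  rw [hopfMul_apply, ← lact_ract, ← lact_mul, γ.inv_mul_fn, lact_one]

end TwistBialgebra


section Middle

variable {C : Type*} [AddCommGroup C] [Module ℂ C] [Coalgebra ℂ C]
variable {X Y : Type*} [AddCommGroup X] [Module ℂ X] [AddCommGroup Y] [Module ℂ Y]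

theorem comul_comul (h : C) : TensorProduct.map comul comul (comul (R := ℂ) h) =
    (TensorProduct.assoc ℂ C C (C ⊗[ℂ] C)).symm ((TensorProduct.assoc ℂ C C C).toLinearMap.lTensor C
      ((comul.rTensor C ∘ₗ comul).lTensor C (comul (R := ℂ) h))) := by
  have e1 : ∀ t : C ⊗[ℂ] C, TensorProduct.map comul comul t = (comul (R := ℂ)).lTensor (C ⊗[ℂ] C)
      (comul.rTensor C t) := by
    intro t
    induction t with
    | zero => simp
    | add x y hx hy => simp only [map_add, hx, hy]
    | tmul c m => simp
  have e2 : ∀ t : C ⊗[ℂ] (C ⊗[ℂ] C), (comul (R := ℂ)).lTensor (C ⊗[ℂ] C)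
      ((TensorProduct.assoc ℂ C C C).symm t) = (TensorProduct.assoc ℂ C C (C ⊗[ℂ] C)).symm
        (((comul (R := ℂ)).lTensor C).lTensor C t) := by
    intro t
    induction t with
    | zero => simp
    | add x y hx hy => simp only [map_add, hx, hy]
    | tmul c t =>
      induction t with
      | zero => simp
      | add x y hx hy => simp only [map_add, TensorProduct.tmul_add, hx, hy]
      | tmul d e => simp
  rw [e1, ← (TensorProduct.assoc ℂ C C C).symm_apply_apply (comul.rTensor C (comul (R := ℂ) h)),
    coassoc_apply, e2]
  have e3 : (comul (R := ℂ) (A := C)).lTensor C ∘ₗ comul =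
      (TensorProduct.assoc ℂ C C C).toLinearMap ∘ₗ comul.rTensor C ∘ₗ comul := coassoc.symm
  rw [← LinearMap.lTensor_comp_apply, ← LinearMap.lTensor_comp_apply, e3]

theorem mid_eval (G : C ⊗[ℂ] C →ₗ[ℂ] X) (K : C ⊗[ℂ] (X ⊗[ℂ] C) →ₗ[ℂ] Y)
    (E : (C ⊗[ℂ] C) ⊗[ℂ] (C ⊗[ℂ] C) →ₗ[ℂ] Y)
    (hE : ∀ a b c d, E ((a ⊗ₜ b) ⊗ₜ (c ⊗ₜ d)) = K (a ⊗ₜ (G (b ⊗ₜ c) ⊗ₜ d))) (h : C) :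
    E (TensorProduct.map comul comul (comul (R := ℂ) h)) =
      K (((G ∘ₗ comul).rTensor C ∘ₗ comul).lTensor C (comul h)) := by
  rw [comul_comul]
  have key : ∀ t : C ⊗[ℂ] ((C ⊗[ℂ] C) ⊗[ℂ] C), E ((TensorProduct.assoc ℂ C C (C ⊗[ℂ] C)).symm
      ((TensorProduct.assoc ℂ C C C).toLinearMap.lTensor C t)) = K ((G.rTensor C).lTensor C t) := by
    intro t
    induction t with
    | zero => simp
    | add x y hx hy => simp only [map_add, hx, hy]
    | tmul a t =>
      induction t with
      | zero => simp
      | add x y hx hy => simp only [map_add, TensorProduct.tmul_add, hx, hy]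
      | tmul t d =>
        induction t with
        | zero => simp
        | add x y hx hy => simp only [map_add, TensorProduct.add_tmul, TensorProduct.tmul_add, hx, hy]
        | tmul b c => simp [hE]
  rw [key, ← LinearMap.lTensor_comp_apply, ← LinearMap.comp_assoc, ← LinearMap.rTensor_comp]

theorem mid_fn (f : C ⊗[ℂ] C →ₗ[ℂ] ℂ) (K : C ⊗[ℂ] C →ₗ[ℂ] Y)
    (E : (C ⊗[ℂ] C) ⊗[ℂ] (C ⊗[ℂ] C) →ₗ[ℂ] Y)
    (hE : ∀ a b c d, E ((a ⊗ₜ b) ⊗ₜ (c ⊗ₜ d)) = f (b ⊗ₜ c) • K (a ⊗ₜ d)) (h : C) :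
    E (TensorProduct.map comul comul (comul (R := ℂ) h)) =
      K ((lact (toConv (f ∘ₗ comul))).lTensor C (comul h)) := by
  rw [mid_eval f (K ∘ₗ (TensorProduct.lid ℂ C).toLinearMap.lTensor C) E (by simpa using hE),
    LinearMap.comp_apply, ← LinearMap.comp_apply (LinearMap.lTensor C _), ← LinearMap.lTensor_comp]
  rfl

theorem mid_one {A : Type*} [Ring A] [Bialgebra ℂ A] (G : A ⊗[ℂ] A →ₗ[ℂ] A)
    (hG : ∀ a, G (comul a) = algebraMap ℂ A (Coalgebra.counit a)) (K : A ⊗[ℂ] (A ⊗[ℂ] A) →ₗ[ℂ] Y)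
    (E : (A ⊗[ℂ] A) ⊗[ℂ] (A ⊗[ℂ] A) →ₗ[ℂ] Y)
    (hE : ∀ a b c d, E ((a ⊗ₜ b) ⊗ₜ (c ⊗ₜ d)) = K (a ⊗ₜ (G (b ⊗ₜ c) ⊗ₜ d))) (h : A) :
    E (TensorProduct.map comul comul (comul (R := ℂ) h)) =
      K ((TensorProduct.mk ℂ A A 1).lTensor A (comul h)) := by
  rw [mid_eval G K E hE]
  congr 3
  ext a
  have : G ∘ₗ comul = Algebra.linearMap ℂ A ∘ₗ Coalgebra.counit := LinearMap.ext hG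
  rw [this, LinearMap.rTensor_comp, LinearMap.comp_assoc]
  have h2 := rTensor_counit_comul (R := ℂ) a
  simp only [LinearMap.comp_apply, h2]
  simp

end Middle

section Antipode

open HopfAlgebra

variable {A : Type u} [Ring A] [HopfAlgebra ℂ A]

theorem comul_antipode (a : A) : comul (R := ℂ) (antipode ℂ a) =
    TensorProduct.map (antipode ℂ) (antipode ℂ) (TensorProduct.comm ℂ A A (comul a)) := by
  let δ : A →ₗ[ℂ] A ⊗[ℂ] A := comul
  let X : A →ₗ[ℂ] A ⊗[ℂ] A := TensorProduct.map (antipode ℂ) (antipode ℂ) ∘ₗ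
    (TensorProduct.comm ℂ A A).toLinearMap ∘ₗ comul
  have h1 : toConv X * toConv δ = 1 := by
    apply WithConv.ext
    ext a
    let E : (A ⊗[ℂ] A) ⊗[ℂ] (A ⊗[ℂ] A) →ₗ[ℂ] A ⊗[ℂ] A := LinearMap.mul' ℂ (A ⊗[ℂ] A) ∘ₗ
      TensorProduct.map (TensorProduct.map (antipode ℂ) (antipode ℂ) ∘ₗ
        (TensorProduct.comm ℂ A A).toLinearMap) LinearMap.id
    let K : A ⊗[ℂ] (A ⊗[ℂ] A) →ₗ[ℂ] A ⊗[ℂ] A := (TensorProduct.comm ℂ A A).toLinearMap ∘ₗ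
      (LinearMap.mul' ℂ A ∘ₗ (antipode ℂ).rTensor A).rTensor A ∘ₗ
      (TensorProduct.assoc ℂ A A A).symm.toLinearMap ∘ₗ
      ((TensorProduct.comm ℂ A A).toLinearMap).lTensor A
    have h := mid_one (LinearMap.mul' ℂ A ∘ₗ (antipode ℂ).rTensor A) (by simp) K E
      (fun a b c d => by simp [E, K]) a
    have h2 : (toConv X * toConv δ).ofConv a =
      E (TensorProduct.map comul comul (comul (R := ℂ) a)) := by
      change LinearMap.mul' ℂ (A ⊗[ℂ] A) (TensorProduct.map X δ (comul a)) = _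
      generalize comul (R := ℂ) a = t
      induction t with
      | zero => simp
      | add x y hx hy => simp only [map_add, hx, hy]
      | tmul c m => simp [E, X, δ]
    have h3 : ∀ t : A ⊗[ℂ] A, K ((TensorProduct.mk ℂ A A 1).lTensor A t) =
        1 ⊗ₜ LinearMap.mul' ℂ A ((antipode ℂ).rTensor A t) := by
      intro t
      induction t with
      | zero => simp
      | add x y hx hy => simp only [map_add, TensorProduct.tmul_add, hx, hy]
      | tmul c m => simp [K]
    rw [h2, h, h3]
    simp [Algebra.algebraMap_eq_smul_one, Algebra.TensorProduct.one_def]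
  have h2 : toConv δ * toConv (δ ∘ₗ antipode ℂ) = 1 := LinearMap.comul_right_inv
  exact (LinearMap.congr_fun (congrArg WithConv.ofConv (left_inv_eq_right_inv h1 h2)) a).symm

/-- `h ↦ h₍₁₎ ⊗ S(h₍₂₎)` -/
noncomputable def idS : A →ₗ[ℂ] A ⊗[ℂ] A := (antipode ℂ).lTensor A ∘ₗ comul

/-- `h ↦ S(h₍₁₎) ⊗ h₍₂₎` -/
noncomputable def sId : A →ₗ[ℂ] A ⊗[ℂ] A := (antipode ℂ).rTensor A ∘ₗ comul

theorem mul'_idS (h : A) : LinearMap.mul' ℂ A (idS h) = algebraMap ℂ A (Coalgebra.counit h) := by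
  simp [idS]

theorem mul'_sId (h : A) : LinearMap.mul' ℂ A (sId h) = algebraMap ℂ A (Coalgebra.counit h) := by
  simp [sId]

theorem comul_idS (h : A) : comul (R := ℂ) (idS h) =
    (((antipode ℂ).lTensor A).lTensor (A ⊗[ℂ] A) ∘ₗ ((antipode ℂ).lTensor A).rTensor (A ⊗[ℂ] A) ∘ₗ
      (TensorProduct.tensorTensorTensorComm ℂ A A A A).toLinearMap ∘ₗ
      ((TensorProduct.comm ℂ A A).toLinearMap.lTensor (A ⊗[ℂ] A)))
      (TensorProduct.map comul comul (comul (R := ℂ) h)) := by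
  rw [comul_tensor, idS, LinearMap.comp_apply]
  generalize comul (R := ℂ) h = t
  induction t with
  | zero => simp
  | add x y hx hy => simp only [map_add, hx, hy]
  | tmul a b =>
    simp only [LinearMap.lTensor_tmul, tcoact_tmul, comul_antipode, LinearMap.comp_apply,
      LinearEquiv.coe_coe, TensorProduct.map_tmul]
    generalize comul (R := ℂ) a = s, comul (R := ℂ) b = t
    induction s with
    | zero => simp
    | add x y hx hy => simp only [map_add, TensorProduct.add_tmul, hx, hy]
    | tmul a a' =>
      induction t with
      | zero => simp
      | add x y hx hy => simp only [map_add, TensorProduct.tmul_add, hx, hy]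
      | tmul d n => simp

theorem comul_sId (h : A) : comul (R := ℂ) (sId h) =
    (((antipode ℂ).rTensor A).lTensor (A ⊗[ℂ] A) ∘ₗ ((antipode ℂ).rTensor A).rTensor (A ⊗[ℂ] A) ∘ₗ
      (TensorProduct.tensorTensorTensorComm ℂ A A A A).toLinearMap ∘ₗ
      ((TensorProduct.comm ℂ A A).toLinearMap.rTensor (A ⊗[ℂ] A)))
      (TensorProduct.map comul comul (comul (R := ℂ) h)) := by
  rw [comul_tensor, sId, LinearMap.comp_apply]
  generalize comul (R := ℂ) h = t
  induction t with
  | zero => simp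
  | add x y hx hy => simp only [map_add, hx, hy]
  | tmul a b =>
    simp only [LinearMap.rTensor_tmul, tcoact_tmul, comul_antipode, LinearMap.comp_apply,
      LinearEquiv.coe_coe, TensorProduct.map_tmul]
    generalize comul (R := ℂ) a = s, comul (R := ℂ) b = t
    induction s with
    | zero => simp
    | add x y hx hy => simp only [map_add, TensorProduct.add_tmul, hx, hy]
    | tmul a a' =>
      induction t with
      | zero => simp
      | add x y hx hy => simp only [map_add, TensorProduct.tmul_add, hx, hy]
      | tmul d n => simp

theorem ract_idS (f : Fn (A ⊗[ℂ] A)) (h : A) :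
    ract f (idS h) = (antipode ℂ ∘ₗ lact (f.pre idS)).lTensor A (comul h) := by
  rw [ract, LinearMap.comp_apply, LinearMap.comp_apply, comul_idS, ← LinearMap.comp_apply,
    ← LinearMap.comp_apply, mid_fn (f.ofConv ∘ₗ (antipode ℂ).lTensor A) ((antipode ℂ).lTensor A)]
  · rw [← LinearMap.comp_apply, ← LinearMap.lTensor_comp]; rfl
  · intro a b c d; simp

theorem lact_sId (f : Fn (A ⊗[ℂ] A)) (h : A) :
    lact f (sId h) = (antipode ℂ ∘ₗ ract (f.pre sId)).rTensor A (comul h) := by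
  rw [lact, act, LinearMap.comp_apply, LinearMap.comp_apply, comul_sId, ← LinearMap.comp_apply,
    ← LinearMap.comp_apply, mid_fn (f.ofConv ∘ₗ (antipode ℂ).rTensor A) ((antipode ℂ).rTensor A)]
  · rw [lTensor_lact, ← LinearMap.comp_apply, ← LinearMap.rTensor_comp]; rfl
  · intro a b c d; simp

theorem mul_lact_idS (f : Fn (A ⊗[ℂ] A)) (h : A) :
    LinearMap.mul' ℂ A (lact f (idS h)) = f.ofConv (idS h) • 1 := by
  rw [lact, act, LinearMap.comp_apply, LinearMap.comp_apply, comul_idS, ← LinearMap.comp_apply,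
    ← LinearMap.comp_apply, ← LinearMap.comp_apply, 
    mid_one (LinearMap.mul' ℂ A ∘ₗ (antipode ℂ).lTensor A) (by simp) 
      (LinearMap.mul' ℂ A ∘ₗ (TensorProduct.comm ℂ A A).toLinearMap ∘ₗ
       (Algebra.linearMap ℂ A ∘ₗ f.ofConv ∘ₗ (antipode ℂ).lTensor A).lTensor A ∘ₗ
        (TensorProduct.leftComm ℂ A A A).toLinearMap)]
  · simp only [idS, LinearMap.comp_apply]
    induction comul (R := ℂ) h with
    | zero => simp
    | add x y hx hy => simp only [map_add, add_smul, hx, hy]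
    | tmul d n => simp [Algebra.algebraMap_eq_smul_one]
  · intro a b c d; simp [Algebra.algebraMap_eq_smul_one]

theorem mul_ract_sId (f : Fn (A ⊗[ℂ] A)) (h : A) :
    LinearMap.mul' ℂ A (ract f (sId h)) = f.ofConv (sId h) • 1 := by
  rw [ract, LinearMap.comp_apply, LinearMap.comp_apply, comul_sId, ← LinearMap.comp_apply,
    ← LinearMap.comp_apply, ← LinearMap.comp_apply, 
    mid_one (LinearMap.mul' ℂ A ∘ₗ (antipode ℂ).rTensor A) (by simp) 
      (LinearMap.mul' ℂ A ∘ₗ (TensorProduct.comm ℂ A A).toLinearMap ∘ₗ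
       (Algebra.linearMap ℂ A ∘ₗ f.ofConv ∘ₗ (antipode ℂ).rTensor A).lTensor A ∘ₗ
        (TensorProduct.leftComm ℂ A A A).toLinearMap)]
  · simp only [sId, LinearMap.comp_apply]
    induction comul (R := ℂ) h with
    | zero => simp
    | add x y hx hy => simp only [map_add, add_smul, hx, hy]
    | tmul d n => simp [Algebra.algebraMap_eq_smul_one]
  · intro a b c d; simp [Algebra.algebraMap_eq_smul_one]

end Antipode


section AntipodeTwist

open HopfAlgebra

variable {A : Type u} [Ring A] [HopfAlgebra ℂ A] (γ : TwoCocycle A)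

/-- `U(k) = γ(k₍₁₎ ⊗ S(k₍₂₎))` -/
noncomputable def TwoCocycle.U : Fn A := γ.fn.pre idS

/-- `Ū(k) = γ̄(S(k₍₁₎) ⊗ k₍₂₎)` -/
noncomputable def TwoCocycle.Uinv : Fn A := γ.inv.pre sId

theorem hopfMul_U (h : A) : hopfMul γ ((antipode ℂ ∘ₗ lact γ.U).lTensor A (comul h)) =
    γ.U.ofConv h • 1 := by
  have := mul'_lact γ (idS h)
  rw [mul_lact_idS, ract_idS] at this
  exact this.symm

theorem hopfMul_Uinv (h : A) : hopfMul γ ((antipode ℂ ∘ₗ ract γ.Uinv).rTensor A (comul h)) =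
    γ.Uinv.ofConv h • 1 := by
  have := mul'_ract γ (sId h)
  rw [mul_ract_sId, lact_sId] at this
  exact this.symm

theorem mul_comul_idS (h : A) : (LinearMap.mul' ℂ A).lTensor (A ⊗[ℂ] A) (comul (R := ℂ) (idS h)) =
    idS h ⊗ₜ 1 := by
  rw [comul_idS, ← LinearMap.comp_apply,
    mid_one (LinearMap.mul' ℂ A ∘ₗ (antipode ℂ).lTensor A) (by simp) 
      (((antipode ℂ).lTensor A).rTensor A ∘ₗ (TensorProduct.assoc ℂ A A A).symm.toLinearMap ∘ₗ
       (TensorProduct.comm ℂ A A).toLinearMap.lTensor A)]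
  · simp only [idS, LinearMap.comp_apply]
    induction comul (R := ℂ) h with
    | zero => simp
    | add x y hx hy => simp only [map_add, TensorProduct.add_tmul, hx, hy]
    | tmul d n => simp
  · intro a b c d; simp

theorem mul_comul_sId (h : A) : (LinearMap.mul' ℂ A).rTensor (A ⊗[ℂ] A) (comul (R := ℂ) (sId h)) =
    1 ⊗ₜ sId h := by
  rw [comul_sId, ← LinearMap.comp_apply,
    mid_one (LinearMap.mul' ℂ A ∘ₗ (antipode ℂ).rTensor A) (by simp) 
      (((antipode ℂ).rTensor A).lTensor A ∘ₗ (TensorProduct.leftComm ℂ A A A).toLinearMap)]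
  · simp only [sId, LinearMap.comp_apply]
    induction comul (R := ℂ) h with
    | zero => simp
    | add x y hx hy => simp only [map_add, TensorProduct.tmul_add, hx, hy]
    | tmul d n => simp
  · intro a b c d; simp

theorem mul_pre_right (F : Fn ((A ⊗[ℂ] A) ⊗[ℂ] A)) (x : A ⊗[ℂ] A) (k : A)
    (hx : (LinearMap.mul' ℂ A).lTensor (A ⊗[ℂ] A) (comul (R := ℂ) x) = x ⊗ₜ 1) :
    (F * γ.inv.pre ((LinearMap.mul' ℂ A).rTensor A)).ofConv (x ⊗ₜ k) = F.ofConv (x ⊗ₜ k) := by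
  have key : ∀ (t : (A ⊗[ℂ] A) ⊗[ℂ] (A ⊗[ℂ] A)) (s : A ⊗[ℂ] A), LinearMap.mul' ℂ ℂ
      (TensorProduct.map F.ofConv (γ.inv.pre ((LinearMap.mul' ℂ A).rTensor A)).ofConv
        (TensorProduct.tensorTensorTensorComm ℂ (A ⊗[ℂ] A) (A ⊗[ℂ] A) A A (t ⊗ₜ s))) =
      LinearMap.mul' ℂ ℂ (TensorProduct.map F.ofConv γ.inv.ofConv
        (TensorProduct.tensorTensorTensorComm ℂ (A ⊗[ℂ] A) A A A
          ((LinearMap.mul' ℂ A).lTensor (A ⊗[ℂ] A) t ⊗ₜ s))) := by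
    intro t s
    induction t with
    | zero => simp
    | add x y hx hy => simp only [map_add, TensorProduct.add_tmul, hx, hy]
    | tmul a b =>
      induction s with
      | zero => simp
      | add x y hx hy => simp only [map_add, TensorProduct.tmul_add, hx, hy]
      | tmul c d => simp [Fn.pre]
  rw [conv_apply, comul_tensor, tcoact_tmul, key, hx]
  have h2 : k = TensorProduct.rid ℂ A (Coalgebra.counit.lTensor A (comul (R := ℂ) k)) := by simp
  conv_rhs => rw [h2]
  generalize comul (R := ℂ) k = s
  induction s with
  | zero => simp
  | add x y hx hy => simp only [map_add, TensorProduct.tmul_add, hx, hy]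
  | tmul c d => simp [γ.inv_one_tmul, mul_comm]

theorem mul_pre_left (F : Fn (A ⊗[ℂ] (A ⊗[ℂ] A))) (x : A ⊗[ℂ] A) (k : A)
    (hx : (LinearMap.mul' ℂ A).rTensor (A ⊗[ℂ] A) (comul (R := ℂ) x) = 1 ⊗ₜ x) :
    (γ.fn.pre ((LinearMap.mul' ℂ A).rTensor A) *
      F.pre (TensorProduct.assoc ℂ A A A).toLinearMap).ofConv (x ⊗ₜ k) =
      F.ofConv (TensorProduct.assoc ℂ A A A (x ⊗ₜ k)) := by
  have key : ∀ (t : (A ⊗[ℂ] A) ⊗[ℂ] (A ⊗[ℂ] A)) (s : A ⊗[ℂ] A), LinearMap.mul' ℂ ℂ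
      (TensorProduct.map (γ.fn.pre ((LinearMap.mul' ℂ A).rTensor A)).ofConv
        (F.pre (TensorProduct.assoc ℂ A A A).toLinearMap).ofConv
        (TensorProduct.tensorTensorTensorComm ℂ (A ⊗[ℂ] A) (A ⊗[ℂ] A) A A (t ⊗ₜ s))) =
      LinearMap.mul' ℂ ℂ (TensorProduct.map γ.fn.ofConv
        (F.pre (TensorProduct.assoc ℂ A A A).toLinearMap).ofConv
        (TensorProduct.tensorTensorTensorComm ℂ A (A ⊗[ℂ] A) A A
          ((LinearMap.mul' ℂ A).rTensor (A ⊗[ℂ] A) t ⊗ₜ s))) := by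
    intro t s
    induction t with
    | zero => simp
    | add x y hx hy => simp only [map_add, TensorProduct.add_tmul, hx, hy]
    | tmul a b =>
      induction s with
      | zero => simp
      | add x y hx hy => simp only [map_add, TensorProduct.tmul_add, hx, hy]
      | tmul c d => simp [Fn.pre]
  rw [conv_apply, comul_tensor, tcoact_tmul, key, hx]
  have h2 : k = TensorProduct.lid ℂ A (Coalgebra.counit.rTensor A (comul (R := ℂ) k)) := by simp
  conv_rhs => rw [h2]
  generalize comul (R := ℂ) k = s
  induction s with
  | zero => simp
  | add x y hx hy => simp only [map_add, TensorProduct.tmul_add, hx, hy]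
  | tmul c d => simp [γ.fn_one_tmul, Fn.pre]

theorem TwoCocycle.U_mul_Uinv : γ.U * γ.Uinv = 1 := by
  apply WithConv.ext
  ext h
  have key := congrArg (fun f => f.ofConv (idS.rTensor A (comul (R := ℂ) h))) γ.mixed₁
  have e1 : ∀ t : A ⊗[ℂ] A, ((γ.fn.pre ((LinearMap.mul' ℂ A).lTensor A)).pre
      (TensorProduct.assoc ℂ A A A).toLinearMap *
      γ.inv.pre ((LinearMap.mul' ℂ A).rTensor A)).ofConv (idS.rTensor A t) =
      γ.fn.ofConv ((LinearMap.mul' ℂ A).lTensor A (((antipode ℂ).rTensor A).lTensor A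
        (TensorProduct.assoc ℂ A A A (comul.rTensor A t)))) := by
    intro t
    induction t with
    | zero => simp
    | add x y hx hy => simp only [map_add, hx, hy]
    | tmul a b =>
      rw [LinearMap.rTensor_tmul, mul_pre_right γ _ _ _ (mul_comul_idS a)]
      simp only [Fn.pre, idS, LinearMap.comp_apply, LinearMap.rTensor_tmul]
      generalize comul (R := ℂ) a = s
      induction s with
      | zero => simp
      | add x y hx hy => simp only [map_add, TensorProduct.add_tmul, hx, hy]
      | tmul c d => simp
  have e2 : ∀ t : A ⊗[ℂ] A, ((extFn 1 γ.inv).pre (TensorProduct.assoc ℂ A A A).toLinearMap *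
      extFn γ.fn 1).ofConv (idS.rTensor A t) = γ.inv.ofConv ((antipode ℂ).rTensor A
        ((lact γ.U).rTensor A t)) := by
    intro t
    induction t with
    | zero => simp
    | add x y hx hy => simp only [map_add, hx, hy]
    | tmul a b =>
      rw [LinearMap.rTensor_tmul, ← ofConv_ract, ract_extFn, ract_one, ract_idS]
      have : a = TensorProduct.lid ℂ A (Coalgebra.counit.rTensor A (comul (R := ℂ) a)) := by simp
      conv_rhs => rw [this]
      simp only [Fn.pre]
      generalize comul (R := ℂ) a = s
      induction s with
      | zero => simp
      | add x y hx hy => simp only [map_add, TensorProduct.add_tmul, hx, hy]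
      | tmul c d => simp [extFn, TensorProduct.smul_tmul, TwoCocycle.U, Fn.pre]
  rw [e1, e2, ← comul_lact, coassoc_apply, ← LinearMap.lTensor_comp_apply,
    ← LinearMap.lTensor_comp_apply] at key
  have e3 : (LinearMap.mul' ℂ A ∘ₗ (antipode ℂ).rTensor A) ∘ₗ comul =
    Algebra.linearMap ℂ A ∘ₗ Coalgebra.counit := mul_antipode_rTensor_comul
  rw [← ofConv_lact]
  change γ.inv.ofConv (sId _) = _
  rw [sId, LinearMap.comp_apply, ← key, e3, LinearMap.lTensor_comp_apply,
    lTensor_counit_comul]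
  simp [γ.fn_tmul_one]

theorem TwoCocycle.Uinv_mul_U : γ.Uinv * γ.U = 1 := by
  apply WithConv.ext
  ext h
  have key := congrArg (fun f => f.ofConv
    (TensorProduct.map sId (antipode ℂ) (comul (R := ℂ) h))) γ.mixed₂
  have e1 : ∀ t : A ⊗[ℂ] A, (γ.fn.pre ((LinearMap.mul' ℂ A).rTensor A) *
      (γ.inv.pre ((LinearMap.mul' ℂ A).lTensor A)).pre
        (TensorProduct.assoc ℂ A A A).toLinearMap).ofConv
        (TensorProduct.map sId (antipode ℂ) t) =
      γ.inv.ofConv (TensorProduct.map (antipode ℂ) (LinearMap.mul' ℂ A)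
        (((antipode ℂ).lTensor A).lTensor A
        (TensorProduct.assoc ℂ A A A (comul.rTensor A t)))) := by
    intro t
    induction t with
    | zero => simp
    | add x y hx hy => simp only [map_add, hx, hy]
    | tmul a b =>
      rw [TensorProduct.map_tmul, mul_pre_left γ _ _ _ (mul_comul_sId a)]
      simp only [Fn.pre, sId, LinearMap.comp_apply, LinearMap.rTensor_tmul]
      generalize comul (R := ℂ) a = s
      induction s with
      | zero => simp
      | add x y hx hy => simp only [map_add, TensorProduct.add_tmul, hx, hy]
      | tmul c d => simp
  have e2 : ∀ t : A ⊗[ℂ] A, (extFn γ.inv 1 *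
      (extFn 1 γ.fn).pre (TensorProduct.assoc ℂ A A A).toLinearMap).ofConv
        (TensorProduct.map sId (antipode ℂ) t) = γ.fn.ofConv ((antipode ℂ).lTensor A
        ((lact γ.Uinv).rTensor A t)) := by
    intro t
    induction t with
    | zero => simp
    | add x y hx hy => simp only [map_add, hx, hy]
    | tmul a b =>
      rw [TensorProduct.map_tmul, ← ofConv_lact, lact_extFn, lact_one, lact_sId]
      simp only [Fn.pre, lact, act, LinearMap.rTensor_tmul, LinearMap.comp_apply]
      generalize comul (R := ℂ) a = s
      induction s with
      | zero => simp
      | add x y hx hy => simp only [map_add, TensorProduct.add_tmul, hx, hy]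
      | tmul c d =>
        simp [extFn, TensorProduct.smul_tmul, TwoCocycle.Uinv, Fn.pre, mul_comm, counit_ract]
  rw [e1, e2, ← comul_lact, coassoc_apply, ← LinearMap.lTensor_comp_apply] at key
  have e4 : ∀ t : A ⊗[ℂ] (A ⊗[ℂ] A), TensorProduct.map (antipode ℂ) (LinearMap.mul' ℂ A)
     (((antipode ℂ).lTensor A).lTensor A t) = (antipode ℂ).rTensor A
      ((LinearMap.mul' ℂ A ∘ₗ (antipode ℂ).lTensor A).lTensor A t) := by
    intro t
    induction t with
    | zero => simp
    | add x y hx hy => simp only [map_add, hx, hy]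
    | tmul a b => simp
  have e3 : (LinearMap.mul' ℂ A ∘ₗ (antipode ℂ).lTensor A) ∘ₗ comul =
    Algebra.linearMap ℂ A ∘ₗ Coalgebra.counit := mul_antipode_lTensor_comul
  rw [← ofConv_lact]
  change γ.fn.ofConv (idS _) = _
  rw [idS, LinearMap.comp_apply, ← key, LinearMap.lTensor_comp_apply, e4,
    ← LinearMap.lTensor_comp_apply, e3, LinearMap.lTensor_comp_apply,
    lTensor_counit_comul]
  simp [γ.inv_tmul_one]

/-- The antipode `h ↦ U(h₍₁₎) S(h₍₂₎) Ū(h₍₃₎)` of the twisted Hopf algebra. -/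
noncomputable def twistAntipode : A →ₗ[ℂ] A := antipode ℂ ∘ₗ lact γ.U ∘ₗ ract γ.Uinv

theorem hopfMul_twistAntipode_left (h : A) :
    hopfMul γ ((twistAntipode γ).rTensor A (comul h)) = algebraMap ℂ A (Coalgebra.counit h) := by
  have h1 := hopfMul_Uinv γ (lact γ.U h)
  rw [comul_lact, ← LinearMap.rTensor_comp_apply, ofConv_lact, γ.U_mul_Uinv, one_apply] at h1
  rw [Algebra.algebraMap_eq_smul_one, ← h1]
  congr 3
  ext a
  simp [twistAntipode, lact_ract]

theorem hopfMul_twistAntipode_right (h : A) :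
    hopfMul γ ((twistAntipode γ).lTensor A (comul h)) = algebraMap ℂ A (Coalgebra.counit h) := by
  have h1 := hopfMul_U γ (ract γ.Uinv h)
  rw [comul_ract, ← LinearMap.lTensor_comp_apply, ofConv_ract, γ.U_mul_Uinv, one_apply] at h1
  rw [Algebra.algebraMap_eq_smul_one, ← h1]
  rfl

end AntipodeTwist


section StarHopf

open HopfAlgebra

/-- A Hopf `*`-algebra: the comultiplication is a `*`-homomorphism. -/
class HopfStarAlgebra (A : Type*) [Ring A] [StarRing A] [HopfAlgebra ℂ A] [StarModule ℂ A] :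
    Prop where
  comul_star : ∀ a : A, comul (R := ℂ) (star a) = star (comul (R := ℂ) a)

variable {A : Type u} [Ring A] [StarRing A] [HopfAlgebra ℂ A] [StarModule ℂ A]

/-- A unital `2`-cocycle on a Hopf `*`-algebra is unitary if `γ(a ⊗ b)* = γ̄(S(a)* ⊗ S(b)*)`. -/
structure UnitaryTwoCocycle (A : Type u) [Ring A] [StarRing A] [HopfAlgebra ℂ A] [StarModule ℂ A]
    extends TwoCocycle A where
  unitary : ∀ a b : A, conj (fn.ofConv (a ⊗ₜ b)) =
    inv.ofConv (star (antipode ℂ a) ⊗ₜ star (antipode ℂ b))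

/-- The linear map `a ↦ S(a*)*`, the inverse of the antipode. -/
noncomputable def sInv : A →ₗ[ℂ] A := (star (toConv (antipode ℂ (A := A)))).ofConv

theorem sInv_apply (a : A) : sInv a = star (antipode ℂ (star a)) := rfl

theorem sInv_mul (a b : A) : sInv (a * b) = sInv b * sInv a := by
  simp only [sInv_apply, star_mul, antipode_mul_antidistrib]

variable [HopfStarAlgebra A]

theorem counit_star (a : A) : Coalgebra.counit (R := ℂ) (star a) =
    conj (Coalgebra.counit (R := ℂ) a) := by
  let e : Fn A := star (toConv (Coalgebra.counit (R := ℂ) (A := A)))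
  have h1 : ∀ c : A, lact e c = c := by
    intro c
    have key : ∀ t : A ⊗[ℂ] A, TensorProduct.lid ℂ A (e.ofConv.rTensor A (star t)) =
        star (TensorProduct.lid ℂ A ((Coalgebra.counit (R := ℂ)).rTensor A t)) := by
      intro t
      induction t with
      | zero => simp
      | add x y hx hy => simp only [map_add, star_add, hx, hy]
      | tmul a b => simp [e]
    have := key (comul (star c))
    rw [← HopfStarAlgebra.comul_star, star_star, rTensor_counit_comul] at this
    simp only [TensorProduct.lid_tmul, one_smul, star_star] at this
    exact this
  have h2 := counit_lact e (star a)
  rw [h1] at h2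
  rw [h2]
  simp [e]

theorem comul_sInv (a : A) : comul (R := ℂ) (sInv a) =
    TensorProduct.map sInv sInv (TensorProduct.comm ℂ A A (comul a)) := by
  rw [sInv_apply, HopfStarAlgebra.comul_star, comul_antipode, HopfStarAlgebra.comul_star]
  generalize comul (R := ℂ) a = t
  induction t with
  | zero => simp
  | add x y hx hy => simp only [map_add, star_add, hx, hy]
  | tmul a b => simp [sInv_apply]

theorem counit_sInv (a : A) : Coalgebra.counit (R := ℂ) (sInv a) = Coalgebra.counit a := by
  simp [sInv_apply, counit_star]

/-- `h ↦ h₍₂₎ ⊗ S⁻¹(h₍₁₎)` -/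
noncomputable def idT : A →ₗ[ℂ] A ⊗[ℂ] A :=
  sInv.lTensor A ∘ₗ (TensorProduct.comm ℂ A A).toLinearMap ∘ₗ comul

theorem mul'_idT (h : A) : LinearMap.mul' ℂ A (idT h) = algebraMap ℂ A (Coalgebra.counit h) := by
  have key : ∀ t : A ⊗[ℂ] A, LinearMap.mul' ℂ A (sInv.lTensor A
      (TensorProduct.comm ℂ A A (star t))) =
      star (LinearMap.mul' ℂ A ((antipode ℂ).rTensor A t)) := by
    intro t
    induction t with
    | zero => simp
    | add x y hx hy => simp only [map_add, star_add, hx, hy]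
    | tmul a b => simp [sInv_apply]
  have := key (comul (star h))
  rw [← HopfStarAlgebra.comul_star, star_star] at this
  refine this.trans ?_
  rw [mul_antipode_rTensor_comul_apply, counit_star]
  simp [Algebra.algebraMap_eq_smul_one]

theorem antipode_sInv (a : A) : antipode ℂ (sInv a) = a := by
  have h1 : toConv (antipode ℂ ∘ₗ sInv) * toConv (antipode ℂ (A := A)) = 1 := by
    apply WithConv.ext
    ext a
    have key : ∀ t : A ⊗[ℂ] A, LinearMap.mul' ℂ A
        (TensorProduct.map (antipode ℂ ∘ₗ sInv) (antipode ℂ) t) =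
        antipode ℂ (LinearMap.mul' ℂ A (sInv.lTensor A (TensorProduct.comm ℂ A A t))) := by
      intro t
      induction t with
      | zero => simp
      | add x y hx hy => simp only [map_add, hx, hy]
      | tmul a b => simp [antipode_mul_antidistrib]
    refine (key (comul a)).trans ?_
    change antipode ℂ (LinearMap.mul' ℂ A (idT a)) = _
    rw [mul'_idT, Algebra.algebraMap_eq_smul_one, map_smul, antipode_one]
    simp [Algebra.algebraMap_eq_smul_one]
  exact LinearMap.congr_fun (congrArg WithConv.ofConv
    (left_inv_eq_right_inv h1 LinearMap.antipode_mul_id)) a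

theorem star_antipode (a : A) : star (antipode ℂ a) = sInv (star a) := by
  rw [sInv_apply, star_star]

theorem pre_sInv_mul (f g : Fn A) : (f * g).pre sInv = g.pre sInv * f.pre sInv := by
  apply WithConv.ext
  ext c
  simp only [Fn.pre, conv_apply, LinearMap.comp_apply, comul_sInv]
  induction comul (R := ℂ) c with
  | zero => simp
  | add x y hx hy => simp only [map_add, hx, hy]
  | tmul c m => simp [mul_comm]

theorem comul_idT (h : A) : comul (R := ℂ) (idT h) =
    ((sInv.lTensor A).lTensor (A ⊗[ℂ] A) ∘ₗ (sInv.lTensor A).rTensor (A ⊗[ℂ] A) ∘ₗ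
      (TensorProduct.tensorTensorTensorComm ℂ A A A A).toLinearMap ∘ₗ
      ((TensorProduct.comm ℂ A A).toLinearMap.lTensor (A ⊗[ℂ] A)) ∘ₗ
      (TensorProduct.comm ℂ (A ⊗[ℂ] A) (A ⊗[ℂ] A)).toLinearMap)
      (TensorProduct.map comul comul (comul (R := ℂ) h)) := by
  rw [comul_tensor, idT, LinearMap.comp_apply, LinearMap.comp_apply]
  generalize comul (R := ℂ) h = t
  induction t with
  | zero => simp
  | add x y hx hy => simp only [map_add, hx, hy]
  | tmul a b =>
    simp only [LinearMap.lTensor_tmul, tcoact_tmul, comul_sInv, LinearMap.comp_apply,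
      LinearEquiv.coe_coe, TensorProduct.map_tmul, TensorProduct.comm_tmul]
    generalize comul (R := ℂ) a = s, comul (R := ℂ) b = t
    induction s with
    | zero => simp
    | add x y hx hy => simp only [map_add, TensorProduct.tmul_add, hx, hy]
    | tmul a a' =>
      induction t with
      | zero => simp
      | add x y hx hy => simp only [map_add, TensorProduct.add_tmul, hx, hy]
      | tmul d n => simp

theorem lact_idT (f : Fn (A ⊗[ℂ] A)) (h : A) :
    lact f (idT h) = sInv.lTensor A (TensorProduct.comm ℂ A A
      ((lact (f.pre idT)).lTensor A (comul h))) := by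
  rw [lact, act, LinearMap.comp_apply, LinearMap.comp_apply, comul_idT, ← LinearMap.comp_apply,
    ← LinearMap.comp_apply,
    mid_fn (f.ofConv ∘ₗ sInv.lTensor A ∘ₗ (TensorProduct.comm ℂ A A).toLinearMap)
      (sInv.lTensor A ∘ₗ (TensorProduct.comm ℂ A A).toLinearMap)]
  · rfl
  · intro a b c d; simp

theorem mul_comul_idT (h : A) : (LinearMap.mul' ℂ A).rTensor (A ⊗[ℂ] A) (comul (R := ℂ) (idT h)) =
    1 ⊗ₜ idT h := by
  rw [comul_idT, ← LinearMap.comp_apply,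
    mid_one (LinearMap.mul' ℂ A ∘ₗ sInv.lTensor A ∘ₗ (TensorProduct.comm ℂ A A).toLinearMap)
      mul'_idT ((sInv.lTensor A).lTensor A ∘ₗ (TensorProduct.comm ℂ A A).toLinearMap.lTensor A ∘ₗ
        (TensorProduct.leftComm ℂ A A A).toLinearMap)]
  · simp only [idT, LinearMap.comp_apply]
    induction comul (R := ℂ) h with
    | zero => simp
    | add x y hx hy => simp only [map_add, TensorProduct.tmul_add, hx, hy]
    | tmul d n => simp
  · intro a b c d; simp

variable (γ : UnitaryTwoCocycle A)

/-- `V(k) = U(S⁻¹(k))` -/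
noncomputable def UnitaryTwoCocycle.V : Fn A := γ.U.pre sInv

/-- `V̄(k) = Ū(S⁻¹(k))` -/
noncomputable def UnitaryTwoCocycle.Vinv : Fn A := γ.Uinv.pre sInv

theorem UnitaryTwoCocycle.V_mul_Vinv : γ.V * γ.Vinv = 1 := by
  rw [UnitaryTwoCocycle.V, UnitaryTwoCocycle.Vinv, ← pre_sInv_mul, TwoCocycle.Uinv_mul_U,
    pre_one _ counit_sInv]

theorem UnitaryTwoCocycle.Vinv_mul_V : γ.Vinv * γ.V = 1 := by
  rw [UnitaryTwoCocycle.V, UnitaryTwoCocycle.Vinv, ← pre_sInv_mul, TwoCocycle.U_mul_Uinv,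
    pre_one _ counit_sInv]

theorem UnitaryTwoCocycle.Vinv_eq : γ.Vinv = γ.inv.pre idT := by
  apply WithConv.ext
  ext k
  simp only [Vinv, TwoCocycle.Uinv, Fn.pre, LinearMap.comp_apply, sId, comul_sInv, idT]
  generalize comul (R := ℂ) k = t
  induction t with
  | zero => simp
  | add x y hx hy => simp only [map_add, hx, hy]
  | tmul a b => simp [antipode_sInv]

theorem UnitaryTwoCocycle.V_apply (k : A) : γ.V.ofConv k = γ.fn.ofConv
    (sInv.rTensor A (TensorProduct.comm ℂ A A (comul k))) := by
  simp only [V, TwoCocycle.U, Fn.pre, LinearMap.comp_apply, idS, comul_sInv]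
  generalize comul (R := ℂ) k = t
  induction t with
  | zero => simp
  | add x y hx hy => simp only [map_add, hx, hy]
  | tmul a b => simp [antipode_sInv]

theorem UnitaryTwoCocycle.conj_inv (a b : A) : conj (γ.inv.ofConv (a ⊗ₜ b)) =
    γ.fn.ofConv (star (antipode ℂ a) ⊗ₜ star (antipode ℂ b)) := by
  have := γ.unitary (star (antipode ℂ a)) (star (antipode ℂ b))
  simp only [star_antipode, star_star, antipode_sInv] at this ⊢
  rw [← this, Complex.conj_conj]

theorem UnitaryTwoCocycle.conj_Vinv (k : A) : conj (γ.Vinv.ofConv k) = γ.V.ofConv (star k) := by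
  rw [γ.Vinv_eq, γ.V_apply, HopfStarAlgebra.comul_star]
  simp only [Fn.pre, LinearMap.comp_apply, idT]
  generalize comul (R := ℂ) k = t
  induction t with
  | zero => simp
  | add x y hx hy => simp only [map_add, star_add, hx, hy]
  | tmul a b => simp [γ.conj_inv, star_antipode, antipode_sInv]

theorem UnitaryTwoCocycle.conj_V (k : A) : conj (γ.V.ofConv k) = γ.Vinv.ofConv (star k) := by
  rw [← star_star k, ← conj_Vinv, Complex.conj_conj, star_star]

end StarHopf


section KeyIdentity

open HopfAlgebra

variable {A : Type u} [Ring A] [StarRing A] [HopfAlgebra ℂ A] [StarModule ℂ A]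
  [HopfStarAlgebra A] (γ : UnitaryTwoCocycle A)

/-- `k ⊗ (x ⊗ y) ↦ kx ⊗ y` -/
noncomputable def mulFirst : A ⊗[ℂ] (A ⊗[ℂ] A) →ₗ[ℂ] A ⊗[ℂ] A :=
  (LinearMap.mul' ℂ A).rTensor A ∘ₗ (TensorProduct.assoc ℂ A A A).symm.toLinearMap

theorem comul_mulFirst (t : A ⊗[ℂ] (A ⊗[ℂ] A)) : comul (R := ℂ) (mulFirst t) =
    TensorProduct.map mulFirst mulFirst (comul t) := by
  obtain ⟨s, rfl⟩ := (TensorProduct.assoc ℂ A A A).surjective t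
  have h1 := comul_assoc (A := A) s
  simp only [LinearEquiv.coe_coe] at h1
  rw [h1]
  simp only [mulFirst, LinearMap.comp_apply, LinearEquiv.coe_coe, LinearEquiv.symm_apply_apply,
    comul_mul_rTensor]
  generalize comul (R := ℂ) s = r
  induction r with
  | zero => simp
  | add x y hx hy => simp only [map_add, hx, hy]
  | tmul a b => simp

theorem mul_comul_one (x : A ⊗[ℂ] A) (k : A)
    (hx : (LinearMap.mul' ℂ A).rTensor (A ⊗[ℂ] A) (comul (R := ℂ) x) = 1 ⊗ₜ x)
    (f : TwoCocycle A) (F : Fn (A ⊗[ℂ] (A ⊗[ℂ] A))) :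
    (f.fn.pre ((LinearMap.mul' ℂ A).lTensor A) * F).ofConv (k ⊗ₜ x) = F.ofConv (k ⊗ₜ x) := by
  have key : ∀ (s : A ⊗[ℂ] A) (t : (A ⊗[ℂ] A) ⊗[ℂ] (A ⊗[ℂ] A)), LinearMap.mul' ℂ ℂ
      (TensorProduct.map (f.fn.pre ((LinearMap.mul' ℂ A).lTensor A)).ofConv F.ofConv
        (TensorProduct.tensorTensorTensorComm ℂ A A (A ⊗[ℂ] A) (A ⊗[ℂ] A) (s ⊗ₜ t))) =
      LinearMap.mul' ℂ ℂ (TensorProduct.map f.fn.ofConv F.ofConv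
        (TensorProduct.tensorTensorTensorComm ℂ A A A (A ⊗[ℂ] A)
          (s ⊗ₜ (LinearMap.mul' ℂ A).rTensor (A ⊗[ℂ] A) t))) := by
    intro s t
    induction t with
    | zero => simp
    | add x y hx hy => simp only [map_add, TensorProduct.tmul_add, hx, hy]
    | tmul a b =>
      induction s with
      | zero => simp
      | add x y hx hy => simp only [map_add, TensorProduct.add_tmul, hx, hy]
      | tmul c d => simp [Fn.pre]
  rw [conv_apply, comul_tensor, tcoact_tmul, key, hx]
  have h2 : k = TensorProduct.lid ℂ A (Coalgebra.counit.rTensor A (comul (R := ℂ) k)) := by simp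
  conv_rhs => rw [h2]
  generalize comul (R := ℂ) k = s
  induction s with
  | zero => simp
  | add x y hx hy => simp only [map_add, TensorProduct.add_tmul, hx, hy]
  | tmul c d => simp [f.fn_tmul_one, TensorProduct.smul_tmul]

theorem mul_ract_mulFirst (f : Fn (A ⊗[ℂ] A)) (x : A ⊗[ℂ] A) (k : A)
    (hx : (LinearMap.mul' ℂ A).rTensor (A ⊗[ℂ] A) (comul (R := ℂ) x) = 1 ⊗ₜ x) :
    LinearMap.mul' ℂ A (ract f (mulFirst (k ⊗ₜ x))) =
      ract (toConv (f.ofConv ∘ₗ mulFirst ∘ₗ (TensorProduct.mk ℂ A (A ⊗[ℂ] A)).flip x)) k := by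
  rw [ract, LinearMap.comp_apply, LinearMap.comp_apply, comul_mulFirst, comul_tensor, tcoact_tmul,
    ract, LinearMap.comp_apply, LinearMap.comp_apply]
  generalize comul (R := ℂ) k = s
  induction s with
  | zero => simp
  | add x y hx hy => simp only [map_add, TensorProduct.add_tmul, hx, hy]
  | tmul c d =>
    let Φ : A ⊗[ℂ] (A ⊗[ℂ] A) →ₗ[ℂ] A := LinearMap.mulLeft ℂ c ∘ₗ
      (TensorProduct.rid ℂ A).toLinearMap ∘ₗ
      (f.ofConv ∘ₗ mulFirst ∘ₗ TensorProduct.mk ℂ A (A ⊗[ℂ] A) d).lTensor A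
    have key : ∀ t : (A ⊗[ℂ] A) ⊗[ℂ] (A ⊗[ℂ] A), LinearMap.mul' ℂ A (TensorProduct.rid ℂ (A ⊗[ℂ] A)
        (f.ofConv.lTensor (A ⊗[ℂ] A) (TensorProduct.map mulFirst mulFirst
        (TensorProduct.tensorTensorTensorComm ℂ A A (A ⊗[ℂ] A) (A ⊗[ℂ] A) ((c ⊗ₜ d) ⊗ₜ t))))) =
        Φ ((LinearMap.mul' ℂ A).rTensor (A ⊗[ℂ] A) t) := by
      intro t
      induction t with
      | zero => simp
      | add x y hx hy => simp only [map_add, TensorProduct.tmul_add, hx, hy]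
      | tmul a b =>
        induction a with
        | zero => simp
        | add x y hx hy =>
          simp only [map_add, TensorProduct.tmul_add, TensorProduct.add_tmul, hx, hy]
        | tmul a a' => simp [Φ, mulFirst, mul_assoc]
    refine (key _).trans ?_
    rw [hx]
    simp [Φ]

theorem UnitaryTwoCocycle.key₁ (k h : A) : (extFn 1 γ.Vinv * γ.fn).ofConv (k ⊗ₜ h) =
    γ.inv.ofConv (mulFirst (k ⊗ₜ idT h)) := by
  have key := congrArg (fun f => f.ofConv ((TensorProduct.assoc ℂ A A A).symm (k ⊗ₜ idT h)))
    γ.mixed₁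
  have e1 : γ.inv.pre ((LinearMap.mul' ℂ A).rTensor A) =
      (γ.inv.pre mulFirst).pre (TensorProduct.assoc ℂ A A A).toLinearMap := by
    apply WithConv.ext
    apply LinearMap.ext
    intro t
    simp [Fn.pre, mulFirst]
  have e2 : extFn γ.fn 1 = ((extFn γ.fn 1).pre (TensorProduct.assoc ℂ A A A).symm.toLinearMap).pre
      (TensorProduct.assoc ℂ A A A).toLinearMap := by
    apply WithConv.ext
    apply LinearMap.ext
    intro t
    simp [Fn.pre]
  have e3 : ∀ F : Fn (A ⊗[ℂ] (A ⊗[ℂ] A)), (F.pre (TensorProduct.assoc ℂ A A A).toLinearMap).ofConv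
      ((TensorProduct.assoc ℂ A A A).symm (k ⊗ₜ idT h)) = F.ofConv (k ⊗ₜ idT h) := by
    intro F; simp [Fn.pre]
  rw [e1, e2, ← (isCoalgMap_assoc A).pre_mul, ← (isCoalgMap_assoc A).pre_mul, e3, e3,
    mul_comul_one _ _ (mul_comul_idT h), ← ofConv_lact, lact_extFn, lact_one, lact_idT] at key
  refine Eq.trans ?_ key.symm
  rw [← ofConv_lact, lact_extFn, lact_one, γ.Vinv_eq]
  have h2 : lact (γ.inv.pre idT) h = TensorProduct.lid ℂ A (Coalgebra.counit.rTensor A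
      ((lact (γ.inv.pre idT)).lTensor A (comul (R := ℂ) h))) := by
    have : ∀ t : A ⊗[ℂ] A, TensorProduct.lid ℂ A (Coalgebra.counit.rTensor A
      ((lact (γ.inv.pre idT)).lTensor A t)) = lact (γ.inv.pre idT) (TensorProduct.lid ℂ A
        ((Coalgebra.counit (R := ℂ)).rTensor A t)) := by
      intro t
      induction t with
      | zero => simp
      | add x y hx hy => simp only [map_add, hx, hy]
      | tmul a b => simp
    rw [this, rTensor_counit_comul]; simp
  rw [h2]
  generalize (lact (γ.inv.pre idT)).lTensor A (comul (R := ℂ) h) = t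
  induction t with
  | zero => simp
  | add x y hx hy => simp only [map_add, TensorProduct.tmul_add, hx, hy]
  | tmul a b => simp [Fn.pre, extFn, counit_sInv, mul_comm]

/-- The functional `k ⊗ h ↦ γ(h* ⊗ k*)*`. -/
noncomputable def UnitaryTwoCocycle.dag : Fn (A ⊗[ℂ] A) :=
  γ.inv.pre (TensorProduct.map sInv sInv ∘ₗ (TensorProduct.comm ℂ A A).toLinearMap)

theorem UnitaryTwoCocycle.conj_fn (a b : A) : conj (γ.fn.ofConv (a ⊗ₜ b)) =
    γ.dag.ofConv (star b ⊗ₜ star a) := by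
  simp [γ.unitary, dag, Fn.pre, star_antipode]

theorem lact_dag (t : A ⊗[ℂ] A) :
    ract γ.inv (TensorProduct.map sInv sInv (TensorProduct.comm ℂ A A t)) =
    TensorProduct.map sInv sInv (TensorProduct.comm ℂ A A (lact γ.dag t)) := by
  induction t with
  | zero => simp
  | add x y hx hy => simp only [map_add, hx, hy]
  | tmul a b =>
    simp only [TensorProduct.comm_tmul, TensorProduct.map_tmul, ract, lact, act,
      LinearMap.comp_apply, comul_tensor, tcoact_tmul, comul_sInv]
    generalize comul (R := ℂ) a = s, comul (R := ℂ) b = t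
    induction s with
    | zero => simp
    | add x y hx hy => simp only [map_add, TensorProduct.add_tmul, TensorProduct.tmul_add, hx, hy]
    | tmul a a' =>
      induction t with
      | zero => simp
      | add x y hx hy => simp only [map_add, TensorProduct.add_tmul, TensorProduct.tmul_add, hx, hy]
      | tmul d n => simp [UnitaryTwoCocycle.dag, Fn.pre]

theorem mul'_sInv (t : A ⊗[ℂ] A) :
    LinearMap.mul' ℂ A (TensorProduct.map sInv sInv (TensorProduct.comm ℂ A A t)) =
      sInv (LinearMap.mul' ℂ A t) := by
  induction t with
  | zero => simp
  | add x y hx hy => simp only [map_add, hx, hy]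
  | tmul a b => simp [sInv_mul]

theorem UnitaryTwoCocycle.key₂ :
    extFn γ.Vinv γ.Vinv * γ.fn = γ.dag * γ.Vinv.pre (LinearMap.mul' ℂ A) := by
  apply WithConv.ext
  apply TensorProduct.ext'
  intro k h
  let E : Fn A := toConv ((extFn 1 γ.Vinv * γ.fn).ofConv ∘ₗ (TensorProduct.mk ℂ A A).flip h)
  have hE : E = toConv (γ.inv.ofConv ∘ₗ mulFirst ∘ₗ
      (TensorProduct.mk ℂ A (A ⊗[ℂ] A)).flip (idT h)) := by
    apply WithConv.ext
    ext k
    exact γ.key₁ k h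
  -- the left-hand side
  have l1 : (extFn γ.Vinv γ.Vinv * γ.fn).ofConv (k ⊗ₜ h) = γ.Vinv.ofConv (ract E k) := by
    have : extFn γ.Vinv γ.Vinv = extFn γ.Vinv 1 * extFn 1 γ.Vinv := by
      rw [extFn_mul, mul_one, one_mul]
    rw [ofConv_ract, this, mul_assoc, ← ofConv_lact (extFn γ.Vinv 1), lact_extFn, lact_one,
      ← ofConv_lact γ.Vinv]
    rfl
  -- `Z s t = (s₁ t₁ ⊗ t₂) ⊗ s₂`
  let Z : (A ⊗[ℂ] A) ⊗[ℂ] (A ⊗[ℂ] A) →ₗ[ℂ] (A ⊗[ℂ] A) ⊗[ℂ] A :=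
    mulFirst.rTensor A ∘ₗ (TensorProduct.assoc ℂ A (A ⊗[ℂ] A) A).symm.toLinearMap ∘ₗ
    (TensorProduct.comm ℂ A (A ⊗[ℂ] A)).toLinearMap.lTensor A ∘ₗ
    (TensorProduct.assoc ℂ A A (A ⊗[ℂ] A)).toLinearMap
  have key := congrArg (fun f => f.ofConv (Z (idT k ⊗ₜ idT h))) γ.inv_cocycle
  have l2 : ∀ t : A ⊗[ℂ] A, (γ.inv.pre ((LinearMap.mul' ℂ A).rTensor A) * extFn γ.inv 1).ofConv
      (Z (t ⊗ₜ idT h)) = γ.inv.ofConv ((ract E).rTensor A t) := by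
    intro t
    induction t with
    | zero => simp
    | add x y hx hy => simp only [map_add, TensorProduct.add_tmul, hx, hy]
    | tmul a b =>
      have : Z ((a ⊗ₜ b) ⊗ₜ idT h) = mulFirst (a ⊗ₜ idT h) ⊗ₜ b := by
        simp [Z]
      rw [this, ← ofConv_ract, ract_extFn, ract_one]
      simp only [Fn.pre, LinearMap.comp_apply, LinearMap.rTensor_tmul]
      rw [mul_ract_mulFirst _ _ _ (mul_comul_idT h), hE]
  have l3 : γ.inv.ofConv ((ract E).rTensor A (idT k)) = γ.Vinv.ofConv (ract E k) := by
    rw [γ.Vinv_eq]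
    simp only [Fn.pre, LinearMap.comp_apply, idT, comul_ract]
    generalize comul (R := ℂ) k = t
    induction t with
    | zero => simp
    | add x y hx hy => simp only [map_add, hx, hy]
    | tmul a b => simp
  -- the right-hand side
  have r2 : ((γ.inv.pre ((LinearMap.mul' ℂ A).lTensor A)).pre
      (TensorProduct.assoc ℂ A A A).toLinearMap *
      (extFn 1 γ.inv).pre (TensorProduct.assoc ℂ A A A).toLinearMap).ofConv (Z (idT k ⊗ₜ idT h)) =
      γ.Vinv.ofConv (LinearMap.mul' ℂ A (lact γ.dag (k ⊗ₜ h))) := by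
    rw [← (isCoalgMap_assoc A).pre_mul]
    have hp : ∀ (F : Fn (A ⊗[ℂ] (A ⊗[ℂ] A))) (z : (A ⊗[ℂ] A) ⊗[ℂ] A),
        (F.pre (TensorProduct.assoc ℂ A A A).toLinearMap).ofConv z =
          F.ofConv ((TensorProduct.assoc ℂ A A A).toLinearMap z) := fun _ _ => rfl
    rw [hp, ← ofConv_ract, γ.Vinv_eq]
    simp only [Fn.pre, LinearMap.comp_apply, idT, comul_mul', comul_lact]
    rw [comul_tensor, tcoact_tmul]
    generalize comul (R := ℂ) k = s, comul (R := ℂ) h = t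
    induction s with
    | zero => simp
    | add x y hx hy => simp only [map_add, TensorProduct.add_tmul, hx, hy]
    | tmul a a' =>
      induction t with
      | zero => simp
      | add x y hx hy => simp only [map_add, TensorProduct.tmul_add, hx, hy]
      | tmul b b' =>
        have e : (TensorProduct.assoc ℂ A A A).toLinearMap (Z ((sInv.lTensor A
          ((TensorProduct.comm ℂ A A).toLinearMap (a ⊗ₜ a'))) ⊗ₜ (sInv.lTensor A
          ((TensorProduct.comm ℂ A A).toLinearMap (b ⊗ₜ b'))))) = (a' * b') ⊗ₜ
            TensorProduct.map sInv sInv (TensorProduct.comm ℂ A A (a ⊗ₜ b)) := by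
          simp [Z, mulFirst]
        rw [e, ract_extFn, ract_one, lact_dag]
        simp only [LinearMap.lTensor_tmul, mul'_sInv, TensorProduct.tensorTensorTensorComm_tmul,
          LinearMap.rTensor_tmul, TensorProduct.map_tmul, LinearEquiv.coe_coe,
          TensorProduct.comm_tmul, LinearMap.mul'_apply]
  rw [l1, ← l3, ← l2, ← ofConv_lact γ.dag]
  exact key.trans r2

/-- The functional `k ⊗ h ↦ γ̄(h* ⊗ k*)*`. -/
noncomputable def UnitaryTwoCocycle.invDag : Fn (A ⊗[ℂ] A) :=
  γ.fn.pre (TensorProduct.map sInv sInv ∘ₗ (TensorProduct.comm ℂ A A).toLinearMap)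

theorem UnitaryTwoCocycle.conj_inv' (a b : A) : conj (γ.inv.ofConv (a ⊗ₜ b)) =
    γ.invDag.ofConv (star b ⊗ₜ star a) := by
  simp [γ.conj_inv, invDag, Fn.pre, star_antipode]

theorem pre_dag_mul (f g : Fn (A ⊗[ℂ] A)) :
    (f * g).pre (TensorProduct.map sInv sInv ∘ₗ (TensorProduct.comm ℂ A A).toLinearMap) =
    g.pre (TensorProduct.map sInv sInv ∘ₗ (TensorProduct.comm ℂ A A).toLinearMap) *
    f.pre (TensorProduct.map sInv sInv ∘ₗ (TensorProduct.comm ℂ A A).toLinearMap) := by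
  apply WithConv.ext
  apply TensorProduct.ext'
  intro a b
  simp only [Fn.pre, conv_apply, LinearMap.comp_apply, comul_tensor, tcoact_tmul, comul_sInv,
    LinearEquiv.coe_coe, TensorProduct.comm_tmul, TensorProduct.map_tmul]
  generalize comul (R := ℂ) a = s, comul (R := ℂ) b = t
  induction s with
  | zero => simp
  | add x y hx hy => simp only [map_add, TensorProduct.add_tmul, TensorProduct.tmul_add, hx, hy]
  | tmul a a' =>
    induction t with
    | zero => simp
    | add x y hx hy => simp only [map_add, TensorProduct.add_tmul, TensorProduct.tmul_add, hx, hy]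
    | tmul d n => simp [mul_comm]

theorem UnitaryTwoCocycle.invDag_mul_dag : γ.invDag * γ.dag = 1 := by
  rw [invDag, dag, ← pre_dag_mul, γ.inv_mul_fn, pre_one]
  intro t
  induction t with
  | zero => simp
  | add x y hx hy => simp only [map_add, hx, hy]
  | tmul a b => simp [counit_sInv, mul_comm]

theorem UnitaryTwoCocycle.key₃ :
    γ.inv * extFn γ.V γ.V = γ.V.pre (LinearMap.mul' ℂ A) * γ.invDag :=
  inv_unique γ.key₂ (extFn_pair_one γ.Vinv_mul_V γ.Vinv_mul_V) γ.fn_mul_inv γ.invDag_mul_dag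
    (pre_pair_one (isCoalgMap_mul A) γ.V_mul_Vinv)

end KeyIdentity


section SemilinearMaps

variable {C : Type*} [AddCommGroup C] [Module ℂ C]
variable {D : Type*} [AddCommGroup D] [Module ℂ D]
variable {M : Type*} [AddCommGroup M] [Module ℂ M]
variable {N : Type*} [AddCommGroup N] [Module ℂ N]

theorem act_semi {δ : M →ₗ[ℂ] C ⊗[ℂ] M} {δ' : N →ₗ[ℂ] D ⊗[ℂ] N} (c : C →ₗ⋆[ℂ] D) (s : M →ₗ⋆[ℂ] N)
    (hs : ∀ m, δ' (s m) = TensorProduct.map c s (δ m)) (f : Fn C) (f' : Fn D)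
    (hf : ∀ x, f'.ofConv (c x) = conj (f.ofConv x)) (m : M) :
    s (act δ f m) = act δ' f' (s m) := by
  simp only [act, LinearMap.comp_apply, hs, LinearEquiv.coe_coe]
  induction δ m with
  | zero => simp
  | add x y hx hy => simp only [map_add, hx, hy]
  | tmul a b => simp [hf]

/-- `m ⊗ n ↦ s(n) ⊗ s(m)` for a conjugate-linear map `s`. -/
noncomputable def swapMap (s : M →ₗ⋆[ℂ] N) : M ⊗[ℂ] M →ₗ⋆[ℂ] N ⊗[ℂ] N :=
  (TensorProduct.map s s).comp (TensorProduct.comm ℂ M M).toLinearMap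

theorem swapMap_tmul (s : M →ₗ⋆[ℂ] N) (x y : M) : swapMap s (x ⊗ₜ y) = s y ⊗ₜ s x := rfl

theorem tcoact_swapMap {δ : M →ₗ[ℂ] C ⊗[ℂ] M} {δ' : N →ₗ[ℂ] D ⊗[ℂ] N} (c : C →ₗ⋆[ℂ] D)
    (s : M →ₗ⋆[ℂ] N) (hs : ∀ m, δ' (s m) = TensorProduct.map c s (δ m)) (t : M ⊗[ℂ] M) :
    tcoact δ' δ' (swapMap s t) = TensorProduct.map (swapMap c) (swapMap s) (tcoact δ δ t) := by
  induction t with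
  | zero => simp
  | add x y hx hy => simp only [map_add, hx, hy]
  | tmul m n =>
    simp only [swapMap_tmul, tcoact_tmul, hs]
    generalize δ m = u, δ n = v
    induction u with
    | zero => simp
    | add x y hx hy => simp only [map_add, TensorProduct.add_tmul, TensorProduct.tmul_add, hx, hy]
    | tmul c m =>
      induction v with
      | zero => simp
      | add x y hx hy => simp only [map_add, TensorProduct.add_tmul, TensorProduct.tmul_add, hx, hy]
      | tmul d n => simp [swapMap_tmul]

end SemilinearMaps

section TwistMul

variable {A : Type u} [Ring A] [HopfAlgebra ℂ A] (γ : TwoCocycle A)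
variable {M : Type v} [AddCommGroup M] [Module ℂ M]

/-- A bilinear product on a comodule that is compatible with the coaction. -/
def IsComoduleMul (δ : M →ₗ[ℂ] A ⊗[ℂ] M) (μ : M ⊗[ℂ] M →ₗ[ℂ] M) : Prop :=
  ∀ t, δ (μ t) = TensorProduct.map (LinearMap.mul' ℂ A) μ (tcoact δ δ t)

/-- The twisted product `a ·_γ b = γ(a₍₋₁₎ ⊗ b₍₋₁₎) a₍₀₎ b₍₀₎`. -/
noncomputable def twistMul (δ : M →ₗ[ℂ] A ⊗[ℂ] M) (μ : M ⊗[ℂ] M →ₗ[ℂ] M) : M ⊗[ℂ] M →ₗ[ℂ] M :=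
  μ ∘ₗ act (tcoact δ δ) γ.fn

theorem twistMul_one {δ : M →ₗ[ℂ] A ⊗[ℂ] M} (h : IsCoaction δ) {μ : M ⊗[ℂ] M →ₗ[ℂ] M} {e : M}
    (he : δ e = 1 ⊗ₜ e) (m : M) : twistMul γ δ μ (m ⊗ₜ e) = μ (m ⊗ₜ e) := by
  have := act_map (δ := δ) (δ' := tcoact δ δ) ((TensorProduct.mk ℂ A A).flip 1)
    ((TensorProduct.mk ℂ M M).flip e) (fun m => by
      simp only [LinearMap.flip_apply, TensorProduct.mk_apply, tcoact_tmul, he]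
      induction δ m with
      | zero => simp
      | add x y hx hy => simp only [map_add, TensorProduct.add_tmul, hx, hy]
      | tmul a b => simp) γ.fn m
  rw [γ.fn_pre_right, act_one h] at this
  exact congrArg μ this

theorem one_twistMul {δ : M →ₗ[ℂ] A ⊗[ℂ] M} (h : IsCoaction δ) {μ : M ⊗[ℂ] M →ₗ[ℂ] M} {e : M}
    (he : δ e = 1 ⊗ₜ e) (m : M) : twistMul γ δ μ (e ⊗ₜ m) = μ (e ⊗ₜ m) := by
  have := act_map (δ := δ) (δ' := tcoact δ δ) (TensorProduct.mk ℂ A A 1)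
    (TensorProduct.mk ℂ M M e) (fun m => by
      simp only [TensorProduct.mk_apply, tcoact_tmul, he]
      induction δ m with
      | zero => simp
      | add x y hx hy => simp only [map_add, TensorProduct.tmul_add, hx, hy]
      | tmul a b => simp) γ.fn m
  rw [γ.fn_pre_left, act_one h] at this
  exact congrArg μ this

theorem twistMul_assoc {δ : M →ₗ[ℂ] A ⊗[ℂ] M} (h : IsCoaction δ) {μ : M ⊗[ℂ] M →ₗ[ℂ] M}
    (hμ : IsComoduleMul δ μ) (ha : ∀ a b c, μ (μ (a ⊗ₜ b) ⊗ₜ c) = μ (a ⊗ₜ μ (b ⊗ₜ c)))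
    (a b c : M) : twistMul γ δ μ (twistMul γ δ μ (a ⊗ₜ b) ⊗ₜ c) =
      twistMul γ δ μ (a ⊗ₜ twistMul γ δ μ (b ⊗ₜ c)) :=
  twist_assoc γ h h h μ μ μ hμ hμ ha a b c

theorem coact_twistMul {δ : M →ₗ[ℂ] A ⊗[ℂ] M} (h : IsCoaction δ) {μ : M ⊗[ℂ] M →ₗ[ℂ] M}
    (hμ : IsComoduleMul δ μ) (t : M ⊗[ℂ] M) : δ (twistMul γ δ μ t) =
      TensorProduct.map (hopfMul γ) (twistMul γ δ μ) (tcoact δ δ t) := by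
  have e1 : ∀ s, TensorProduct.map (hopfMul γ) (twistMul γ δ μ) s =
      TensorProduct.map (hopfMul γ) μ ((act (tcoact δ δ) γ.fn).lTensor (A ⊗[ℂ] A) s) := by
    intro s
    induction s with
    | zero => simp
    | add x y hx hy => simp only [map_add, hx, hy]
    | tmul a b => rfl
  rw [e1, lTensor_act (isCoaction_tcoact h h)]
  change δ (μ (act (tcoact δ δ) γ.fn t)) = _
  rw [hμ, coact_act (isCoaction_tcoact h h)]
  generalize tcoact δ δ t = s
  induction s with
  | zero => simp
  | add x y hx hy => simp only [map_add, hx, hy]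
  | tmul a b => simp only [LinearMap.rTensor_tmul, TensorProduct.map_tmul, mul'_lact]

end TwistMul

section StarMaps

/-- The `*`-operation of `A` as a conjugate-linear map. -/
noncomputable def starL (A : Type*) [AddCommGroup A] [Module ℂ A] [StarAddMonoid A]
    [StarModule ℂ A] : A →ₗ⋆[ℂ] A := (starLinearEquiv ℂ (A := A)).toLinearMap

theorem starL_apply {R : Type*} [AddCommGroup R] [Module ℂ R] [StarAddMonoid R]
    [StarModule ℂ R] (a : R) : starL R a = star a := rfl

theorem star_mul' {R : Type*} [Ring R] [StarRing R] [Algebra ℂ R] [StarModule ℂ R]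
    (t : R ⊗[ℂ] R) : star (LinearMap.mul' ℂ R t) =
      LinearMap.mul' ℂ R (swapMap (starL R) t) := by
  induction t with
  | zero => simp
  | add x y hx hy => simp only [map_add, star_add, hx, hy]
  | tmul a b => simp [swapMap_tmul, starL_apply]

end StarMaps

section TwistStar

variable {A : Type u} [Ring A] [StarRing A] [HopfAlgebra ℂ A] [StarModule ℂ A]
  [HopfStarAlgebra A] (γ : UnitaryTwoCocycle A)
variable {M : Type v} [AddCommGroup M] [Module ℂ M]

theorem comul_starL (a : A) : comul (R := ℂ) (starL A a) =
    TensorProduct.map (starL A) (starL A) (comul a) := HopfStarAlgebra.comul_star a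

/-- The twisted `*`-operation `b ↦ V̄(b₍₋₁₎*) b₍₀₎*` on a comodule. -/
noncomputable def twistStar (δ : M →ₗ[ℂ] A ⊗[ℂ] M) (s : M →ₗ⋆[ℂ] M) : M →ₗ⋆[ℂ] M :=
  (act δ γ.Vinv).comp s

/-- The twisted `*`-operation `h ↦ V̄(h₍₁₎*) h₍₂₎* V(h₍₃₎*)` on the Hopf algebra. -/
noncomputable def hopfStar : A →ₗ⋆[ℂ] A := (lact γ.Vinv ∘ₗ ract γ.V).comp (starL A)

theorem hopfStar_apply (a : A) : hopfStar γ a = lact γ.Vinv (ract γ.V (star a)) := rfl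

variable {δ : M →ₗ[ℂ] A ⊗[ℂ] M} {s : M →ₗ⋆[ℂ] M}

theorem star_act (hs : ∀ m, δ (s m) = TensorProduct.map (starL A) s (δ m)) (m : M) :
    s (act δ γ.Vinv m) = act δ γ.V (s m) :=
  act_semi (starL A) s hs γ.Vinv γ.V (fun x => (γ.conj_Vinv x).symm) m

theorem twistStar_twistStar (h : IsCoaction δ)
    (hs : ∀ m, δ (s m) = TensorProduct.map (starL A) s (δ m)) (hss : ∀ m, s (s m) = m) (m : M) :
    twistStar γ δ s (twistStar γ δ s m) = m := by
  change act δ γ.Vinv (s (act δ γ.Vinv (s m))) = m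
  rw [star_act γ hs, ← act_mul h, γ.V_mul_Vinv, act_one h, hss]

theorem coact_twistStar (h : IsCoaction δ)
    (hs : ∀ m, δ (s m) = TensorProduct.map (starL A) s (δ m)) (m : M) :
    δ (twistStar γ δ s m) = TensorProduct.map (hopfStar γ) (twistStar γ δ s) (δ m) := by
  have e1 : ∀ t, TensorProduct.map (hopfStar γ) (twistStar γ δ s) t =
      (lact γ.Vinv ∘ₗ ract γ.V).rTensor M ((act δ γ.Vinv).lTensor A
        (TensorProduct.map (starL A) s t)) := by
    intro t
    induction t with
    | zero => simp
    | add x y hx hy => simp only [map_add, hx, hy]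
    | tmul a b => rfl
  rw [e1, ← hs, lTensor_act h]
  change δ (act δ γ.Vinv (s m)) = _
  rw [coact_act h, ← LinearMap.rTensor_comp_apply]
  congr 2
  ext a
  simp only [LinearMap.comp_apply]
  rw [← ract_mul, γ.V_mul_Vinv, ract_one]

theorem dag_swapMap (x : A ⊗[ℂ] A) :
    γ.dag.ofConv (swapMap (starL A) x) = conj (γ.fn.ofConv x) := by
  induction x with
  | zero => simp
  | add x y hx hy => simp only [map_add, hx, hy]
  | tmul a b => rw [swapMap_tmul, γ.conj_fn]; rfl

theorem twistStar_twistMul (h : IsCoaction δ) {μ : M ⊗[ℂ] M →ₗ[ℂ] M} (hμ : IsComoduleMul δ μ)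
    (hs : ∀ m, δ (s m) = TensorProduct.map (starL A) s (δ m)) (c : ℂ) (t : M ⊗[ℂ] M)
    (ht : s (μ (act (tcoact δ δ) γ.fn t)) = c • μ (swapMap s (act (tcoact δ δ) γ.fn t))) :
    twistStar γ δ s (twistMul γ.toTwoCocycle δ μ t) =
      c • twistMul γ.toTwoCocycle δ μ (swapMap (twistStar γ δ s) t) := by
  have h2 := isCoaction_tcoact h h
  have e1 : ∀ t, swapMap (twistStar γ δ s) t =
      act (tcoact δ δ) (extFn γ.Vinv γ.Vinv) (swapMap s t) := by
    intro t
    induction t with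
    | zero => simp
    | add x y hx hy => simp only [map_add, hx, hy]
    | tmul a b => rw [swapMap_tmul, swapMap_tmul, act_tcoact]; rfl
  change act δ γ.Vinv (s (μ (act (tcoact δ δ) γ.fn t))) = _
  rw [ht, e1, map_smul, act_semi (swapMap (starL A)) (swapMap s) (tcoact_swapMap _ _ hs) γ.fn γ.dag]
  · change _ = c • μ (act (tcoact δ δ) γ.fn _)
    rw [← act_mul h2, γ.key₂, act_mul h2, act_map (LinearMap.mul' ℂ A) μ hμ]
  · exact dag_swapMap γ

theorem star_lact (a : A) : star (lact γ.Vinv a) = lact γ.V (star a) :=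
  act_semi (starL A) (starL A) comul_starL γ.Vinv γ.V (fun x => (γ.conj_Vinv x).symm) a

theorem ract_semi {C D : Type*} [AddCommGroup C] [Module ℂ C] [Coalgebra ℂ C]
    [AddCommGroup D] [Module ℂ D] [Coalgebra ℂ D] (c : C →ₗ⋆[ℂ] D)
    (hc : ∀ m, comul (R := ℂ) (c m) = TensorProduct.map c c (comul (R := ℂ) m)) (f : Fn C)
    (f' : Fn D) (hf : ∀ x, f'.ofConv (c x) = conj (f.ofConv x)) (m : C) :
    c (ract f m) = ract f' (c m) := by
  simp only [ract, LinearMap.comp_apply, hc, LinearEquiv.coe_coe]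
  induction comul (R := ℂ) m with
  | zero => simp
  | add x y hx hy => simp only [map_add, hx, hy]
  | tmul a b => simp [hf]

theorem star_ract (a : A) : star (ract γ.V a) = ract γ.Vinv (star a) :=
  ract_semi (starL A) comul_starL γ.V γ.Vinv (fun x => (γ.conj_V x).symm) a

theorem hopfStar_hopfStar (a : A) : hopfStar γ (hopfStar γ a) = a := by
  rw [hopfStar_apply, hopfStar_apply, star_lact, star_ract, star_star,
    ← lact_ract γ.V γ.V, ← lact_mul, ← ract_mul, γ.V_mul_Vinv, lact_one, ract_one]

theorem comul_hopfStar (a : A) : comul (R := ℂ) (hopfStar γ a) =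
    TensorProduct.map (hopfStar γ) (hopfStar γ) (comul a) := by
  have e1 : ∀ t, TensorProduct.map (hopfStar γ) (hopfStar γ) t =
      TensorProduct.map (lact γ.Vinv ∘ₗ ract γ.V) (ract γ.V) ((lact γ.Vinv).lTensor A
        (TensorProduct.map (starL A) (starL A) t)) := by
    intro t
    induction t with
    | zero => simp
    | add x y hx hy => simp only [map_add, hx, hy]
    | tmul a b =>
      simp only [TensorProduct.map_tmul, hopfStar_apply, starL_apply, LinearMap.lTensor_tmul,
        LinearMap.comp_apply, lact_ract]
  rw [e1, ← comul_starL, lTensor_lact, hopfStar_apply, comul_lact, comul_ract, starL_apply]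
  generalize comul (R := ℂ) (star a) = t
  induction t with
  | zero => simp
  | add x y hx hy => simp only [map_add, hx, hy]
  | tmul a b =>
    simp only [TensorProduct.map_tmul, LinearMap.lTensor_tmul, LinearMap.rTensor_tmul,
        LinearMap.comp_apply]
    rw [← ract_mul, γ.V_mul_Vinv, ract_one]

theorem comul_swapMap (t : A ⊗[ℂ] A) : comul (R := ℂ) (swapMap (starL A) t) =
    TensorProduct.map (swapMap (starL A)) (swapMap (starL A)) (comul (R := ℂ) t) := by
  rw [comul_tensor]
  exact tcoact_swapMap (starL A) (starL A) comul_starL t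

theorem swapMap_hopfStar (t : A ⊗[ℂ] A) : swapMap (hopfStar γ) t =
    lact (extFn γ.Vinv γ.Vinv) (ract (extFn γ.V γ.V) (swapMap (starL A) t)) := by
  induction t with
  | zero => simp
  | add x y hx hy => simp only [map_add, hx, hy]
  | tmul a b => rw [swapMap_tmul, swapMap_tmul, ract_extFn, lact_extFn]; rfl

theorem invDag_swapMap (x : A ⊗[ℂ] A) :
    γ.invDag.ofConv (swapMap (starL A) x) = conj (γ.inv.ofConv x) := by
  induction x with
  | zero => simp
  | add x y hx hy => simp only [map_add, hx, hy]
  | tmul a b => rw [swapMap_tmul, γ.conj_inv']; rfl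

theorem swapMap_lact (t : A ⊗[ℂ] A) :
    swapMap (starL A) (lact γ.fn t) = lact γ.dag (swapMap (starL A) t) :=
  act_semi (swapMap (starL A)) (swapMap (starL A)) comul_swapMap γ.fn γ.dag (dag_swapMap γ) t

theorem swapMap_ract (t : A ⊗[ℂ] A) :
    swapMap (starL A) (ract γ.inv t) = ract γ.invDag (swapMap (starL A) t) :=
  ract_semi (swapMap (starL A)) comul_swapMap γ.inv γ.invDag (invDag_swapMap γ) t

theorem hopfStar_hopfMul (t : A ⊗[ℂ] A) : hopfStar γ (hopfMul γ.toTwoCocycle t) =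
    hopfMul γ.toTwoCocycle (swapMap (hopfStar γ) t) := by
  rw [hopfStar_apply, hopfMul_apply, star_mul', swapMap_lact, swapMap_ract, hopfMul_apply,
    swapMap_hopfStar, ract_map _ comul_mul', lact_map _ comul_mul', 
    ← lact_ract γ.dag (γ.V.pre (LinearMap.mul' ℂ A)), ← lact_mul, ← ract_mul, ← γ.key₂, ← γ.key₃,
    lact_mul, ract_mul, lact_ract (extFn γ.Vinv γ.Vinv) γ.inv]

end TwistStar


section RingOfMul

variable {M : Type*} [AddCommGroup M] [Module ℂ M]

/-- The ring structure given by an associative unital bilinear product. -/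
noncomputable def ringOfMul (μ : M ⊗[ℂ] M →ₗ[ℂ] M) (e : M)
    (h₁ : ∀ a b c, μ (μ (a ⊗ₜ b) ⊗ₜ c) = μ (a ⊗ₜ μ (b ⊗ₜ c)))
    (h₂ : ∀ a, μ (e ⊗ₜ a) = a) (h₃ : ∀ a, μ (a ⊗ₜ e) = a) : Ring M where
  __ := ‹AddCommGroup M›
  mul a b := μ (a ⊗ₜ b)
  one := e
  mul_assoc := h₁
  one_mul := h₂
  mul_one := h₃
  left_distrib a b c := by
    change μ (a ⊗ₜ (b + c)) = μ (a ⊗ₜ b) + μ (a ⊗ₜ c)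
    rw [TensorProduct.tmul_add, map_add]
  right_distrib a b c := by
    change μ ((a + b) ⊗ₜ c) = μ (a ⊗ₜ c) + μ (b ⊗ₜ c)
    rw [TensorProduct.add_tmul, map_add]
  zero_mul a := by
    change μ (0 ⊗ₜ a) = 0
    rw [TensorProduct.zero_tmul, map_zero]
  mul_zero a := by
    change μ (a ⊗ₜ 0) = 0
    rw [TensorProduct.tmul_zero, map_zero]

theorem smul_tmul_map (μ : M ⊗[ℂ] M →ₗ[ℂ] M) (r : ℂ) (x y : M) :
    μ ((r • x) ⊗ₜ y) = r • μ (x ⊗ₜ y) := by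
  rw [← TensorProduct.smul_tmul', map_smul]

theorem tmul_smul_map (μ : M ⊗[ℂ] M →ₗ[ℂ] M) (r : ℂ) (x y : M) :
    μ (x ⊗ₜ (r • y)) = r • μ (x ⊗ₜ y) := by
  rw [TensorProduct.tmul_smul, map_smul]

/-- The algebra structure given by an associative unital bilinear product. -/
noncomputable def algebraOfMul (μ : M ⊗[ℂ] M →ₗ[ℂ] M) (e : M)
    (h₁ : ∀ a b c, μ (μ (a ⊗ₜ b) ⊗ₜ c) = μ (a ⊗ₜ μ (b ⊗ₜ c)))
    (h₂ : ∀ a, μ (e ⊗ₜ a) = a) (h₃ : ∀ a, μ (a ⊗ₜ e) = a) :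
    @Algebra ℂ M _ (ringOfMul μ e h₁ h₂ h₃).toSemiring :=
  @Algebra.ofModule ℂ M _ (ringOfMul μ e h₁ h₂ h₃).toSemiring ‹Module ℂ M›
    (fun r x y => by exact smul_tmul_map μ r x y) (fun r x y => by exact tmul_smul_map μ r x y)

end RingOfMul

section TwistHopf

open HopfAlgebra

variable {A : Type u} [Ring A] [StarRing A] [HopfAlgebra ℂ A] [StarModule ℂ A]

/-- The Hopf `*`-algebra `A_γ`: the coalgebra `A` with the product
`h ·_γ k = γ(h₍₁₎ ⊗ k₍₁₎) h₍₂₎ k₍₂₎ γ̄(h₍₃₎ ⊗ k₍₃₎)` and the `*`-operation `hopfStar γ`. -/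
def TwistHopf (_γ : UnitaryTwoCocycle A) : Type u := A

variable (γ : UnitaryTwoCocycle A)

noncomputable instance : Ring (TwistHopf γ) := ringOfMul (M := A) (hopfMul γ.toTwoCocycle) 1
  (hopfMul_assoc γ.toTwoCocycle) (one_hopfMul γ.toTwoCocycle) (hopfMul_one γ.toTwoCocycle)

noncomputable instance : Algebra ℂ (TwistHopf γ) := algebraOfMul (M := A) (hopfMul γ.toTwoCocycle) 1
  (hopfMul_assoc γ.toTwoCocycle) (one_hopfMul γ.toTwoCocycle) (hopfMul_one γ.toTwoCocycle)

/-- The identity map of `A`, seen as a linear map to `A_γ`. -/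
noncomputable def TwistHopf.of : A ≃ₗ[ℂ] TwistHopf γ where
  toFun a := a
  invFun a := a
  map_add' _ _ := rfl
  map_smul' _ _ := rfl
  left_inv _ := rfl
  right_inv _ := rfl

theorem TwistHopf.of_mul (a b : A) : TwistHopf.of γ a * TwistHopf.of γ b =
    TwistHopf.of γ (hopfMul γ.toTwoCocycle (a ⊗ₜ b)) := rfl

theorem TwistHopf.of_one : TwistHopf.of γ 1 = 1 := rfl

/-- Transport of linear maps to the tensor square. -/
noncomputable def TwistHopf.of₂ : A ⊗[ℂ] A →ₗ[ℂ] TwistHopf γ ⊗[ℂ] TwistHopf γ :=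
  TensorProduct.map (TwistHopf.of γ).toLinearMap (TwistHopf.of γ).toLinearMap

noncomputable instance : CoalgebraStruct ℂ (TwistHopf γ) where
  comul := TwistHopf.of₂ γ ∘ₗ comul ∘ₗ (TwistHopf.of γ).symm.toLinearMap
  counit := Coalgebra.counit ∘ₗ (TwistHopf.of γ).symm.toLinearMap

theorem TwistHopf.comul_of (a : A) : comul (R := ℂ) (TwistHopf.of γ a) =
    TwistHopf.of₂ γ (comul a) := rfl

theorem TwistHopf.counit_of (a : A) : Coalgebra.counit (R := ℂ) (TwistHopf.of γ a) =
    Coalgebra.counit (R := ℂ) a := rfl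

noncomputable instance : Coalgebra ℂ (TwistHopf γ) where
  coassoc := by
    apply LinearMap.ext
    intro x
    obtain ⟨a, rfl⟩ := (TwistHopf.of γ).surjective x
    have key := congrArg (TensorProduct.map (TwistHopf.of γ).toLinearMap (TwistHopf.of₂ γ))
      (coassoc_apply (R := ℂ) a)
    have e1 : ∀ t : A ⊗[ℂ] A, TensorProduct.assoc ℂ (TwistHopf γ) (TwistHopf γ) (TwistHopf γ)
        (comul.rTensor (TwistHopf γ) (TwistHopf.of₂ γ t)) =
        TensorProduct.map (TwistHopf.of γ).toLinearMap (TwistHopf.of₂ γ)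
          (TensorProduct.assoc ℂ A A A (comul.rTensor A t)) := by
      intro t
      induction t with
      | zero => simp
      | add x y hx hy => simp only [map_add, hx, hy]
      | tmul a b =>
        simp only [TwistHopf.of₂, TensorProduct.map_tmul, LinearMap.rTensor_tmul,
          LinearEquiv.coe_coe, TwistHopf.comul_of]
        generalize comul (R := ℂ) a = s
        induction s with
        | zero => simp
        | add x y hx hy => simp only [map_add, TensorProduct.add_tmul, hx, hy]
        | tmul c d => simp
    have e2 : ∀ t : A ⊗[ℂ] A, comul.lTensor (TwistHopf γ) (TwistHopf.of₂ γ t) =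
        TensorProduct.map (TwistHopf.of γ).toLinearMap (TwistHopf.of₂ γ) (comul.lTensor A t) := by
      intro t
      induction t with
      | zero => simp
      | add x y hx hy => simp only [map_add, hx, hy]
      | tmul a b =>
        simp [TwistHopf.of₂, TwistHopf.comul_of]
    simp only [LinearMap.comp_apply, LinearEquiv.coe_coe, TwistHopf.comul_of]
    rw [e1, e2, key]
  rTensor_counit_comp_comul := by
    apply LinearMap.ext
    intro x
    obtain ⟨a, rfl⟩ := (TwistHopf.of γ).surjective x
    have e1 : ∀ t : A ⊗[ℂ] A, Coalgebra.counit.rTensor (TwistHopf γ) (TwistHopf.of₂ γ t) =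
        (TwistHopf.of γ).toLinearMap.lTensor ℂ ((Coalgebra.counit (R := ℂ)).rTensor A t) := by
      intro t
      induction t with
      | zero => simp
      | add x y hx hy => simp only [map_add, hx, hy]
      | tmul a b => simp [TwistHopf.of₂, TwistHopf.counit_of]
    simp [TwistHopf.comul_of, e1]
  lTensor_counit_comp_comul := by
    apply LinearMap.ext
    intro x
    obtain ⟨a, rfl⟩ := (TwistHopf.of γ).surjective x
    have e1 : ∀ t : A ⊗[ℂ] A, Coalgebra.counit.lTensor (TwistHopf γ) (TwistHopf.of₂ γ t) =
        (TwistHopf.of γ).toLinearMap.rTensor ℂ ((Coalgebra.counit (R := ℂ)).lTensor A t) := by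
      intro t
      induction t with
      | zero => simp
      | add x y hx hy => simp only [map_add, hx, hy]
      | tmul a b => simp [TwistHopf.of₂, TwistHopf.counit_of]
    simp [TwistHopf.comul_of, e1]

theorem TwistHopf.of₂_mul (s t : A ⊗[ℂ] A) : TwistHopf.of₂ γ s * TwistHopf.of₂ γ t =
    TwistHopf.of₂ γ (TensorProduct.map (hopfMul γ.toTwoCocycle) (hopfMul γ.toTwoCocycle)
      (TensorProduct.tensorTensorTensorComm ℂ A A A A (s ⊗ₜ t))) := by
  induction s with
  | zero => simp
  | add x y hx hy => simp only [add_mul, TensorProduct.add_tmul, map_add, hx, hy]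
  | tmul a b =>
    induction t with
    | zero => simp
    | add x y hx hy => simp only [mul_add, TensorProduct.tmul_add, map_add, hx, hy]
    | tmul c d => simp [TwistHopf.of₂, TwistHopf.of_mul]

theorem TwistHopf.mul_of₂ (t : A ⊗[ℂ] A) : LinearMap.mul' ℂ (TwistHopf γ) (TwistHopf.of₂ γ t) =
    TwistHopf.of γ (hopfMul γ.toTwoCocycle t) := by
  induction t with
  | zero => simp
  | add x y hx hy => simp only [map_add, hx, hy]
  | tmul c d => simp [TwistHopf.of₂, TwistHopf.of_mul]

theorem TwistHopf.comul_mul (x y : TwistHopf γ) : comul (R := ℂ) (x * y) =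
    comul (R := ℂ) x * comul (R := ℂ) y := by
  obtain ⟨a, rfl⟩ := (TwistHopf.of γ).surjective x
  obtain ⟨b, rfl⟩ := (TwistHopf.of γ).surjective y
  rw [TwistHopf.of_mul, TwistHopf.comul_of, TwistHopf.comul_of, TwistHopf.comul_of,
    TwistHopf.of₂_mul, comul_hopfMul, comul_tensor, tcoact_tmul]

theorem TwistHopf.counit_mul (x y : TwistHopf γ) : Coalgebra.counit (R := ℂ) (x * y) =
    Coalgebra.counit (R := ℂ) x * Coalgebra.counit (R := ℂ) y := by
  obtain ⟨a, rfl⟩ := (TwistHopf.of γ).surjective x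
  obtain ⟨b, rfl⟩ := (TwistHopf.of γ).surjective y
  rw [TwistHopf.of_mul, TwistHopf.counit_of, TwistHopf.counit_of, TwistHopf.counit_of,
    counit_hopfMul]
  simp [mul_comm]

noncomputable instance : Bialgebra ℂ (TwistHopf γ) := Bialgebra.mk' ℂ (TwistHopf γ)
  (by rw [← TwistHopf.of_one, TwistHopf.counit_of, Bialgebra.counit_one])
  (TwistHopf.counit_mul γ _ _)
  (by
    rw [← TwistHopf.of_one, TwistHopf.comul_of, Bialgebra.comul_one]
    simp [TwistHopf.of₂, TwistHopf.of_one, Algebra.TensorProduct.one_def])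
  (TwistHopf.comul_mul γ _ _)

noncomputable instance : HopfAlgebra ℂ (TwistHopf γ) where
  antipode := (TwistHopf.of γ).toLinearMap ∘ₗ twistAntipode γ.toTwoCocycle ∘ₗ
    (TwistHopf.of γ).symm.toLinearMap
  mul_antipode_rTensor_comul := by
    apply LinearMap.ext
    intro x
    obtain ⟨a, rfl⟩ := (TwistHopf.of γ).surjective x
    have e1 : ∀ t : A ⊗[ℂ] A, ((TwistHopf.of γ).toLinearMap ∘ₗ twistAntipode γ.toTwoCocycle ∘ₗ
        (TwistHopf.of γ).symm.toLinearMap).rTensor (TwistHopf γ) (TwistHopf.of₂ γ t) =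
        TwistHopf.of₂ γ ((twistAntipode γ.toTwoCocycle).rTensor A t) := by
      intro t
      induction t with
      | zero => simp
      | add x y hx hy => simp only [map_add, hx, hy]
      | tmul a b => simp [TwistHopf.of₂]
    simp only [LinearMap.comp_apply (f := LinearMap.mul' ℂ (TwistHopf γ)),
      LinearMap.comp_apply (g := comul), TwistHopf.comul_of]
    rw [e1, TwistHopf.mul_of₂, hopfMul_twistAntipode_left]
    simp [Algebra.algebraMap_eq_smul_one, TwistHopf.of_one, TwistHopf.counit_of]
  mul_antipode_lTensor_comul := by
    apply LinearMap.ext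
    intro x
    obtain ⟨a, rfl⟩ := (TwistHopf.of γ).surjective x
    have e1 : ∀ t : A ⊗[ℂ] A, ((TwistHopf.of γ).toLinearMap ∘ₗ twistAntipode γ.toTwoCocycle ∘ₗ
        (TwistHopf.of γ).symm.toLinearMap).lTensor (TwistHopf γ) (TwistHopf.of₂ γ t) =
        TwistHopf.of₂ γ ((twistAntipode γ.toTwoCocycle).lTensor A t) := by
      intro t
      induction t with
      | zero => simp
      | add x y hx hy => simp only [map_add, hx, hy]
      | tmul a b => simp [TwistHopf.of₂]
    simp only [LinearMap.comp_apply (f := LinearMap.mul' ℂ (TwistHopf γ)),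
      LinearMap.comp_apply (g := comul), TwistHopf.comul_of]
    rw [e1, TwistHopf.mul_of₂, hopfMul_twistAntipode_right]
    simp [Algebra.algebraMap_eq_smul_one, TwistHopf.of_one, TwistHopf.counit_of]

variable [HopfStarAlgebra A]

noncomputable instance : StarRing (TwistHopf γ) where
  star a := TwistHopf.of γ (hopfStar γ ((TwistHopf.of γ).symm a))
  star_involutive a := by simp [hopfStar_hopfStar]
  star_add a b := by simp
  star_mul x y := by
    obtain ⟨a, rfl⟩ := (TwistHopf.of γ).surjective x
    obtain ⟨b, rfl⟩ := (TwistHopf.of γ).surjective y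
    simp only [TwistHopf.of_mul, LinearEquiv.symm_apply_apply, hopfStar_hopfMul, swapMap_tmul]

theorem TwistHopf.star_of (a : A) : star (TwistHopf.of γ a) = TwistHopf.of γ (hopfStar γ a) := rfl

instance : StarModule ℂ (TwistHopf γ) where
  star_smul r x := by
    obtain ⟨a, rfl⟩ := (TwistHopf.of γ).surjective x
    rw [← map_smul, TwistHopf.star_of, TwistHopf.star_of, LinearMap.map_smulₛₗ]
    simp

instance : HopfStarAlgebra (TwistHopf γ) where
  comul_star x := by
    obtain ⟨a, rfl⟩ := (TwistHopf.of γ).surjective x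
    rw [TwistHopf.star_of, TwistHopf.comul_of, TwistHopf.comul_of, comul_hopfStar]
    generalize comul (R := ℂ) a = t
    induction t with
    | zero => simp
    | add x y hx hy => simp only [map_add, star_add, hx, hy]
    | tmul a b => simp [TwistHopf.of₂, TwistHopf.star_of]

end TwistHopf


section Comodules

theorem tensor_mul {R S : Type*} [Ring R] [Algebra ℂ R] [Ring S] [Algebra ℂ S]
    (s t : R ⊗[ℂ] S) : s * t = TensorProduct.map (LinearMap.mul' ℂ R) (LinearMap.mul' ℂ S)
      (TensorProduct.tensorTensorTensorComm ℂ R S R S (s ⊗ₜ t)) := by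
  induction s with
  | zero => simp
  | add x y hx hy => simp only [add_mul, TensorProduct.add_tmul, map_add, hx, hy]
  | tmul a b =>
    induction t with
    | zero => simp
    | add x y hx hy => simp only [mul_add, TensorProduct.tmul_add, map_add, hx, hy]
    | tmul c d => simp

/-- A left comodule over a coalgebra. -/
class LeftComodule (A : Type*) (M : Type*) [AddCommGroup A] [Module ℂ A] [Coalgebra ℂ A]
    [AddCommGroup M] [Module ℂ M] where
  /-- the coaction `m ↦ m₍₋₁₎ ⊗ m₍₀₎` -/
  coact : M →ₗ[ℂ] A ⊗[ℂ] M
  isCoaction : IsCoaction coact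

/-- The coaction `m ↦ m₍₋₁₎ ⊗ m₍₀₎`. -/
noncomputable def coact (A : Type*) {M : Type*} [AddCommGroup A] [Module ℂ A] [Coalgebra ℂ A]
    [AddCommGroup M] [Module ℂ M] [LeftComodule A M] : M →ₗ[ℂ] A ⊗[ℂ] M := LeftComodule.coact

theorem isCoaction_coact (A : Type*) (M : Type*) [AddCommGroup A] [Module ℂ A] [Coalgebra ℂ A]
    [AddCommGroup M] [Module ℂ M] [LeftComodule A M] : IsCoaction (coact A (M := M)) :=
  LeftComodule.isCoaction

/-- A left comodule algebra: the coaction is a homomorphism of algebras. -/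
class ComoduleAlgebra (A : Type*) (B : Type*) [Ring A] [Bialgebra ℂ A] [Ring B] [Algebra ℂ B]
    [LeftComodule A B] : Prop where
  coact_one : coact A (1 : B) = 1
  coact_mul : ∀ a b : B, coact A (a * b) = coact A a * coact A b

/-- A left comodule `*`-algebra: the coaction is a homomorphism of `*`-algebras. -/
class ComoduleStarAlgebra (A : Type*) (B : Type*) [Ring A] [StarRing A] [Bialgebra ℂ A]
    [StarModule ℂ A] [Ring B] [StarRing B] [Algebra ℂ B] [StarModule ℂ B] [LeftComodule A B] : Prop
    extends ComoduleAlgebra A B where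
  coact_star : ∀ b : B, coact A (star b) = star (coact A b)

theorem isComoduleMul_mul' (A : Type*) (B : Type*) [Ring A] [HopfAlgebra ℂ A] [Ring B] [Algebra ℂ B]
    [LeftComodule A B] [ComoduleAlgebra A B] :
    IsComoduleMul (coact A (M := B)) (LinearMap.mul' ℂ B) := by
  intro t
  induction t with
  | zero => simp
  | add x y hx hy => simp only [map_add, hx, hy]
  | tmul a b => rw [LinearMap.mul'_apply, ComoduleAlgebra.coact_mul, tensor_mul, tcoact_tmul]

theorem coact_one' (A : Type*) (B : Type*) [Ring A] [HopfAlgebra ℂ A] [Ring B] [Algebra ℂ B]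
    [LeftComodule A B] [ComoduleAlgebra A B] : coact A (1 : B) = 1 ⊗ₜ 1 :=
  ComoduleAlgebra.coact_one

theorem coact_starL (A : Type*) (B : Type*) [Ring A] [StarRing A] [HopfAlgebra ℂ A]
    [StarModule ℂ A] [Ring B] [StarRing B] [Algebra ℂ B] [StarModule ℂ B] [LeftComodule A B]
    [ComoduleStarAlgebra A B] (b : B) :
    coact A (starL B b) = TensorProduct.map (starL A) (starL B) (coact A b) :=
  ComoduleStarAlgebra.coact_star b

end Comodules

section Twist

variable {A : Type u} [Ring A] [StarRing A] [HopfAlgebra ℂ A] [StarModule ℂ A]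

/-- The `A_γ`-comodule algebra `B_γ`: the comodule `B` with the product
`a ·_γ b = γ(a₍₋₁₎ ⊗ b₍₋₁₎) a₍₀₎ b₍₀₎`. -/
def Twist (_γ : UnitaryTwoCocycle A) (B : Type v) : Type v := B

variable (γ : UnitaryTwoCocycle A) (B : Type v) [Ring B] [Algebra ℂ B] [LeftComodule A B]
  [ComoduleAlgebra A B]

/-- The twisted product as a linear map. -/
noncomputable def algMul : B ⊗[ℂ] B →ₗ[ℂ] B :=
  twistMul γ.toTwoCocycle (coact A) (LinearMap.mul' ℂ B)

variable {B}

theorem algMul_assoc (a b c : B) :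
    algMul γ B (algMul γ B (a ⊗ₜ b) ⊗ₜ c) = algMul γ B (a ⊗ₜ algMul γ B (b ⊗ₜ c)) :=
  twistMul_assoc γ.toTwoCocycle (isCoaction_coact A B) (isComoduleMul_mul' A B)
    (fun a b c => by simp [mul_assoc]) a b c

theorem one_algMul (a : B) : algMul γ B (1 ⊗ₜ a) = a :=
  (one_twistMul γ.toTwoCocycle (isCoaction_coact A B) (coact_one' A B) a).trans (by simp)

theorem algMul_one (a : B) : algMul γ B (a ⊗ₜ 1) = a :=
  (twistMul_one γ.toTwoCocycle (isCoaction_coact A B) (coact_one' A B) a).trans (by simp)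

theorem coact_algMul (t : B ⊗[ℂ] B) : coact A (algMul γ B t) =
    TensorProduct.map (hopfMul γ.toTwoCocycle) (algMul γ B) (tcoact (coact A) (coact A) t) :=
  coact_twistMul γ.toTwoCocycle (isCoaction_coact A B) (isComoduleMul_mul' A B) t

noncomputable instance : Ring (Twist γ B) := ringOfMul (M := B) (algMul γ B) 1
  (algMul_assoc γ) (one_algMul γ) (algMul_one γ)

noncomputable instance : Algebra ℂ (Twist γ B) := algebraOfMul (M := B) (algMul γ B) 1
  (algMul_assoc γ) (one_algMul γ) (algMul_one γ)

/-- The identity map of `B`, seen as a linear map to `B_γ`. -/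
noncomputable def Twist.of : B ≃ₗ[ℂ] Twist γ B where
  toFun a := a
  invFun a := a
  map_add' _ _ := rfl
  map_smul' _ _ := rfl
  left_inv _ := rfl
  right_inv _ := rfl

theorem Twist.of_mul (a b : B) : Twist.of γ a * Twist.of γ b =
    Twist.of γ (algMul γ B (a ⊗ₜ b)) := rfl

theorem Twist.of_one : Twist.of γ (1 : B) = 1 := rfl

/-- Transport of linear maps to the tensor product. -/
noncomputable def Twist.of₂ : A ⊗[ℂ] B →ₗ[ℂ] TwistHopf γ ⊗[ℂ] Twist γ B :=
  TensorProduct.map (TwistHopf.of γ).toLinearMap (Twist.of γ).toLinearMap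

variable (B) in
/-- The coaction of `A` on `B`, seen as a coaction of `A_γ` on `B_γ`. -/
noncomputable def Twist.coactMap : Twist γ B →ₗ[ℂ] TwistHopf γ ⊗[ℂ] Twist γ B :=
  Twist.of₂ γ ∘ₗ coact A ∘ₗ (Twist.of γ).symm.toLinearMap

theorem Twist.coactMap_of (b : B) :
    Twist.coactMap γ B (Twist.of γ b) = Twist.of₂ γ (coact A b) := rfl

theorem Twist.isCoaction : IsCoaction (Twist.coactMap γ B) where
  coassoc x := by
    obtain ⟨a, rfl⟩ := (Twist.of γ).surjective x
    have key := congrArg (TensorProduct.map (TwistHopf.of γ).toLinearMap (Twist.of₂ γ))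
      ((isCoaction_coact A B).coassoc a)
    have e1 : ∀ t : A ⊗[ℂ] B, TensorProduct.assoc ℂ (TwistHopf γ) (TwistHopf γ) (Twist γ B)
        (comul.rTensor (Twist γ B) (Twist.of₂ γ t)) =
        TensorProduct.map (TwistHopf.of γ).toLinearMap (Twist.of₂ γ)
          (TensorProduct.assoc ℂ A A B (comul.rTensor B t)) := by
      intro t
      induction t with
      | zero => simp
      | add x y hx hy => simp only [map_add, hx, hy]
      | tmul a b =>
        simp only [Twist.of₂, TensorProduct.map_tmul, LinearMap.rTensor_tmul,
          LinearEquiv.coe_coe, TwistHopf.comul_of]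
        generalize comul (R := ℂ) a = s
        induction s with
        | zero => simp
        | add x y hx hy => simp only [map_add, TensorProduct.add_tmul, hx, hy]
        | tmul c d => simp [TwistHopf.of₂]
    have e2 : ∀ t : A ⊗[ℂ] B, (Twist.coactMap γ B).lTensor (TwistHopf γ) (Twist.of₂ γ t) =
        TensorProduct.map (TwistHopf.of γ).toLinearMap (Twist.of₂ γ)
          ((coact A).lTensor A t) := by
      intro t
      induction t with
      | zero => simp
      | add x y hx hy => simp only [map_add, hx, hy]
      | tmul a b => simp [Twist.of₂, Twist.coactMap]
    rw [Twist.coactMap_of, e1, e2, key]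
  counit x := by
    obtain ⟨a, rfl⟩ := (Twist.of γ).surjective x
    have e1 : ∀ t : A ⊗[ℂ] B, TensorProduct.lid ℂ (Twist γ B)
        ((Coalgebra.counit (R := ℂ)).rTensor (Twist γ B) (Twist.of₂ γ t)) =
        Twist.of γ (TensorProduct.lid ℂ B ((Coalgebra.counit (R := ℂ)).rTensor B t)) := by
      intro t
      induction t with
      | zero => simp
      | add x y hx hy => simp only [map_add, hx, hy]
      | tmul a b => simp [Twist.of₂, TwistHopf.counit_of]
    rw [Twist.coactMap_of, e1, (isCoaction_coact A B).counit]

noncomputable instance : LeftComodule (TwistHopf γ) (Twist γ B) where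
  coact := Twist.coactMap γ B
  isCoaction := Twist.isCoaction γ

theorem Twist.coact_of (b : B) : coact (TwistHopf γ) (Twist.of γ b) = Twist.of₂ γ (coact A b) := rfl

theorem Twist.of₂_mul (s t : A ⊗[ℂ] B) : Twist.of₂ γ s * Twist.of₂ γ t =
    Twist.of₂ γ (TensorProduct.map (hopfMul γ.toTwoCocycle) (algMul γ B)
      (TensorProduct.tensorTensorTensorComm ℂ A B A B (s ⊗ₜ t))) := by
  induction s with
  | zero => simp
  | add x y hx hy => simp only [add_mul, TensorProduct.add_tmul, map_add, hx, hy]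
  | tmul a b =>
    induction t with
    | zero => simp
    | add x y hx hy => simp only [mul_add, TensorProduct.tmul_add, map_add, hx, hy]
    | tmul c d => simp [Twist.of₂, TwistHopf.of_mul, Twist.of_mul]

instance : ComoduleAlgebra (TwistHopf γ) (Twist γ B) where
  coact_one := by
    rw [← Twist.of_one, Twist.coact_of, coact_one']
    simp [Twist.of₂, TwistHopf.of_one, Twist.of_one, Algebra.TensorProduct.one_def]
  coact_mul x y := by
    obtain ⟨a, rfl⟩ := (Twist.of γ).surjective x
    obtain ⟨b, rfl⟩ := (Twist.of γ).surjective y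
    rw [Twist.of_mul, Twist.coact_of, Twist.coact_of, Twist.coact_of, Twist.of₂_mul, coact_algMul,
      tcoact_tmul]

end Twist

section TwistStarAlgebra

variable {A : Type u} [Ring A] [StarRing A] [HopfAlgebra ℂ A] [StarModule ℂ A] [HopfStarAlgebra A]
  (γ : UnitaryTwoCocycle A) {B : Type v} [Ring B] [StarRing B] [Algebra ℂ B] [StarModule ℂ B]
  [LeftComodule A B] [ComoduleStarAlgebra A B]

theorem twistStar_algMul (a b : B) : twistStar γ (coact A) (starL B) (algMul γ B (a ⊗ₜ b)) =
    algMul γ B (twistStar γ (coact A) (starL B) b ⊗ₜ twistStar γ (coact A) (starL B) a) := by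
  have h := twistStar_twistMul γ (isCoaction_coact A B) (isComoduleMul_mul' A B)
    (coact_starL A B) 1 (a ⊗ₜ b) (by rw [one_smul]; exact star_mul' _)
  rw [one_smul] at h
  exact h

/-- The `*`-operation of `B_γ` is `b ↦ V̄(b₍₋₁₎*) b₍₀₎*`. -/
noncomputable instance : StarRing (Twist γ B) where
  star a := Twist.of γ (twistStar γ (coact A) (starL B) ((Twist.of γ).symm a))
  star_involutive a := by
    simp [twistStar_twistStar γ (isCoaction_coact A B) (coact_starL A B) star_star]
  star_add a b := by simp
  star_mul x y := by
    obtain ⟨a, rfl⟩ := (Twist.of γ).surjective x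
    obtain ⟨b, rfl⟩ := (Twist.of γ).surjective y
    simp only [Twist.of_mul, LinearEquiv.symm_apply_apply, twistStar_algMul]

theorem Twist.star_of (b : B) : star (Twist.of γ b) =
    Twist.of γ (twistStar γ (coact A) (starL B) b) := rfl

instance : StarModule ℂ (Twist γ B) where
  star_smul r x := by
    obtain ⟨a, rfl⟩ := (Twist.of γ).surjective x
    rw [← map_smul, Twist.star_of, Twist.star_of, LinearMap.map_smulₛₗ]
    simp

instance : ComoduleStarAlgebra (TwistHopf γ) (Twist γ B) where
  coact_star x := by
    obtain ⟨a, rfl⟩ := (Twist.of γ).surjective x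
    rw [Twist.star_of, Twist.coact_of, Twist.coact_of,
      coact_twistStar γ (isCoaction_coact A B) (coact_starL A B)]
    generalize coact A a = t
    induction t with
    | zero => simp
    | add x y hx hy => simp only [map_add, star_add, hx, hy]
    | tmul a b => simp [Twist.of₂, Twist.star_of, TwistHopf.star_of]

end TwistStarAlgebra


section Subcomodules

variable {C : Type*} [AddCommGroup C] [Module ℂ C]
variable {D : Type*} [AddCommGroup D] [Module ℂ D]
variable {M : Type*} [AddCommGroup M] [Module ℂ M]
variable {N : Type*} [AddCommGroup N] [Module ℂ N]

/-- The image of `C ⊗ P` in `C ⊗ M`, for a subspace `P` of `M`. -/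
noncomputable def tensorSub (C : Type*) [AddCommGroup C] [Module ℂ C] (P : Submodule ℂ M) :
    Submodule ℂ (C ⊗[ℂ] M) :=
  LinearMap.range (P.subtype.lTensor C)

theorem tmul_mem_tensorSub (P : Submodule ℂ M) (c : C) {m : M} (hm : m ∈ P) :
    c ⊗ₜ m ∈ tensorSub C P := ⟨c ⊗ₜ ⟨m, hm⟩, rfl⟩

theorem tensorSub_induction {P : Submodule ℂ M} {p : C ⊗[ℂ] M → Prop} (h0 : p 0)
    (ha : ∀ x y, p x → p y → p (x + y)) (ht : ∀ c, ∀ m ∈ P, p (c ⊗ₜ m)) (t : C ⊗[ℂ] M)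
    (h : t ∈ tensorSub C P) : p t := by
  obtain ⟨s, rfl⟩ := h
  induction s with
  | zero => simpa using h0
  | add x y hx hy => rw [map_add]; exact ha _ _ hx hy
  | tmul c m => exact ht c m m.2

theorem tensorSub_top (t : C ⊗[ℂ] M) : t ∈ tensorSub C (⊤ : Submodule ℂ M) := by
  induction t with
  | zero => exact zero_mem _
  | add x y hx hy => exact add_mem hx hy
  | tmul c m => exact tmul_mem_tensorSub _ c trivial

/-- The image of `P ⊗ Q` in `M ⊗ N`. -/
noncomputable def tensorSub₂ (P : Submodule ℂ M) (Q : Submodule ℂ N) : Submodule ℂ (M ⊗[ℂ] N) :=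
  LinearMap.range (TensorProduct.map P.subtype Q.subtype)

theorem tensorSub₂_induction {P : Submodule ℂ M} {Q : Submodule ℂ N} {p : M ⊗[ℂ] N → Prop}
    (h0 : p 0) (ha : ∀ x y, p x → p y → p (x + y)) (ht : ∀ m ∈ P, ∀ n ∈ Q, p (m ⊗ₜ n))
    (t : M ⊗[ℂ] N) (h : t ∈ tensorSub₂ P Q) : p t := by
  obtain ⟨s, rfl⟩ := h
  induction s with
  | zero => simpa using h0
  | add x y hx hy => rw [map_add]; exact ha _ _ hx hy
  | tmul c m => exact ht c c.2 m m.2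

theorem act_mem {δ : M →ₗ[ℂ] C ⊗[ℂ] M} {P : Submodule ℂ M} (f : Fn C) {m : M}
    (h : δ m ∈ tensorSub C P) : act δ f m ∈ P := by
  change TensorProduct.lid ℂ M (f.ofConv.rTensor M (δ m)) ∈ P
  refine tensorSub_induction (p := fun t => TensorProduct.lid ℂ M (f.ofConv.rTensor M t) ∈ P)
    (by simp) (fun x y hx hy => ?_) (fun c m hm => ?_) _ h
  · simp only [map_add]; exact add_mem hx hy
  · simpa using P.smul_mem _ hm

theorem tcoact_mem {δ : M →ₗ[ℂ] C ⊗[ℂ] M} {δ' : N →ₗ[ℂ] D ⊗[ℂ] N} {P : Submodule ℂ M}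
    {Q : Submodule ℂ N} {m : M} {n : N} (h : δ m ∈ tensorSub C P) (h' : δ' n ∈ tensorSub D Q) :
    tcoact δ δ' (m ⊗ₜ n) ∈ tensorSub (C ⊗[ℂ] D) (tensorSub₂ P Q) := by
  rw [tcoact_tmul]
  refine tensorSub_induction (p := fun t => TensorProduct.tensorTensorTensorComm ℂ C M D N
    (t ⊗ₜ δ' n) ∈ tensorSub (C ⊗[ℂ] D) (tensorSub₂ P Q)) (by simp) (fun x y hx hy => ?_)
    (fun c m hm => ?_) _ h
  · simp only [TensorProduct.add_tmul, map_add]; exact add_mem hx hy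
  · refine tensorSub_induction (p := fun t => TensorProduct.tensorTensorTensorComm ℂ C M D N
      ((c ⊗ₜ m) ⊗ₜ t) ∈ tensorSub (C ⊗[ℂ] D) (tensorSub₂ P Q)) (by simp) (fun x y hx hy => ?_)
      (fun d n hn => ?_) _ h'
    · simp only [TensorProduct.tmul_add, map_add]; exact add_mem hx hy
    · exact tmul_mem_tensorSub _ _ ⟨⟨m, hm⟩ ⊗ₜ ⟨n, hn⟩, rfl⟩

theorem act_tcoact_mem {δ : M →ₗ[ℂ] C ⊗[ℂ] M} {δ' : N →ₗ[ℂ] D ⊗[ℂ] N} {P : Submodule ℂ M}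
    {Q : Submodule ℂ N} {m : M} {n : N} (h : δ m ∈ tensorSub C P) (h' : δ' n ∈ tensorSub D Q)
    (f : Fn (C ⊗[ℂ] D)) : act (tcoact δ δ') f (m ⊗ₜ n) ∈ tensorSub₂ P Q :=
  act_mem f (tcoact_mem h h')

end Subcomodules

section Calculus

/-- A covariant differential `*`-calculus on a comodule `*`-algebra `B` over a Hopf `*`-algebra `A`:
a differential graded algebra `Ω = ⨁ Ωᵏ` with `Ω⁰ = B`, generated by `B` and `dB`, with a coaction
of `A` by homomorphisms of graded algebras that extends the one on `B` and commutes with `d`, and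
with a graded `*`-operation that extends the one on `B`, commutes with `d`, and is compatible with
the coaction. -/
structure CovariantStarCalculus (A : Type u) (B : Type v) (Ω : Type w) [Ring A] [StarRing A]
    [HopfAlgebra ℂ A] [StarModule ℂ A] [Ring B] [StarRing B] [Algebra ℂ B] [StarModule ℂ B]
    [LeftComodule A B] [Ring Ω] [Algebra ℂ Ω] [LeftComodule A Ω] [ComoduleAlgebra A Ω] where
  /-- the subspace `Ωᵏ` of `k`-forms -/
  grade : ℕ → Submodule ℂ Ω
  isInternal : DirectSum.IsInternal grade
  mul_mem : ∀ {i j : ℕ} {x y : Ω}, x ∈ grade i → y ∈ grade j → x * y ∈ grade (i + j)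
  /-- the identification of `B` with `Ω⁰` -/
  incl : B →ₐ[ℂ] Ω
  incl_injective : Function.Injective incl
  range_incl : LinearMap.range incl.toLinearMap = grade 0
  /-- the differential -/
  d : Ω →ₗ[ℂ] Ω
  d_mem : ∀ {k : ℕ} {x : Ω}, x ∈ grade k → d x ∈ grade (k + 1)
  d_d : ∀ x : Ω, d (d x) = 0
  d_mul : ∀ {k : ℕ} {x : Ω} (y : Ω), x ∈ grade k → d (x * y) = d x * y + (-1 : ℂ) ^ k • (x * d y)
  generated : Algebra.adjoin ℂ (Set.range incl ∪ Set.range fun b => d (incl b)) = ⊤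
  coact_incl : ∀ b : B, coact A (incl b) = incl.toLinearMap.lTensor A (coact A b)
  coact_mem : ∀ {k : ℕ} {x : Ω}, x ∈ grade k →
    coact A x ∈ LinearMap.range ((grade k).subtype.lTensor A)
  coact_d : ∀ x : Ω, coact A (d x) = d.lTensor A (coact A x)
  /-- the `*`-operation on forms -/
  star : Ω →ₗ⋆[ℂ] Ω
  star_star : ∀ x : Ω, star (star x) = x
  star_mem : ∀ {k : ℕ} {x : Ω}, x ∈ grade k → star x ∈ grade k
  star_incl : ∀ b : B, star (incl b) = incl (Star.star b)
  star_d : ∀ x : Ω, star (d x) = d (star x)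
  star_mul : ∀ {k l : ℕ} {x y : Ω}, x ∈ grade k → y ∈ grade l →
    star (x * y) = (-1 : ℂ) ^ (k * l) • (star y * star x)
  coact_star : ∀ x : Ω, coact A (star x) = TensorProduct.map (starL A) star (coact A x)

end Calculus

section TwistCalculus

variable {A : Type u} {B : Type v} {Ω : Type w} [Ring A] [StarRing A]
  [HopfAlgebra ℂ A] [StarModule ℂ A] [HopfStarAlgebra A] [Ring B] [StarRing B] [Algebra ℂ B]
  [StarModule ℂ B] [LeftComodule A B] [ComoduleStarAlgebra A B] [Ring Ω] [Algebra ℂ Ω]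
  [LeftComodule A Ω] [ComoduleAlgebra A Ω] (C : CovariantStarCalculus A B Ω)
  (γ : UnitaryTwoCocycle A)

namespace CovariantStarCalculus

theorem coact_mem' {k : ℕ} {x : Ω} (h : x ∈ C.grade k) : coact A x ∈ tensorSub A (C.grade k) :=
  C.coact_mem h

theorem algMul_incl (a b : B) : algMul γ Ω (C.incl a ⊗ₜ C.incl b) = C.incl (algMul γ B (a ⊗ₜ b)) := by
  have h := act_map (δ := tcoact (coact A) (coact A)) (δ' := tcoact (coact A) (coact A))
    (TensorProduct.map LinearMap.id LinearMap.id)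
    (TensorProduct.map C.incl.toLinearMap C.incl.toLinearMap)
    (fun t => tcoact_map (LinearMap.id : A →ₗ[ℂ] A) (LinearMap.id : A →ₗ[ℂ] A) C.incl.toLinearMap
      C.incl.toLinearMap C.coact_incl C.coact_incl t) γ.fn (a ⊗ₜ b)
  rw [TensorProduct.map_id, pre_id] at h
  refine (congrArg (LinearMap.mul' ℂ Ω) h).trans ?_
  change _ = C.incl.toLinearMap (LinearMap.mul' ℂ B (act _ γ.fn (a ⊗ₜ b)))
  generalize act _ γ.fn (a ⊗ₜ[ℂ] b) = t
  induction t with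
  | zero => simp
  | add x y hx hy => simp only [map_add, hx, hy]
  | tmul c m => simp

theorem mul'_mem {i j : ℕ} {t : Ω ⊗[ℂ] Ω} (ht : t ∈ tensorSub₂ (C.grade i) (C.grade j)) :
    LinearMap.mul' ℂ Ω t ∈ C.grade (i + j) :=
  tensorSub₂_induction (p := fun t => LinearMap.mul' ℂ Ω t ∈ C.grade (i + j)) (by simp)
    (fun x y hx hy => by rw [map_add]; exact add_mem hx hy)
    (fun m hm n hn => C.mul_mem hm hn) t ht

theorem algMul_mem {i j : ℕ} {x y : Ω} (hx : x ∈ C.grade i) (hy : y ∈ C.grade j) :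
    algMul γ Ω (x ⊗ₜ y) ∈ C.grade (i + j) :=
  C.mul'_mem (act_tcoact_mem (C.coact_mem' hx) (C.coact_mem' hy) γ.fn)

theorem d_algMul {k : ℕ} {x : Ω} (y : Ω) (hx : x ∈ C.grade k) : C.d (algMul γ Ω (x ⊗ₜ y)) =
    algMul γ Ω (C.d x ⊗ₜ y) + (-1 : ℂ) ^ k • algMul γ Ω (x ⊗ₜ C.d y) := by
  have h1 := act_map (δ := tcoact (coact A) (coact A)) (δ' := tcoact (coact A) (coact A))
    (TensorProduct.map LinearMap.id LinearMap.id)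
    (TensorProduct.map C.d LinearMap.id)
    (fun t => tcoact_map (LinearMap.id : A →ₗ[ℂ] A) (LinearMap.id : A →ₗ[ℂ] A) C.d
      (LinearMap.id : Ω →ₗ[ℂ] Ω) C.coact_d map_id_coact t) γ.fn (x ⊗ₜ y)
  have h2 := act_map (δ := tcoact (coact A) (coact A)) (δ' := tcoact (coact A) (coact A))
    (TensorProduct.map LinearMap.id LinearMap.id)
    (TensorProduct.map LinearMap.id C.d)
    (fun t => tcoact_map (LinearMap.id : A →ₗ[ℂ] A) (LinearMap.id : A →ₗ[ℂ] A) 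
      (LinearMap.id : Ω →ₗ[ℂ] Ω) C.d map_id_coact C.coact_d t) γ.fn (x ⊗ₜ y)
  rw [TensorProduct.map_id, pre_id] at h1 h2
  have e1 : algMul γ Ω (C.d x ⊗ₜ y) = LinearMap.mul' ℂ Ω (TensorProduct.map C.d LinearMap.id
      (act (tcoact (coact A) (coact A)) γ.fn (x ⊗ₜ y))) := congrArg (LinearMap.mul' ℂ Ω) h1
  have e2 : algMul γ Ω (x ⊗ₜ C.d y) = LinearMap.mul' ℂ Ω (TensorProduct.map LinearMap.id C.d
      (act (tcoact (coact A) (coact A)) γ.fn (x ⊗ₜ y))) := congrArg (LinearMap.mul' ℂ Ω) h2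
  rw [e1, e2]
  change C.d (LinearMap.mul' ℂ Ω (act _ γ.fn (x ⊗ₜ y))) = _
  refine tensorSub₂_induction (P := C.grade k) (Q := ⊤) (p := fun t =>
    C.d (LinearMap.mul' ℂ Ω t) = LinearMap.mul' ℂ Ω (TensorProduct.map C.d LinearMap.id t) +
      (-1 : ℂ) ^ k • LinearMap.mul' ℂ Ω (TensorProduct.map LinearMap.id C.d t)) (by simp)
    (fun x y hx hy => ?_) (fun m hm n _ => ?_) _
    (act_tcoact_mem (C.coact_mem' hx) (tensorSub_top _) γ.fn)
  · simp only [map_add, hx, hy, smul_add]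
    abel
  · simpa using C.d_mul n hm

theorem twistStar_mul {k l : ℕ} {x y : Ω} (hx : x ∈ C.grade k) (hy : y ∈ C.grade l) :
    twistStar γ (coact A) C.star (algMul γ Ω (x ⊗ₜ y)) = (-1 : ℂ) ^ (k * l) •
      algMul γ Ω (twistStar γ (coact A) C.star y ⊗ₜ twistStar γ (coact A) C.star x) := by
  refine twistStar_twistMul γ (isCoaction_coact A Ω) (isComoduleMul_mul' A Ω) C.coact_star
    ((-1 : ℂ) ^ (k * l)) (x ⊗ₜ y) ?_
  refine tensorSub₂_induction (P := C.grade k) (Q := C.grade l) (p := fun t =>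
    C.star (LinearMap.mul' ℂ Ω t) = (-1 : ℂ) ^ (k * l) • LinearMap.mul' ℂ Ω (swapMap C.star t))
    (by simp) (fun x y hx hy => ?_) (fun m hm n hn => ?_) _
    (act_tcoact_mem (C.coact_mem' hx) (C.coact_mem' hy) γ.fn)
  · simp only [map_add, hx, hy, smul_add]
  · simpa [swapMap_tmul] using C.star_mul hm hn

theorem _root_.CocycleTwist.Twist.of₂_tmul {M : Type*} [Ring M] [Algebra ℂ M] [LeftComodule A M]
    [ComoduleAlgebra A M] (a : A) (m : M) :
    Twist.of₂ γ (a ⊗ₜ m) = TwistHopf.of γ a ⊗ₜ Twist.of γ m := rfl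

/-- The inclusion `B_γ → Ω_γ`. -/
noncomputable def twistIncl : Twist γ B →ₐ[ℂ] Twist γ Ω :=
  AlgHom.ofLinearMap ((Twist.of γ).toLinearMap ∘ₗ C.incl.toLinearMap ∘ₗ
    (Twist.of γ).symm.toLinearMap)
    (by simp [← Twist.of_one])
    (fun x y => by
      obtain ⟨a, rfl⟩ := (Twist.of γ).surjective x
      obtain ⟨b, rfl⟩ := (Twist.of γ).surjective y
      simp [Twist.of_mul, algMul_incl])

theorem twistIncl_of (b : B) : C.twistIncl γ (Twist.of γ b) = Twist.of γ (C.incl b) := rfl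

/-- The differential of `Ω_γ`, which is that of `Ω`. -/
noncomputable def twistD : Twist γ Ω →ₗ[ℂ] Twist γ Ω :=
  (Twist.of γ).toLinearMap ∘ₗ C.d ∘ₗ (Twist.of γ).symm.toLinearMap

theorem twistD_of (x : Ω) : C.twistD γ (Twist.of γ x) = Twist.of γ (C.d x) := rfl

/-- The `*`-operation of `Ω_γ`: `ω ↦ V̄(ω₍₋₁₎*) ω₍₀₎*`. -/
noncomputable def twistStarMap : Twist γ Ω →ₗ⋆[ℂ] Twist γ Ω :=
  ((Twist.of γ).toLinearMap.comp (twistStar γ (coact A) C.star)).comp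
    (Twist.of γ).symm.toLinearMap

theorem twistStarMap_of (x : Ω) : C.twistStarMap γ (Twist.of γ x) =
    Twist.of γ (twistStar γ (coact A) C.star x) := rfl

/-- The subspace of `k`-forms in `Ω_γ`, which is that of `Ω`. -/
noncomputable def twistGrade (k : ℕ) : Submodule ℂ (Twist γ Ω) :=
  (C.grade k).map (Twist.of γ).toLinearMap

theorem of_mem_twistGrade {k : ℕ} {x : Ω} (h : x ∈ C.grade k) :
    Twist.of γ x ∈ C.twistGrade γ k := ⟨x, h, rfl⟩

theorem twist_isInternal : DirectSum.IsInternal (C.twistGrade γ) := by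
  have h := (DirectSum.isInternal_submodule_iff_iSupIndep_and_iSup_eq_top C.grade).1 C.isInternal
  refine (DirectSum.isInternal_submodule_iff_iSupIndep_and_iSup_eq_top _).2 ⟨?_, ?_⟩
  · exact h.1.map_orderIso (Submodule.orderIsoMapComap (Twist.of γ (B := Ω)))
  · have := Submodule.map_iSup (Twist.of γ (B := Ω)).toLinearMap C.grade
    rw [h.2, Submodule.map_top, LinearEquiv.range] at this
    exact this.symm

theorem twist_generated : Algebra.adjoin ℂ (Set.range (C.twistIncl γ) ∪
    Set.range fun b => C.twistD γ (C.twistIncl γ b)) = ⊤ := by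
  set S := Algebra.adjoin ℂ (Set.range (C.twistIncl γ) ∪
    Set.range fun b => C.twistD γ (C.twistIncl γ b)) with hS
  let P : Submodule ℂ Ω := (Subalgebra.toSubmodule S).comap (Twist.of γ).toLinearMap
  have hP : ∀ x, x ∈ P ↔ Twist.of γ x ∈ S := fun x => Iff.rfl
  have h1 : ∀ b, C.incl b ∈ P := fun b => (hP _).2 <|
    Algebra.subset_adjoin (Or.inl ⟨Twist.of γ b, rfl⟩)
  have h2 : ∀ b, C.d (C.incl b) ∈ P := fun b => (hP _).2 <|
    Algebra.subset_adjoin (Or.inr ⟨Twist.of γ b, rfl⟩)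
  have hmul : ∀ t ∈ tensorSub₂ P P, algMul γ Ω t ∈ P := by
    intro t ht
    refine tensorSub₂_induction (p := fun t => algMul γ Ω t ∈ P) (by simp)
      (fun x y hx hy => ?_) (fun m hm n hn => ?_) t ht
    · rw [map_add]; exact add_mem hx hy
    · rw [hP, ← Twist.of_mul]; exact S.mul_mem hm hn
  have hco : ∀ y ∈ S, coact A ((Twist.of γ).symm y) ∈ tensorSub A P := by
    intro y hy
    induction hy using Algebra.adjoin_induction with
    | mem x hx =>
      rcases hx with ⟨b, rfl⟩ | ⟨b, rfl⟩
      · obtain ⟨b, rfl⟩ := (Twist.of γ).surjective b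
        rw [C.twistIncl_of, LinearEquiv.symm_apply_apply, C.coact_incl]
        generalize coact A b = t
        induction t with
        | zero => simp
        | add x y hx hy => rw [map_add]; exact add_mem hx hy
        | tmul a b => exact tmul_mem_tensorSub _ _ (h1 b)
      · obtain ⟨b, rfl⟩ := (Twist.of γ).surjective b
        change coact A ((Twist.of γ).symm (C.twistD γ (C.twistIncl γ (Twist.of γ b)))) ∈ _
        rw [C.twistIncl_of, C.twistD_of, LinearEquiv.symm_apply_apply, C.coact_d, C.coact_incl]
        generalize coact A b = t
        induction t with
        | zero => simp
        | add x y hx hy => rw [map_add, map_add]; exact add_mem hx hy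
        | tmul a b => exact tmul_mem_tensorSub _ _ (h2 b)
    | algebraMap r =>
      rw [Algebra.algebraMap_eq_smul_one, map_smul, map_smul, ← Twist.of_one,
        LinearEquiv.symm_apply_apply, coact_one']
      exact Submodule.smul_mem _ _ (tmul_mem_tensorSub _ _ S.one_mem)
    | add x y _ _ hx hy => rw [map_add, map_add]; exact add_mem hx hy
    | mul x y _ _ hx hy =>
      obtain ⟨x, rfl⟩ := (Twist.of γ).surjective x
      obtain ⟨y, rfl⟩ := (Twist.of γ).surjective y
      rw [LinearEquiv.symm_apply_apply] at hx hy
      rw [Twist.of_mul, LinearEquiv.symm_apply_apply, coact_algMul]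
      refine tensorSub_induction (p := fun t => TensorProduct.map (hopfMul γ.toTwoCocycle)
        (algMul γ Ω) t ∈ tensorSub A P) (by simp) (fun x y hx hy => ?_) (fun c m hm => ?_) _
        (tcoact_mem hx hy)
      · rw [map_add]; exact add_mem hx hy
      · exact tmul_mem_tensorSub _ _ (hmul m hm)
  have hmul' : ∀ x ∈ P, ∀ y ∈ P, x * y ∈ P := by
    intro x hx y hy
    have h3 := hmul _ (act_tcoact_mem (hco _ hx) (hco _ hy) γ.inv)
    have h4 : algMul γ Ω (act (tcoact (coact A) (coact A)) γ.inv (x ⊗ₜ y)) = x * y := by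
      change LinearMap.mul' ℂ Ω (act _ γ.fn (act _ γ.inv (x ⊗ₜ y))) = _
      rw [← act_mul (isCoaction_tcoact (isCoaction_coact A Ω) (isCoaction_coact A Ω)),
        γ.inv_mul_fn, act_one (isCoaction_tcoact (isCoaction_coact A Ω) (isCoaction_coact A Ω))]
      simp
    rw [← h4]
    exact h3
  have hall : ∀ x, x ∈ P := by
    intro x
    have hx : x ∈ Algebra.adjoin ℂ (Set.range C.incl ∪ Set.range fun b => C.d (C.incl b)) := by
      rw [C.generated]; trivial
    induction hx using Algebra.adjoin_induction with
    | mem x hx =>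
      rcases hx with ⟨b, rfl⟩ | ⟨b, rfl⟩
      · exact h1 b
      · exact h2 b
    | algebraMap r =>
      rw [Algebra.algebraMap_eq_smul_one]
      exact Submodule.smul_mem _ _ S.one_mem
    | add x y _ _ hx hy => exact add_mem hx hy
    | mul x y _ _ hx hy => exact hmul' x hx y hy
  rw [eq_top_iff]
  intro y _
  obtain ⟨x, rfl⟩ := (Twist.of γ).surjective y
  exact hall x

/-- The `A_γ`-covariant differential `*`-calculus `Ω_γ` on `B_γ`. -/
noncomputable def twist : CovariantStarCalculus (TwistHopf γ) (Twist γ B) (Twist γ Ω) where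
  grade := C.twistGrade γ
  isInternal := C.twist_isInternal γ
  mul_mem := by
    rintro i j _ _ ⟨x, hx, rfl⟩ ⟨y, hy, rfl⟩
    exact C.of_mem_twistGrade γ (C.algMul_mem γ hx hy)
  incl := C.twistIncl γ
  incl_injective x y h := C.incl_injective h
  range_incl := by
    change _ = (C.grade 0).map _
    rw [← C.range_incl]
    apply le_antisymm
    · rintro _ ⟨b, rfl⟩
      exact ⟨_, ⟨(Twist.of γ).symm b, rfl⟩, rfl⟩
    · rintro _ ⟨_, ⟨b, rfl⟩, rfl⟩
      exact ⟨Twist.of γ b, rfl⟩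
  d := C.twistD γ
  d_mem := by
    rintro k _ ⟨x, hx, rfl⟩
    exact C.of_mem_twistGrade γ (C.d_mem hx)
  d_d x := by
    obtain ⟨x, rfl⟩ := (Twist.of γ).surjective x
    rw [C.twistD_of, C.twistD_of, C.d_d, map_zero]
  d_mul := by
    rintro k _ y ⟨x, hx, rfl⟩
    obtain ⟨y, rfl⟩ := (Twist.of γ).surjective y
    simp only [LinearEquiv.coe_coe, Twist.of_mul, C.twistD_of, C.d_algMul γ y hx, map_add, map_smul]
  generated := C.twist_generated γ
  coact_incl b := by
    obtain ⟨b, rfl⟩ := (Twist.of γ).surjective b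
    rw [C.twistIncl_of, Twist.coact_of, Twist.coact_of, C.coact_incl]
    generalize coact A b = t
    induction t with
    | zero => simp
    | add x y hx hy => simp only [map_add, hx, hy]
    | tmul a b =>
      rw [Twist.of₂_tmul, LinearMap.lTensor_tmul, LinearMap.lTensor_tmul, Twist.of₂_tmul]
      rfl
  coact_mem := by
    rintro k _ ⟨x, hx, rfl⟩
    rw [LinearEquiv.coe_coe, Twist.coact_of]
    refine tensorSub_induction (p := fun t => Twist.of₂ γ t ∈
      tensorSub (TwistHopf γ) (C.twistGrade γ k)) (by simp) (fun x y hx hy => ?_)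
      (fun c m hm => ?_) _ (C.coact_mem hx)
    · rw [map_add]; exact add_mem hx hy
    · exact tmul_mem_tensorSub _ _ (C.of_mem_twistGrade γ hm)
  coact_d x := by
    obtain ⟨x, rfl⟩ := (Twist.of γ).surjective x
    rw [C.twistD_of, Twist.coact_of, Twist.coact_of, C.coact_d]
    generalize coact A x = t
    induction t with
    | zero => simp
    | add x y hx hy => simp only [map_add, hx, hy]
    | tmul a b =>
      rw [Twist.of₂_tmul, LinearMap.lTensor_tmul, LinearMap.lTensor_tmul, Twist.of₂_tmul, C.twistD_of]
  star := C.twistStarMap γ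
  star_star x := by
    obtain ⟨x, rfl⟩ := (Twist.of γ).surjective x
    rw [C.twistStarMap_of, C.twistStarMap_of,
      twistStar_twistStar γ (isCoaction_coact A Ω) C.coact_star C.star_star]
  star_mem := by
    rintro k _ ⟨x, hx, rfl⟩
    exact C.of_mem_twistGrade γ (act_mem γ.Vinv (C.coact_mem' (C.star_mem hx)))
  star_incl b := by
    obtain ⟨b, rfl⟩ := (Twist.of γ).surjective b
    rw [C.twistIncl_of, C.twistStarMap_of, Twist.star_of, C.twistIncl_of]
    congr 1
    change act (coact A) γ.Vinv (C.star (C.incl b)) = C.incl (act (coact A) γ.Vinv (Star.star b))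
    rw [C.star_incl]
    exact act_map LinearMap.id C.incl.toLinearMap C.coact_incl γ.Vinv (Star.star b)
  star_d x := by
    obtain ⟨x, rfl⟩ := (Twist.of γ).surjective x
    rw [C.twistD_of, C.twistStarMap_of, C.twistStarMap_of, C.twistD_of]
    congr 1
    change act (coact A) γ.Vinv (C.star (C.d x)) = C.d (act (coact A) γ.Vinv (C.star x))
    rw [C.star_d]
    exact act_map LinearMap.id C.d C.coact_d γ.Vinv (C.star x)
  star_mul := by
    rintro k l _ _ ⟨x, hx, rfl⟩ ⟨y, hy, rfl⟩
    simp only [LinearEquiv.coe_coe, Twist.of_mul, C.twistStarMap_of, C.twistStar_mul γ hx hy,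
      map_smul]
  coact_star x := by
    obtain ⟨x, rfl⟩ := (Twist.of γ).surjective x
    rw [C.twistStarMap_of, Twist.coact_of, Twist.coact_of,
      coact_twistStar γ (isCoaction_coact A Ω) C.coact_star]
    generalize coact A x = t
    induction t with
    | zero => simp
    | add x y hx hy => simp only [map_add, hx, hy]
    | tmul a b =>
      rw [Twist.of₂_tmul, TensorProduct.map_tmul, TensorProduct.map_tmul, Twist.of₂_tmul,
        C.twistStarMap_of]
      exact congrArg (fun z => z ⊗ₜ _) (TwistHopf.star_of γ a).symm

end CovariantStarCalculus

end TwistCalculus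


section OneForms

variable {A : Type u} {B : Type v} {Ω : Type w} [Ring A] [StarRing A]
  [HopfAlgebra ℂ A] [StarModule ℂ A] [Ring B] [StarRing B] [Algebra ℂ B]
  [StarModule ℂ B] [LeftComodule A B] [Ring Ω] [Algebra ℂ Ω]
  [LeftComodule A Ω] [ComoduleAlgebra A Ω] (C : CovariantStarCalculus A B Ω)

namespace CovariantStarCalculus

/-- The space `Ω¹` of one-forms. -/
def OneForms : Type w := ↥(C.grade 1)

instance : AddCommGroup C.OneForms := inferInstanceAs (AddCommGroup ↥(C.grade 1))

instance : Module ℂ C.OneForms := inferInstanceAs (Module ℂ ↥(C.grade 1))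

/-- The inclusion of `Ω¹` in `Ω`. -/
def val : C.OneForms →ₗ[ℂ] Ω := (C.grade 1).subtype

theorem val_injective : Function.Injective C.val := Subtype.val_injective

theorem val_mem (ω : C.OneForms) : C.val ω ∈ C.grade 1 := ω.2

theorem incl_mem (b : B) : C.incl b ∈ C.grade 0 := by
  rw [← C.range_incl]
  exact ⟨b, rfl⟩

theorem incl_mul_mem (b : B) {x : Ω} (h : x ∈ C.grade 1) : C.incl b * x ∈ C.grade 1 := by
  have := C.mul_mem (C.incl_mem b) h
  rwa [zero_add] at this

theorem mul_incl_mem (b : B) {x : Ω} (h : x ∈ C.grade 1) : x * C.incl b ∈ C.grade 1 :=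
  C.mul_mem h (C.incl_mem b)

/-- The left action of `B` on `Ω¹`. -/
noncomputable instance : Module B C.OneForms where
  smul b ω := ⟨C.incl b * C.val ω, C.incl_mul_mem b (C.val_mem ω)⟩
  one_smul ω := Subtype.ext (by change C.incl 1 * C.val ω = C.val ω; simp)
  mul_smul a b ω := Subtype.ext (by
    change C.incl (a * b) * C.val ω = C.incl a * (C.incl b * C.val ω); rw [map_mul, mul_assoc])
  smul_zero a := Subtype.ext (by change C.incl a * C.val 0 = C.val 0; simp)
  smul_add a ω η := Subtype.ext (by
    change C.incl a * C.val (ω + η) = C.incl a * C.val ω + C.incl a * C.val η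
    rw [map_add, mul_add])
  add_smul a b ω := Subtype.ext (by
    change C.incl (a + b) * C.val ω = C.incl a * C.val ω + C.incl b * C.val ω
    rw [map_add, add_mul])
  zero_smul ω := Subtype.ext (by change C.incl 0 * C.val ω = C.val 0; simp)

theorem val_smul (b : B) (ω : C.OneForms) : C.val (b • ω) = C.incl b * C.val ω := rfl

instance : IsScalarTower ℂ B C.OneForms where
  smul_assoc r b ω := C.val_injective (by
    rw [val_smul, map_smul, map_smul, val_smul, smul_mul_assoc])

/-- The left action `ω ↦ b ω` of `b` on `Ω¹`. -/
noncomputable def lmul (b : B) : C.OneForms →ₗ[ℂ] C.OneForms :=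
  (LinearMap.mulLeft ℂ (C.incl b)).restrict fun _ h => C.incl_mul_mem b h

theorem lmul_apply (b : B) (ω : C.OneForms) : C.lmul b ω = b • ω := rfl

/-- The right action `ω ↦ ω b` of `b` on `Ω¹`. -/
noncomputable def rmul (b : B) : C.OneForms →ₗ[ℂ] C.OneForms :=
  (LinearMap.mulRight ℂ (C.incl b)).restrict fun _ h => C.mul_incl_mem b h

theorem val_rmul (b : B) (ω : C.OneForms) : C.val (C.rmul b ω) = C.val ω * C.incl b := rfl

/-- The left action as a linear map on `B ⊗ Ω¹`. -/
noncomputable def lmulT : B ⊗[ℂ] C.OneForms →ₗ[ℂ] C.OneForms :=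
  TensorProduct.lift
    { toFun := C.lmul
      map_add' := fun a b => LinearMap.ext fun ω => add_smul a b ω
      map_smul' := fun r b => LinearMap.ext fun ω => C.val_injective (by
        change C.incl (r • b) * C.val ω = r • (C.incl b * C.val ω)
        rw [map_smul, smul_mul_assoc]) }

theorem lmulT_tmul (b : B) (ω : C.OneForms) : C.lmulT (b ⊗ₜ ω) = b • ω := rfl

/-- The right action as a linear map on `Ω¹ ⊗ B`. -/
noncomputable def rmulT : C.OneForms ⊗[ℂ] B →ₗ[ℂ] C.OneForms :=
  TensorProduct.lift (LinearMap.flip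
    { toFun := C.rmul
      map_add' := fun a b => LinearMap.ext fun ω => C.val_injective (by
        change C.val ω * C.incl (a + b) = C.val ω * C.incl a + C.val ω * C.incl b
        rw [map_add, mul_add])
      map_smul' := fun r b => LinearMap.ext fun ω => C.val_injective (by
        change C.val ω * C.incl (r • b) = r • (C.val ω * C.incl b)
        rw [map_smul, mul_smul_comm]) })

theorem rmulT_tmul (b : B) (ω : C.OneForms) : C.rmulT (ω ⊗ₜ b) = C.rmul b ω := rfl

theorem rmul_smul (a b : B) (ω : C.OneForms) : C.rmul b (a • ω) = a • C.rmul b ω :=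
  C.val_injective (mul_assoc _ _ _)

/-- The `*`-operation on `Ω¹`. -/
def star₁ : C.OneForms →ₗ⋆[ℂ] C.OneForms where
  toFun ω := ⟨C.star (C.val ω), C.star_mem (C.val_mem ω)⟩
  map_add' ω η := Subtype.ext (by
    change C.star (C.val (ω + η)) = C.star (C.val ω) + C.star (C.val η); rw [map_add, map_add])
  map_smul' r ω := Subtype.ext (by
    change C.star (C.val (r • ω)) = starRingEnd ℂ r • C.star (C.val ω)
    rw [map_smul, LinearMap.map_smulₛₗ])

theorem val_star₁ (ω : C.OneForms) : C.val (C.star₁ ω) = C.star (C.val ω) := rfl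

theorem star₁_rmul (b : B) (ω : C.OneForms) : C.star₁ (C.rmul b ω) = Star.star b • C.star₁ ω :=
  C.val_injective (by
    rw [val_star₁, val_rmul, val_smul, val_star₁, C.star_mul (C.val_mem ω) (C.incl_mem b),
      C.star_incl]
    simp)

theorem star₁_smul (b : B) (ω : C.OneForms) : C.star₁ (b • ω) = C.rmul (Star.star b) (C.star₁ ω) :=
  C.val_injective (by
    rw [val_star₁, val_rmul, val_smul, val_star₁, C.star_mul (C.incl_mem b) (C.val_mem ω),
      C.star_incl]
    simp)

theorem lTensor_val_injective : Function.Injective (C.val.lTensor A) :=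
  Module.Flat.lTensor_preserves_injective_linearMap _ C.val_injective

/-- The coaction of `A` on `Ω¹`, the restriction of the one on `Ω`. -/
noncomputable def coact₁ : C.OneForms →ₗ[ℂ] A ⊗[ℂ] C.OneForms :=
  (LinearEquiv.ofInjective (C.val.lTensor A) C.lTensor_val_injective).symm.toLinearMap ∘ₗ
    (coact A ∘ₗ C.val).codRestrict _ fun ω => C.coact_mem (C.val_mem ω)

theorem val_coact₁ (ω : C.OneForms) : C.val.lTensor A (C.coact₁ ω) = coact A (C.val ω) :=
  congrArg Subtype.val ((LinearEquiv.ofInjective (C.val.lTensor A)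
    C.lTensor_val_injective).apply_symm_apply
      (⟨coact A (C.val ω), C.coact_mem (C.val_mem ω)⟩ : LinearMap.range (C.val.lTensor A)))

theorem coact_val (ω : C.OneForms) : coact A (C.val ω) =
    TensorProduct.map LinearMap.id C.val (C.coact₁ ω) := (C.val_coact₁ ω).symm

theorem isCoaction_coact₁ : IsCoaction C.coact₁ where
  coassoc ω := by
    have hinj : Function.Injective ((C.val.lTensor A).lTensor A) :=
      Module.Flat.lTensor_preserves_injective_linearMap _ C.lTensor_val_injective
    apply hinj
    have h := (isCoaction_coact A Ω).coassoc (C.val ω)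
    rw [← C.val_coact₁] at h
    refine Eq.trans ?_ (h.trans ?_)
    · generalize C.coact₁ ω = t
      induction t with
      | zero => simp
      | add x y hx hy => simp only [map_add, hx, hy]
      | tmul a η =>
        simp only [LinearMap.rTensor_tmul, LinearMap.lTensor_tmul]
        generalize comul (R := ℂ) a = s
        induction s with
        | zero => simp
        | add x y hx hy => simp only [map_add, TensorProduct.add_tmul, hx, hy]
        | tmul c d => simp
    · generalize C.coact₁ ω = t
      induction t with
      | zero => simp
      | add x y hx hy => simp only [map_add, hx, hy]
      | tmul a η => simp only [LinearMap.lTensor_tmul, C.val_coact₁]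
  counit ω := by
    apply C.val_injective
    have h := (isCoaction_coact A Ω).counit (C.val ω)
    rw [← C.val_coact₁] at h
    refine Eq.trans ?_ h
    generalize C.coact₁ ω = t
    induction t with
    | zero => simp
    | add x y hx hy => simp only [map_add, hx, hy]
    | tmul a η => simp

theorem coact₁_lmulT (t : B ⊗[ℂ] C.OneForms) : C.coact₁ (C.lmulT t) =
    TensorProduct.map (LinearMap.mul' ℂ A) C.lmulT (tcoact (coact A) C.coact₁ t) := by
  apply C.lTensor_val_injective
  induction t with
  | zero => simp
  | add x y hx hy => simp only [map_add, hx, hy]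
  | tmul b ω =>
    rw [val_coact₁, lmulT_tmul, val_smul, ComoduleAlgebra.coact_mul, C.coact_incl, ← C.val_coact₁,
      tcoact_tmul]
    generalize C.coact₁ ω = s
    generalize coact A b = t
    induction t with
    | zero => simp
    | add x y hx hy => simp only [map_add, TensorProduct.add_tmul, add_mul, hx, hy]
    | tmul a c =>
      induction s with
      | zero => simp
      | add x y hx hy => simp only [map_add, TensorProduct.tmul_add, mul_add, hx, hy]
      | tmul d η => simp [lmulT_tmul, val_smul]

theorem coact₁_rmulT (t : C.OneForms ⊗[ℂ] B) : C.coact₁ (C.rmulT t) =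
    TensorProduct.map (LinearMap.mul' ℂ A) C.rmulT (tcoact C.coact₁ (coact A) t) := by
  apply C.lTensor_val_injective
  induction t with
  | zero => simp
  | add x y hx hy => simp only [map_add, hx, hy]
  | tmul ω b =>
    rw [val_coact₁, rmulT_tmul, val_rmul, ComoduleAlgebra.coact_mul, C.coact_incl, ← C.val_coact₁,
      tcoact_tmul]
    generalize C.coact₁ ω = s
    generalize coact A b = t
    induction t with
    | zero => simp
    | add x y hx hy => simp only [map_add, TensorProduct.tmul_add, mul_add, hx, hy]
    | tmul a c =>
      induction s with
      | zero => simp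
      | add x y hx hy => simp only [map_add, TensorProduct.add_tmul, add_mul, hx, hy]
      | tmul d η => simp [rmulT_tmul, val_rmul]

end CovariantStarCalculus

end OneForms

section TwoTensors

variable {A : Type u} {B : Type v} {Ω : Type w} [Ring A] [StarRing A]
  [HopfAlgebra ℂ A] [StarModule ℂ A] [Ring B] [StarRing B] [Algebra ℂ B]
  [StarModule ℂ B] [LeftComodule A B] [Ring Ω] [Algebra ℂ Ω]
  [LeftComodule A Ω] [ComoduleAlgebra A Ω] (C : CovariantStarCalculus A B Ω)

namespace CovariantStarCalculus

/-- The subspace of `Ω¹ ⊗ Ω¹` spanned by the elements `ω b ⊗ η - ω ⊗ b η`. -/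
def balanced : Submodule ℂ (C.OneForms ⊗[ℂ] C.OneForms) :=
  Submodule.span ℂ {t | ∃ ω b η, t = C.rmul b ω ⊗ₜ η - ω ⊗ₜ (b • η)}

/-- The bimodule `Ω¹ ⊗_B Ω¹`. -/
def TwoTensors : Type w := (C.OneForms ⊗[ℂ] C.OneForms) ⧸ C.balanced

noncomputable instance : AddCommGroup C.TwoTensors :=
  Submodule.Quotient.addCommGroup C.balanced

noncomputable instance : Module ℂ C.TwoTensors :=
  Submodule.Quotient.module C.balanced

/-- The projection `Ω¹ ⊗ Ω¹ → Ω¹ ⊗_B Ω¹`. -/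
noncomputable def proj : C.OneForms ⊗[ℂ] C.OneForms →ₗ[ℂ] C.TwoTensors := C.balanced.mkQ

theorem proj_surjective : Function.Surjective C.proj := C.balanced.mkQ_surjective

/-- The element `ω ⊗_B η` of `Ω¹ ⊗_B Ω¹`. -/
noncomputable def tmul (ω η : C.OneForms) : C.TwoTensors := C.proj (ω ⊗ₜ η)

theorem proj_tmul (ω η : C.OneForms) : C.proj (ω ⊗ₜ η) = C.tmul ω η := rfl

theorem tmul_balanced (ω η : C.OneForms) (b : B) :
    C.tmul (C.rmul b ω) η = C.tmul ω (b • η) :=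
  (Submodule.Quotient.eq _).2 (Submodule.subset_span ⟨ω, b, η, rfl⟩)

variable {C} in
/-- The map on `Ω¹ ⊗_B Ω¹` induced by a balanced map on `Ω¹ ⊗ Ω¹`. -/
def lift {σ : ℂ →+* ℂ} {N : Type*} [AddCommGroup N] [Module ℂ N]
    (f : C.OneForms ⊗[ℂ] C.OneForms →ₛₗ[σ] N)
    (h : ∀ ω b η, f (C.rmul b ω ⊗ₜ η) = f (ω ⊗ₜ (b • η))) : C.TwoTensors →ₛₗ[σ] N :=
  C.balanced.liftQ f <| Submodule.span_le.2 <| by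
    rintro _ ⟨ω, b, η, rfl⟩
    exact (map_sub f _ _).trans (sub_eq_zero.2 (h ω b η))

theorem lift_proj {σ : ℂ →+* ℂ} {N : Type*} [AddCommGroup N] [Module ℂ N]
    (f : C.OneForms ⊗[ℂ] C.OneForms →ₛₗ[σ] N)
    (h : ∀ ω b η, f (C.rmul b ω ⊗ₜ η) = f (ω ⊗ₜ (b • η))) (t : C.OneForms ⊗[ℂ] C.OneForms) :
    lift f h (C.proj t) = f t := rfl

/-- The left action of `B` on `Ω¹ ⊗_B Ω¹`. -/
noncomputable def lmul₂ (b : B) : C.TwoTensors →ₗ[ℂ] C.TwoTensors :=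
  lift (C.proj ∘ₗ (C.lmul b).rTensor C.OneForms) fun ω a η => by
    simp only [LinearMap.comp_apply, LinearMap.rTensor_tmul, proj_tmul, lmul_apply, ← rmul_smul,
      tmul_balanced]

theorem lmul₂_tmul (b : B) (ω η : C.OneForms) : C.lmul₂ b (C.tmul ω η) = C.tmul (b • ω) η := rfl

/-- The right action of `B` on `Ω¹ ⊗_B Ω¹`. -/
noncomputable def rmul₂ (b : B) : C.TwoTensors →ₗ[ℂ] C.TwoTensors :=
  lift (C.proj ∘ₗ (C.rmul b).lTensor C.OneForms) fun ω a η => by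
    simp only [LinearMap.comp_apply, LinearMap.lTensor_tmul, proj_tmul, rmul_smul, tmul_balanced]

theorem rmul₂_tmul (b : B) (ω η : C.OneForms) :
    C.rmul₂ b (C.tmul ω η) = C.tmul ω (C.rmul b η) := rfl

/-- The codiagonal coaction `ω ⊗ η ↦ ω₍₋₁₎ η₍₋₁₎ ⊗ (ω₍₀₎ ⊗_B η₍₀₎)` as a map on `Ω¹ ⊗ Ω¹`. -/
noncomputable def preCoact₂ : C.OneForms ⊗[ℂ] C.OneForms →ₗ[ℂ] A ⊗[ℂ] C.TwoTensors :=
  TensorProduct.map (LinearMap.mul' ℂ A) C.proj ∘ₗ tcoact C.coact₁ C.coact₁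

theorem preCoact₂_balanced (ω η : C.OneForms) (b : B) :
    C.preCoact₂ (C.rmul b ω ⊗ₜ η) = C.preCoact₂ (ω ⊗ₜ (b • η)) := by
  rw [← rmulT_tmul, ← lmulT_tmul]
  simp only [preCoact₂, LinearMap.comp_apply, tcoact_tmul, coact₁_lmulT, coact₁_rmulT]
  generalize C.coact₁ ω = r
  generalize C.coact₁ η = s
  generalize coact A b = t
  induction r with
  | zero => simp
  | add x y hx hy => simp only [map_add, TensorProduct.add_tmul, hx, hy]
  | tmul a₁ ω =>
    induction s with
    | zero => simp
    | add x y hx hy => simp only [map_add, TensorProduct.tmul_add, hx, hy]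
    | tmul a₂ η =>
      induction t with
      | zero => simp
      | add x y hx hy =>
        simp only [map_add, TensorProduct.add_tmul, TensorProduct.tmul_add, hx, hy]
      | tmul a₃ c =>
        simp only [TensorProduct.tensorTensorTensorComm_tmul, TensorProduct.map_tmul,
          LinearMap.mul'_apply, rmulT_tmul, lmulT_tmul, mul_assoc]
        exact congrArg _ (C.tmul_balanced ω η c)

/-- The coaction `ω ⊗_B η ↦ ω₍₋₁₎ η₍₋₁₎ ⊗ (ω₍₀₎ ⊗_B η₍₀₎)` of `A` on `Ω¹ ⊗_B Ω¹`. -/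
noncomputable def coact₂ : C.TwoTensors →ₗ[ℂ] A ⊗[ℂ] C.TwoTensors :=
  lift C.preCoact₂ fun ω b η => C.preCoact₂_balanced ω η b

/-- The map `ω ⊗_B η ↦ η* ⊗_B ω*` of `Ω¹ ⊗_B Ω¹`. -/
noncomputable def dagger : C.TwoTensors →ₗ⋆[ℂ] C.TwoTensors :=
  lift (C.proj.comp (swapMap C.star₁)) fun ω b η => by
    simp only [LinearMap.comp_apply, swapMap_tmul, star₁_rmul, star₁_smul, proj_tmul,
      tmul_balanced]

theorem dagger_tmul (ω η : C.OneForms) :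
    C.dagger (C.tmul ω η) = C.tmul (C.star₁ η) (C.star₁ ω) := rfl

end CovariantStarCalculus

end TwoTensors

section Metrics

variable {A : Type u} {B : Type v} {Ω : Type w} [Ring A] [StarRing A]
  [HopfAlgebra ℂ A] [StarModule ℂ A] [Ring B] [StarRing B] [Algebra ℂ B]
  [StarModule ℂ B] [LeftComodule A B] [Ring Ω] [Algebra ℂ Ω]
  [LeftComodule A Ω] [ComoduleAlgebra A Ω] (C : CovariantStarCalculus A B Ω)

namespace CovariantStarCalculus

/-- A `B`-bilinear map `( , ) : Ω¹ ⊗_B Ω¹ → B`. -/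
structure Pairing where
  pairing : C.TwoTensors →ₗ[ℂ] B
  pairing_lmul : ∀ (b : B) (t : C.TwoTensors), pairing (C.lmul₂ b t) = b * pairing t
  pairing_rmul : ∀ (b : B) (t : C.TwoTensors), pairing (C.rmul₂ b t) = pairing t * b

variable {C}

namespace Pairing

variable (m : C.Pairing)

/-- The map `η ↦ (ω, η)`. -/
noncomputable def left (ω : C.OneForms) : C.OneForms →ₗ[ℂ] B :=
  m.pairing ∘ₗ C.proj ∘ₗ TensorProduct.mk ℂ C.OneForms C.OneForms ω

theorem left_apply (ω η : C.OneForms) : m.left ω η = m.pairing (C.tmul ω η) := rfl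

/-- The map `η ↦ (η, ω)`. -/
noncomputable def right (ω : C.OneForms) : C.OneForms →ₗ[ℂ] B :=
  m.pairing ∘ₗ C.proj ∘ₗ (TensorProduct.mk ℂ C.OneForms C.OneForms).flip ω

theorem right_apply (ω η : C.OneForms) : m.right ω η = m.pairing (C.tmul η ω) := rfl

/-- The map `(ω, ) ⊗_B id : ω₁ ⊗_B ω₂ ↦ (ω, ω₁) ω₂`. -/
noncomputable def contractLeft (ω : C.OneForms) : C.TwoTensors →ₗ[ℂ] C.OneForms :=
  lift (C.lmulT ∘ₗ (m.left ω).rTensor C.OneForms) fun ω₁ b ω₂ => by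
    simp only [LinearMap.comp_apply, LinearMap.rTensor_tmul, lmulT_tmul, left_apply]
    rw [← rmul₂_tmul, m.pairing_rmul, mul_smul]

theorem contractLeft_tmul (ω ω₁ ω₂ : C.OneForms) :
    m.contractLeft ω (C.tmul ω₁ ω₂) = m.pairing (C.tmul ω ω₁) • ω₂ := rfl

/-- The map `id ⊗_B ( , ω) : ω₁ ⊗_B ω₂ ↦ ω₁ (ω₂, ω)`. -/
noncomputable def contractRight (ω : C.OneForms) : C.TwoTensors →ₗ[ℂ] C.OneForms :=
  lift (C.rmulT ∘ₗ (m.right ω).lTensor C.OneForms) fun ω₁ b ω₂ => by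
    simp only [LinearMap.comp_apply, LinearMap.lTensor_tmul, rmulT_tmul, right_apply]
    rw [← lmul₂_tmul, m.pairing_lmul]
    apply C.val_injective
    simp only [val_rmul, map_mul, mul_assoc]

theorem contractRight_tmul (ω ω₁ ω₂ : C.OneForms) :
    m.contractRight ω (C.tmul ω₁ ω₂) = C.rmul (m.pairing (C.tmul ω₂ ω)) ω₁ := rfl

end Pairing

variable (C)

/-- A metric `(g, ( , ))` on `Ω¹`: an element `g` of `Ω¹ ⊗_B Ω¹` and a `B`-bilinear map
`( , ) : Ω¹ ⊗_B Ω¹ → B` with `((ω, ) ⊗_B id) g = ω = (id ⊗_B ( , ω)) g` for all `ω`. -/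
structure Metric extends Pairing C where
  g : C.TwoTensors
  contractLeft_g : ∀ ω, toPairing.contractLeft ω g = ω
  contractRight_g : ∀ ω, toPairing.contractRight ω g = ω

variable {C}

namespace Metric

variable (m : C.Metric)

/-- The map `coev_g : b ↦ b g`. -/
noncomputable def coev : B →ₗ[ℂ] C.TwoTensors where
  toFun b := C.lmul₂ b m.g
  map_add' a b := by
    obtain ⟨t, ht⟩ := C.proj_surjective m.g
    rw [← ht]; clear ht
    induction t with
    | zero => simp
    | add x y hx hy => simp only [map_add, hx, hy]; abel
    | tmul ω η =>
      change C.tmul ((a + b) • ω) η = C.tmul (a • ω) η + C.tmul (b • ω) η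
      simp only [tmul, add_smul, TensorProduct.add_tmul, map_add]
  map_smul' r b := by
    obtain ⟨t, ht⟩ := C.proj_surjective m.g
    rw [← ht]; clear ht
    induction t with
    | zero => simp
    | add x y hx hy => simp only [map_add, hx, hy, smul_add]
    | tmul ω η =>
      change C.tmul ((r • b) • ω) η = r • C.tmul (b • ω) η
      rw [smul_assoc]
      exact map_smul C.proj r ((b • ω) ⊗ₜ[ℂ] η)

theorem coev_apply (b : B) : m.coev b = C.lmul₂ b m.g := rfl

/-- A metric is covariant if the maps `( , )` and `coev_g` are morphisms of comodules. -/
def IsCovariant : Prop :=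
  (∀ t, coact A (m.pairing t) = m.pairing.lTensor A (C.coact₂ t)) ∧
    ∀ b, C.coact₂ (m.coev b) = m.coev.lTensor A (coact A b)

/-- A metric with `g = ∑ ωᵢ ⊗_B ηᵢ` is real if `g = ∑ ηᵢ* ⊗_B ωᵢ*`. -/
def IsReal : Prop := C.dagger m.g = m.g

end Metric

variable (C)

/-- The set of covariant real metrics on `Ω¹`. -/
def CovariantRealMetric : Type (max v w) := {m : C.Metric // m.IsCovariant ∧ m.IsReal}

variable {C}

/-- The evaluation of elements of `Hom_B(Ω¹, B)` at `e`. -/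
noncomputable def evalAt (e : C.OneForms) : (C.OneForms →ₗ[B] B) →ₗ[ℂ] B where
  toFun f := f e
  map_add' _ _ := rfl
  map_smul' _ _ := rfl

/-- The map `e ↦ S(e₍₋₁₎) f(e₍₀₎)₍₋₁₎ ⊗ f(e₍₀₎)₍₀₎`, which determines the coaction on
`f ∈ Hom_B(Ω¹, B)` by the formula `f₍₋₁₎ ⊗ f₍₀₎(e) = S(e₍₋₁₎) f(e₍₀₎)₍₋₁₎ ⊗ f(e₍₀₎)₍₀₎`. -/
noncomputable def dualCoact (f : C.OneForms →ₗ[ℂ] B) : C.OneForms →ₗ[ℂ] A ⊗[ℂ] B :=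
  (LinearMap.mul' ℂ A ∘ₗ (HopfAlgebra.antipode ℂ (A := A)).rTensor A).rTensor B ∘ₗ
    (TensorProduct.assoc ℂ A A B).symm.toLinearMap ∘ₗ (coact A ∘ₗ f.restrictScalars ℂ).lTensor A ∘ₗ C.coact₁

variable (C)

/-- A covariant Hermitian metric on `Ω¹`: the left `B`-module `Ω¹` is finitely generated and
projective, and `H` is an isomorphism of relative Hopf modules from the conjugate of `Ω¹` to the
left dual `Hom_B(Ω¹, B)` such that `⟨x, ȳ⟩ = H(ȳ)(x)` satisfies `⟨y, x̄⟩* = ⟨x, ȳ⟩`.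
Here `H` is given as the conjugate-linear map `y ↦ H(ȳ)`.
The structures on the conjugate are `b ȳ = overline(y b*)`, `ȳ b = overline(b* y)` and
`ȳ ↦ y₍₋₁₎* ⊗ overline(y₍₀₎)`; those on the dual are `(b f)(e) = f(e b)`, `(f b)(e) = f(e) b`
and the coaction described at `dualCoact`. -/
structure CovariantHermitianMetric : Type (max v w) where
  finite : Module.Finite B C.OneForms
  projective : Module.Projective B C.OneForms
  /-- the conjugate-linear map `y ↦ H(ȳ)`; `H y x` stands for `⟨x, ȳ⟩` -/
  H : C.OneForms →ₗ⋆[ℂ] C.OneForms →ₗ[B] B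
  bijective : Function.Bijective H
  map_lmul : ∀ (b : B) (y e : C.OneForms), H (C.rmul (Star.star b) y) e = H y (C.rmul b e)
  map_rmul : ∀ (b : B) (y e : C.OneForms), H (Star.star b • y) e = H y e * b
  covariant : ∀ y e : C.OneForms, dualCoact (H y) e =
    TensorProduct.map (starL A) ((evalAt e).comp H) (C.coact₁ y)
  hermitian : ∀ x y : C.OneForms, Star.star (H x y) = H y x

end CovariantStarCalculus

end Metrics

section TwistForms

variable {A : Type u} {B : Type v} {Ω : Type w} [Ring A] [StarRing A]
  [HopfAlgebra ℂ A] [StarModule ℂ A] [HopfStarAlgebra A] [Ring B] [StarRing B] [Algebra ℂ B]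
  [StarModule ℂ B] [LeftComodule A B] [ComoduleStarAlgebra A B] [Ring Ω] [Algebra ℂ Ω]
  [LeftComodule A Ω] [ComoduleAlgebra A Ω] (C : CovariantStarCalculus A B Ω)
  (γ : UnitaryTwoCocycle A)

namespace CovariantStarCalculus

/-- The identity map of `Ω¹`, seen as a linear map to `(Ω_γ)¹`. -/
noncomputable def of₁ : C.OneForms ≃ₗ[ℂ] (C.twist γ).OneForms :=
  (Twist.of γ (B := Ω)).submoduleMap (C.grade 1)

theorem val_of₁ (ω : C.OneForms) : (C.twist γ).val (C.of₁ γ ω) = Twist.of γ (C.val ω) := rfl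

theorem of₁_lmul (b : B) (ω : C.OneForms) : Twist.of γ b • C.of₁ γ ω =
    C.of₁ γ (C.lmulT (act (tcoact (coact A) C.coact₁) γ.fn (b ⊗ₜ ω))) := by
  apply (C.twist γ).val_injective
  rw [val_smul, val_of₁, val_of₁]
  change Twist.of γ (algMul γ Ω (C.incl b ⊗ₜ C.val ω)) = _
  congr 1
  have h := act_map (δ := tcoact (coact A) C.coact₁) (δ' := tcoact (coact A) (coact A))
    (TensorProduct.map LinearMap.id LinearMap.id)
    (TensorProduct.map C.incl.toLinearMap C.val)
    (fun t => tcoact_map (LinearMap.id : A →ₗ[ℂ] A) (LinearMap.id : A →ₗ[ℂ] A) C.incl.toLinearMap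
      C.val C.coact_incl C.coact_val t) γ.fn (b ⊗ₜ ω)
  rw [TensorProduct.map_id, pre_id] at h
  refine (congrArg (LinearMap.mul' ℂ Ω) h).trans ?_
  generalize act _ γ.fn (b ⊗ₜ[ℂ] ω) = t
  induction t with
  | zero => simp
  | add x y hx hy => simp only [map_add, hx, hy]
  | tmul c m => simp [lmulT_tmul, val_smul]

theorem of₁_rmul (b : B) (ω : C.OneForms) : (C.twist γ).rmul (Twist.of γ b) (C.of₁ γ ω) =
    C.of₁ γ (C.rmulT (act (tcoact C.coact₁ (coact A)) γ.fn (ω ⊗ₜ b))) := by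
  apply (C.twist γ).val_injective
  rw [val_rmul, val_of₁, val_of₁]
  change Twist.of γ (algMul γ Ω (C.val ω ⊗ₜ C.incl b)) = _
  congr 1
  have h := act_map (δ := tcoact C.coact₁ (coact A)) (δ' := tcoact (coact A) (coact A))
    (TensorProduct.map LinearMap.id LinearMap.id)
    (TensorProduct.map C.val C.incl.toLinearMap)
    (fun t => tcoact_map (LinearMap.id : A →ₗ[ℂ] A) (LinearMap.id : A →ₗ[ℂ] A) C.val
      C.incl.toLinearMap C.coact_val C.coact_incl t) γ.fn (ω ⊗ₜ b)
  rw [TensorProduct.map_id, pre_id] at h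
  refine (congrArg (LinearMap.mul' ℂ Ω) h).trans ?_
  generalize act _ γ.fn (ω ⊗ₜ[ℂ] b) = t
  induction t with
  | zero => simp
  | add x y hx hy => simp only [map_add, hx, hy]
  | tmul c m => simp [rmulT_tmul, val_rmul]

/-- The map `φ : Ω¹_γ ⊗_{B_γ} Ω¹_γ → Ω¹ ⊗_B Ω¹`,
`ω ⊗_{B_γ} η ↦ γ(ω₍₋₁₎ ⊗ η₍₋₁₎) ω₍₀₎ ⊗_B η₍₀₎`. -/
noncomputable def phi : (C.twist γ).TwoTensors →ₗ[ℂ] C.TwoTensors :=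
  lift (C.proj ∘ₗ act (tcoact C.coact₁ C.coact₁) γ.fn ∘ₗ
      TensorProduct.map (C.of₁ γ).symm.toLinearMap (C.of₁ γ).symm.toLinearMap) fun ω b η => by
    obtain ⟨ω, rfl⟩ := (C.of₁ γ).surjective ω
    obtain ⟨η, rfl⟩ := (C.of₁ γ).surjective η
    obtain ⟨b, rfl⟩ := (Twist.of γ).surjective b
    rw [of₁_lmul, of₁_rmul]
    simp only [LinearMap.comp_apply, TensorProduct.map_tmul, LinearEquiv.coe_coe,
      LinearEquiv.symm_apply_apply]
    exact twist_assoc γ.toTwoCocycle C.isCoaction_coact₁ C.isCoaction_coact₁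
      (isCoaction_coact A B) C.rmulT C.lmulT C.proj C.coact₁_rmulT C.coact₁_lmulT
      (fun ω b η => C.tmul_balanced ω η b) ω b η

theorem phi_tmul (ω η : C.OneForms) : C.phi γ ((C.twist γ).tmul (C.of₁ γ ω) (C.of₁ γ η)) =
    C.proj (act (tcoact C.coact₁ C.coact₁) γ.fn (ω ⊗ₜ η)) := by
  change C.proj (act (tcoact C.coact₁ C.coact₁) γ.fn
    (((C.of₁ γ).symm (C.of₁ γ ω)) ⊗ₜ ((C.of₁ γ).symm (C.of₁ γ η)))) = _
  simp only [LinearEquiv.symm_apply_apply]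

end CovariantStarCalculus

end TwistForms

end CocycleTwist

open CocycleTwist

/-!
The bijections come from three observations.

*Metrics are Hermitian metrics.* A metric `(g, ( , ))` is determined by its pairing: contracting
`t` with `g = ∑ αᵢ ⊗_B βᵢ` gives `t = ∑ αᵢ ⊗_B ((βᵢ, ) ⊗_B id) t`. Hence all conditions on a metric
can be read off from the pairing. Covariance of the pairing makes `g` coinvariant
(`Metric.coact₂_g`), and `g` is real if and only if `(ω, η)* = (η*, ω*)` (`Metric.isReal_iff`). With
`H(ω̄)(η) = (η, ω*)`, nondegeneracy of the pairing says that `βᵢ` and `( , αᵢ)` are dual bases of the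
left module `Ω¹`, so that `Ω¹` is finitely generated and projective and `H` is bijective. Covariance
of the pairing becomes colinearity of `H` after multiplication with the antipode
(`Pairing.isCovariant_iff_convAct`). Conversely dual bases for `H` give `g`.

*Twisting pairings.* For covariant operations `u v`, `v w` the associativity law `(u v) w = u (v w)`
is equivalent to that of the twisted operations, since by the cocycle identity both sides are
transformed by one invertible functional (`twist_assoc_iff`). Applied to the `B`-actions and
the pairing, this shows that a covariant linear map `Ω¹ ⊗ Ω¹ → B` is balanced and `B`-bilinear if
and only if its composition with the action of `γ` is so for `B_γ`. Applied to the
contractions, it shows that contraction with `t` on `Ω¹_γ` is contraction with `φ(t)` on `Ω¹`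
whenever `φ(t)` is coinvariant. Hence metrics correspond under `( , )_γ = ( , ) ∘ φ`, and
`φ(g_γ) = g`.

*Reality.* Both sides of the Hermitian condition for `( , )_γ` are obtained from those for `( , )` by
the action of the invertible functionals `γ` and `V̄` (`Pairing.IsTwistOf.isHermitian_iff`).
-/

namespace CocycleTwist

open Coalgebra WithConv

universe u v w

/-! ### Convolution with a coaction -/

section ConvolutionAction

variable {A : Type*} [Ring A] [HopfAlgebra ℂ A]
variable {M : Type*} [AddCommGroup M] [Module ℂ M]
variable {X : Type*} [AddCommGroup X] [Module ℂ X]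

/-- The map `m ↦ f(m₍₋₁₎) F(m₍₀₎)`, where `A` acts on the first factor of `A ⊗ X` by left
multiplication. -/
noncomputable def convAct (δ : M →ₗ[ℂ] A ⊗[ℂ] M) (f : A →ₗ[ℂ] A) (F : M →ₗ[ℂ] A ⊗[ℂ] X) :
    M →ₗ[ℂ] A ⊗[ℂ] X :=
  (LinearMap.mul' ℂ A ∘ₗ f.rTensor A).rTensor X ∘ₗ
    (TensorProduct.assoc ℂ A A X).symm.toLinearMap ∘ₗ F.lTensor A ∘ₗ δ

variable {δ : M →ₗ[ℂ] A ⊗[ℂ] M}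

/-- The convolution algebra of endomorphisms of `A` acts on the maps `M → A ⊗ X`. -/
theorem convAct_convAct (h : IsCoaction δ) (f g : WithConv (A →ₗ[ℂ] A)) (F : M →ₗ[ℂ] A ⊗[ℂ] X) :
    convAct δ f.ofConv (convAct δ g.ofConv F) = convAct δ (f * g).ofConv F := by
  let K : (A →ₗ[ℂ] A) → A ⊗[ℂ] (A ⊗[ℂ] X) →ₗ[ℂ] A ⊗[ℂ] X := fun f =>
    (LinearMap.mul' ℂ A ∘ₗ f.rTensor A).rTensor X ∘ₗ
      (TensorProduct.assoc ℂ A A X).symm.toLinearMap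
  have key : ∀ t : A ⊗[ℂ] M, K f.ofConv ((convAct δ g.ofConv F).lTensor A t) =
      K f.ofConv ((K g.ofConv).lTensor A ((F.lTensor A).lTensor A (δ.lTensor A t))) := by
    intro t
    induction t with
    | zero => simp
    | add x y hx hy => simp only [map_add, hx, hy]
    | tmul a m => rfl
  have key2 : ∀ t : A ⊗[ℂ] M, K (f * g).ofConv (F.lTensor A t) =
      K f.ofConv ((K g.ofConv).lTensor A ((F.lTensor A).lTensor A
        (TensorProduct.assoc ℂ A A M (comul.rTensor M t)))) := by
    intro t
    induction t with
    | zero => simp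
    | add x y hx hy => simp only [map_add, hx, hy]
    | tmul a m =>
      have h1 : ∀ s : A ⊗[ℂ] A, (F.lTensor A).lTensor A (TensorProduct.assoc ℂ A A M (s ⊗ₜ m)) =
          TensorProduct.assoc ℂ A A (A ⊗[ℂ] X) (s ⊗ₜ F m) := by
        intro s
        induction s with
        | zero => simp
        | add x y hx hy => simp only [map_add, TensorProduct.add_tmul, hx, hy]
        | tmul a b => simp
      have h2 : ∀ b, (f * g).ofConv b = LinearMap.mul' ℂ A
        (TensorProduct.map f.ofConv g.ofConv (comul b)) := fun _ => rfl
      rw [LinearMap.rTensor_tmul, LinearMap.lTensor_tmul, h1]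
      generalize F m = y
      induction y with
      | zero => simp
      | add x y hx hy => simp only [map_add, TensorProduct.tmul_add, hx, hy]
      | tmul b x =>
        simp only [K, LinearMap.comp_apply, LinearEquiv.coe_coe, TensorProduct.assoc_symm_tmul,
          LinearMap.rTensor_tmul, LinearMap.mul'_apply, h2]
        induction comul (R := ℂ) a with
        | zero => simp
        | add x y hx hy => simp only [map_add, TensorProduct.add_tmul, add_mul, hx, hy]
        | tmul c d => simp [mul_assoc]
  apply LinearMap.ext
  intro m
  change K f.ofConv ((convAct δ g.ofConv F).lTensor A (δ m)) = K (f * g).ofConv (F.lTensor A (δ m))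
  rw [key, key2, h.coassoc]

theorem convAct_one (h : IsCoaction δ) (F : M →ₗ[ℂ] A ⊗[ℂ] X) :
    convAct δ (1 : WithConv (A →ₗ[ℂ] A)).ofConv F = F := by
  have key : ∀ t : A ⊗[ℂ] M, (LinearMap.mul' ℂ A ∘ₗ
      (1 : WithConv (A →ₗ[ℂ] A)).ofConv.rTensor A).rTensor X
        ((TensorProduct.assoc ℂ A A X).symm (F.lTensor A t)) =
      F (TensorProduct.lid ℂ M ((Coalgebra.counit (R := ℂ)).rTensor M t)) := by
    intro t
    induction t with
    | zero => simp
    | add x y hx hy => simp only [map_add, hx, hy]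
    | tmul a m =>
      simp only [LinearMap.lTensor_tmul, LinearMap.rTensor_tmul, TensorProduct.lid_tmul, map_smul]
      induction F m with
      | zero => simp
      | add x y hx hy => simp only [map_add, TensorProduct.tmul_add, smul_add, hx, hy]
      | tmul b x =>
        simp [LinearMap.convOne_def, Algebra.algebraMap_eq_smul_one, TensorProduct.smul_tmul']
  apply LinearMap.ext
  intro m
  refine (key (δ m)).trans ?_
  rw [h.counit]

/-- `S(m₍₋₂₎) m₍₋₁₎ F(m₍₀₎) = F(m)`. -/
theorem convAct_antipode_convAct_id (h : IsCoaction δ) (F : M →ₗ[ℂ] A ⊗[ℂ] X) :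
    convAct δ (HopfAlgebra.antipode ℂ) (convAct δ LinearMap.id F) = F := by
  have h1 := convAct_convAct h (toConv (HopfAlgebra.antipode ℂ (A := A))) (toConv LinearMap.id) F
  rw [LinearMap.antipode_mul_id, convAct_one h] at h1
  exact h1

/-- `m₍₋₂₎ S(m₍₋₁₎) F(m₍₀₎) = F(m)`. -/
theorem convAct_id_convAct_antipode (h : IsCoaction δ) (F : M →ₗ[ℂ] A ⊗[ℂ] X) :
    convAct δ LinearMap.id (convAct δ (HopfAlgebra.antipode ℂ) F) = F := by
  have h1 := convAct_convAct h (toConv LinearMap.id) (toConv (HopfAlgebra.antipode ℂ (A := A))) F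
  rw [LinearMap.id_mul_antipode, convAct_one h] at h1
  exact h1

end ConvolutionAction

/-! ### Twisting of covariant bilinear operations -/

section TwistedOperations

variable {A : Type*} [Ring A] [HopfAlgebra ℂ A] (γ : TwoCocycle A)
variable {U V W X Y Z : Type*} [AddCommGroup U] [Module ℂ U] [AddCommGroup V] [Module ℂ V]
  [AddCommGroup W] [Module ℂ W] [AddCommGroup X] [Module ℂ X] [AddCommGroup Y] [Module ℂ Y]
  [AddCommGroup Z] [Module ℂ Z]

theorem act_fn_act_inv {δ : U →ₗ[ℂ] A ⊗[ℂ] U} {δ' : V →ₗ[ℂ] A ⊗[ℂ] V} (h : IsCoaction δ)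
    (h' : IsCoaction δ') (t : U ⊗[ℂ] V) :
    act (tcoact δ δ') γ.fn (act (tcoact δ δ') γ.inv t) = t := by
  rw [← act_mul (isCoaction_tcoact h h'), γ.inv_mul_fn, act_one (isCoaction_tcoact h h')]

theorem act_inv_act_fn {δ : U →ₗ[ℂ] A ⊗[ℂ] U} {δ' : V →ₗ[ℂ] A ⊗[ℂ] V} (h : IsCoaction δ)
    (h' : IsCoaction δ') (t : U ⊗[ℂ] V) :
    act (tcoact δ δ') γ.inv (act (tcoact δ δ') γ.fn t) = t := by
  rw [← act_mul (isCoaction_tcoact h h'), γ.fn_mul_inv, act_one (isCoaction_tcoact h h')]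

/-- The cocycle acts trivially on `u ⊗ v` if `v` is coinvariant. -/
theorem act_fn_tmul_coinvariant {δ : U →ₗ[ℂ] A ⊗[ℂ] U} {δ' : V →ₗ[ℂ] A ⊗[ℂ] V} (h : IsCoaction δ)
    {v : V} (hv : δ' v = 1 ⊗ₜ v) (u : U) : act (tcoact δ δ') γ.fn (u ⊗ₜ v) = u ⊗ₜ v := by
  have := act_map (δ := δ) (δ' := tcoact δ δ') ((TensorProduct.mk ℂ A A).flip 1)
    ((TensorProduct.mk ℂ U V).flip v) (fun m => by
      simp only [LinearMap.flip_apply, TensorProduct.mk_apply, tcoact_tmul, hv]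
      induction δ m with
      | zero => simp
      | add x y hx hy => simp only [map_add, TensorProduct.add_tmul, hx, hy]
      | tmul a b => simp) γ.fn u
  rwa [γ.fn_pre_right, act_one h] at this

/-- The cocycle acts trivially on `v ⊗ u` if `v` is coinvariant. -/
theorem act_fn_coinvariant_tmul {δ : U →ₗ[ℂ] A ⊗[ℂ] U} {δ' : V →ₗ[ℂ] A ⊗[ℂ] V} (h : IsCoaction δ)
    {v : V} (hv : δ' v = 1 ⊗ₜ v) (u : U) : act (tcoact δ' δ) γ.fn (v ⊗ₜ u) = v ⊗ₜ u := by
  have := act_map (δ := δ) (δ' := tcoact δ' δ) (TensorProduct.mk ℂ A A 1)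
    (TensorProduct.mk ℂ V U v) (fun m => by
      simp only [TensorProduct.mk_apply, tcoact_tmul, hv]
      induction δ m with
      | zero => simp
      | add x y hx hy => simp only [map_add, TensorProduct.tmul_add, hx, hy]
      | tmul a b => simp) γ.fn u
  rwa [γ.fn_pre_left, act_one h] at this

/-- A bilinear associativity law `(u v) w = u (v w)` between covariant operations holds if and only
if it holds for the twisted operations: both sides of the twisted law are obtained from those of the
original one by the action of the same invertible functional
`γ(a₍₁₎ ⊗ b₍₁₎) γ(a₍₂₎ b₍₂₎ ⊗ c)` on `u ⊗ v ⊗ w`. -/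
theorem twist_assoc_iff {δU : U →ₗ[ℂ] A ⊗[ℂ] U} {δV : V →ₗ[ℂ] A ⊗[ℂ] V} {δW : W →ₗ[ℂ] A ⊗[ℂ] W}
    {δX : X →ₗ[ℂ] A ⊗[ℂ] X} {δZ : Z →ₗ[ℂ] A ⊗[ℂ] Z}
    (hU : IsCoaction δU) (hV : IsCoaction δV) (hW : IsCoaction δW)
    {p : U ⊗[ℂ] V →ₗ[ℂ] X} {q : V ⊗[ℂ] W →ₗ[ℂ] Z}
    (hp : ∀ t, δX (p t) = TensorProduct.map (LinearMap.mul' ℂ A) p (tcoact δU δV t))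
    (hq : ∀ t, δZ (q t) = TensorProduct.map (LinearMap.mul' ℂ A) q (tcoact δV δW t))
    (r : X ⊗[ℂ] W →ₗ[ℂ] Y) (r' : U ⊗[ℂ] Z →ₗ[ℂ] Y) :
    (∀ u v w, r (p (u ⊗ₜ v) ⊗ₜ w) = r' (u ⊗ₜ q (v ⊗ₜ w))) ↔
    ∀ u v w, r (act (tcoact δX δW) γ.fn (p (act (tcoact δU δV) γ.fn (u ⊗ₜ v)) ⊗ₜ w)) =
      r' (act (tcoact δU δZ) γ.fn (u ⊗ₜ q (act (tcoact δV δW) γ.fn (v ⊗ₜ w)))) := by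
  set F := extFn γ.fn 1 * γ.fn.pre ((LinearMap.mul' ℂ A).rTensor A) with hF
  set F' := γ.inv.pre ((LinearMap.mul' ℂ A).rTensor A) * extFn γ.inv 1
  have h3 := isCoaction_tcoact (isCoaction_tcoact hU hV) hW
  have hF'F : F' * F = 1 := by
    have h1 : extFn γ.inv 1 * extFn γ.fn 1 = (1 : Fn ((A ⊗[ℂ] A) ⊗[ℂ] A)) :=
      extFn_pair_one γ.inv_mul_fn (one_mul 1)
    have h2 : γ.inv.pre ((LinearMap.mul' ℂ A).rTensor A) *
        γ.fn.pre ((LinearMap.mul' ℂ A).rTensor A) = 1 :=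
      pre_pair_one (isCoalgMap_rTensor A) γ.inv_mul_fn
    calc F' * F = γ.inv.pre ((LinearMap.mul' ℂ A).rTensor A) * ((extFn γ.inv 1 * extFn γ.fn 1) *
          γ.fn.pre ((LinearMap.mul' ℂ A).rTensor A)) := by simp only [F, F', mul_assoc]
      _ = 1 := by rw [h1, one_mul, h2]
  have e1 : ∀ u v w, act (tcoact δX δW) γ.fn (p (act (tcoact δU δV) γ.fn (u ⊗ₜ v)) ⊗ₜ w) =
      p.rTensor W (act (tcoact (tcoact δU δV) δW) F ((u ⊗ₜ v) ⊗ₜ w)) := by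
    intro u v w
    rw [hF, act_mul h3, act_tcoact, act_one hW]
    exact act_map ((LinearMap.mul' ℂ A).rTensor A) (TensorProduct.map p LinearMap.id)
      (fun t => tcoact_map (LinearMap.mul' ℂ A) LinearMap.id p LinearMap.id hp map_id_coact t)
      γ.fn (act (tcoact δU δV) γ.fn (u ⊗ₜ v) ⊗ₜ w)
  have e2 : ∀ u v w, act (tcoact δU δZ) γ.fn (u ⊗ₜ q (act (tcoact δV δW) γ.fn (v ⊗ₜ w))) =
      q.lTensor U (TensorProduct.assoc ℂ U V W
        (act (tcoact (tcoact δU δV) δW) F ((u ⊗ₜ v) ⊗ₜ w))) := by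
    intro u v w
    rw [hF, γ.cocycle, ← act_assoc, act_mul (isCoaction_tcoact hU (isCoaction_tcoact hV hW)),
      TensorProduct.assoc_tmul, act_tcoact, act_one hU]
    exact act_map ((LinearMap.mul' ℂ A).lTensor A) (TensorProduct.map LinearMap.id q)
      (fun t => tcoact_map LinearMap.id (LinearMap.mul' ℂ A) LinearMap.id q map_id_coact hq t)
      γ.fn (u ⊗ₜ act (tcoact δV δW) γ.fn (v ⊗ₜ w))
  let L : (U ⊗[ℂ] V) ⊗[ℂ] W →ₗ[ℂ] Y := r ∘ₗ p.rTensor W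
  let R : (U ⊗[ℂ] V) ⊗[ℂ] W →ₗ[ℂ] Y :=
    r' ∘ₗ q.lTensor U ∘ₗ (TensorProduct.assoc ℂ U V W).toLinearMap
  let T := act (tcoact (tcoact δU δV) δW) F
  constructor
  · intro H u v w
    have : L = R := TensorProduct.ext_threefold H
    rw [e1, e2]
    exact LinearMap.congr_fun this _
  · intro H u v w
    have : L ∘ₗ T = R ∘ₗ T := TensorProduct.ext_threefold fun u v w => by
      have := H u v w
      rw [e1, e2] at this
      exact this
    have h4 : ∀ t, T (act (tcoact (tcoact δU δV) δW) F' t) = t := fun t => by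
      rw [← act_mul h3, hF'F, act_one h3]
    have h5 := LinearMap.congr_fun this (act (tcoact (tcoact δU δV) δW) F' ((u ⊗ₜ v) ⊗ₜ w))
    simp only [LinearMap.comp_apply, h4] at h5
    exact h5

/-- A twisted covariant operation is covariant for the twisted product of `A`. -/
theorem coact_twisted {δU : U →ₗ[ℂ] A ⊗[ℂ] U} {δV : V →ₗ[ℂ] A ⊗[ℂ] V} {δX : X →ₗ[ℂ] A ⊗[ℂ] X}
    (hU : IsCoaction δU) (hV : IsCoaction δV) {p : U ⊗[ℂ] V →ₗ[ℂ] X}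
    (hp : ∀ t, δX (p t) = TensorProduct.map (LinearMap.mul' ℂ A) p (tcoact δU δV t))
    (t : U ⊗[ℂ] V) : δX (p (act (tcoact δU δV) γ.fn t)) =
      TensorProduct.map (hopfMul γ) (p ∘ₗ act (tcoact δU δV) γ.fn) (tcoact δU δV t) := by
  have e1 : ∀ s, TensorProduct.map (hopfMul γ) (p ∘ₗ act (tcoact δU δV) γ.fn) s =
      TensorProduct.map (hopfMul γ) p ((act (tcoact δU δV) γ.fn).lTensor (A ⊗[ℂ] A) s) := by
    intro s
    induction s with
    | zero => simp
    | add x y hx hy => simp only [map_add, hx, hy]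
    | tmul a b => rfl
  rw [e1, lTensor_act (isCoaction_tcoact hU hV), hp, coact_act (isCoaction_tcoact hU hV)]
  generalize tcoact δU δV t = s
  induction s with
  | zero => simp
  | add x y hx hy => simp only [map_add, hx, hy]
  | tmul a b => simp only [LinearMap.rTensor_tmul, TensorProduct.map_tmul, mul'_lact]

/-- An operation that is covariant for the twisted product of `A` becomes covariant for the original
product when it is twisted back by the inverse of the cocycle. -/
theorem coact_untwisted {δU : U →ₗ[ℂ] A ⊗[ℂ] U} {δV : V →ₗ[ℂ] A ⊗[ℂ] V} {δX : X →ₗ[ℂ] A ⊗[ℂ] X}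
    (hU : IsCoaction δU) (hV : IsCoaction δV) {p : U ⊗[ℂ] V →ₗ[ℂ] X}
    (hp : ∀ t, δX (p t) = TensorProduct.map (hopfMul γ) p (tcoact δU δV t))
    (t : U ⊗[ℂ] V) : δX (p (act (tcoact δU δV) γ.inv t)) =
      TensorProduct.map (LinearMap.mul' ℂ A) (p ∘ₗ act (tcoact δU δV) γ.inv)
        (tcoact δU δV t) := by
  have e1 : ∀ s, TensorProduct.map (LinearMap.mul' ℂ A) (p ∘ₗ act (tcoact δU δV) γ.inv) s =
      TensorProduct.map (LinearMap.mul' ℂ A) p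
        ((act (tcoact δU δV) γ.inv).lTensor (A ⊗[ℂ] A) s) := by
    intro s
    induction s with
    | zero => simp
    | add x y hx hy => simp only [map_add, hx, hy]
    | tmul a b => rfl
  rw [e1, lTensor_act (isCoaction_tcoact hU hV), hp, coact_act (isCoaction_tcoact hU hV)]
  generalize tcoact δU δV t = s
  induction s with
  | zero => simp
  | add x y hx hy => simp only [map_add, hx, hy]
  | tmul a b =>
    simp only [LinearMap.rTensor_tmul, TensorProduct.map_tmul, hopfMul_apply]
    rw [← lact_ract γ.inv γ.inv, ← lact_mul, γ.inv_mul_fn, lact_one]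

end TwistedOperations

/-! ### Pairings and metrics -/

section MetricLemmas

variable {A : Type u} {B : Type v} {Ω : Type w} [Ring A] [StarRing A]
  [HopfAlgebra ℂ A] [StarModule ℂ A] [Ring B] [StarRing B] [Algebra ℂ B]
  [StarModule ℂ B] [LeftComodule A B] [Ring Ω] [Algebra ℂ Ω]
  [LeftComodule A Ω] [ComoduleAlgebra A Ω] {C : CovariantStarCalculus A B Ω}

namespace CovariantStarCalculus

theorem star₁_star₁ (ω : C.OneForms) : C.star₁ (C.star₁ ω) = ω :=
  C.val_injective (C.star_star (C.val ω))

theorem coact₁_star₁ (ω : C.OneForms) :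
    C.coact₁ (C.star₁ ω) = TensorProduct.map (starL A) C.star₁ (C.coact₁ ω) := by
  apply C.lTensor_val_injective
  rw [val_coact₁, val_star₁, C.coact_star, ← C.val_coact₁]
  generalize C.coact₁ ω = t
  induction t with
  | zero => simp
  | add x y hx hy => simp only [map_add, hx, hy]
  | tmul a η => simp [val_star₁]

/-- To prove a property of all elements of `Ω¹ ⊗_B Ω¹` it suffices to consider `ω ⊗_B η`. -/
theorem TwoTensors.induction {p : C.TwoTensors → Prop} (h0 : p 0)
    (ha : ∀ s t, p s → p t → p (s + t)) (ht : ∀ ω η, p (C.tmul ω η)) (t : C.TwoTensors) : p t := by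
  obtain ⟨s, rfl⟩ := C.proj_surjective t
  induction s with
  | zero => rwa [map_zero]
  | add x y hx hy => rw [map_add]; exact ha _ _ hx hy
  | tmul ω η => exact ht ω η

theorem exists_sum_tmul (t : C.TwoTensors) :
    ∃ S : Finset (C.OneForms × C.OneForms), t = ∑ i ∈ S, C.tmul i.1 i.2 := by
  obtain ⟨s, rfl⟩ := C.proj_surjective t
  obtain ⟨S, hS⟩ := TensorProduct.exists_finset s
  exact ⟨S, by rw [hS, map_sum]; rfl⟩

variable (C) in
/-- The product `α ↦ ω ⊗_B α` as a linear map. -/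
noncomputable def tmulL (ω : C.OneForms) : C.OneForms →ₗ[ℂ] C.TwoTensors :=
  C.proj ∘ₗ TensorProduct.mk ℂ C.OneForms C.OneForms ω

theorem tmulL_apply (ω η : C.OneForms) : C.tmulL ω η = C.tmul ω η := rfl

theorem add_tmul (ω ω' η : C.OneForms) : C.tmul (ω + ω') η = C.tmul ω η + C.tmul ω' η := by
  rw [tmul, TensorProduct.add_tmul, map_add]; rfl

theorem tmul_add (ω η η' : C.OneForms) : C.tmul ω (η + η') = C.tmul ω η + C.tmul ω η' :=
  map_add (C.tmulL ω) η η'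

theorem smul_tmul (r : ℂ) (ω η : C.OneForms) : C.tmul (r • ω) η = r • C.tmul ω η := by
  rw [tmul, ← TensorProduct.smul_tmul', map_smul]; rfl

theorem tmul_smul (r : ℂ) (ω η : C.OneForms) : C.tmul ω (r • η) = r • C.tmul ω η :=
  map_smul (C.tmulL ω) r η

variable (C) in
/-- The left action of `B` on `Ω¹ ⊗_B Ω¹` as a linear map on `B ⊗ (Ω¹ ⊗_B Ω¹)`. -/
noncomputable def lmul₂T : B ⊗[ℂ] C.TwoTensors →ₗ[ℂ] C.TwoTensors :=
  TensorProduct.lift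
    { toFun := C.lmul₂
      map_add' := fun a b => LinearMap.ext fun t => by
        rw [LinearMap.add_apply]
        induction t using TwoTensors.induction with
        | h0 => simp
        | ha s t hs ht => simp only [map_add, hs, ht]; abel
        | ht α β => simp only [lmul₂_tmul, add_smul, add_tmul]
      map_smul' := fun r b => LinearMap.ext fun t => by
        rw [LinearMap.smul_apply, RingHom.id_apply]
        induction t using TwoTensors.induction with
        | h0 => simp
        | ha s t hs ht => simp only [map_add, hs, ht, smul_add]
        | ht α β => simp only [lmul₂_tmul, smul_assoc, smul_tmul] }

theorem lmul₂T_tmul (b : B) (t : C.TwoTensors) : C.lmul₂T (b ⊗ₜ t) = C.lmul₂ b t := rfl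

theorem coact₂_proj (t : C.OneForms ⊗[ℂ] C.OneForms) : C.coact₂ (C.proj t) =
    TensorProduct.map (LinearMap.mul' ℂ A) C.proj (tcoact C.coact₁ C.coact₁ t) := rfl

namespace Pairing

/-- A pairing is covariant if it is a morphism of comodules. -/
def IsCovariant (m : C.Pairing) : Prop :=
  ∀ t, coact A (m.pairing t) = m.pairing.lTensor A (C.coact₂ t)

/-- A pairing is Hermitian if `(ω, η)* = (η*, ω*)`. -/
def IsHermitian (m : C.Pairing) : Prop :=
  ∀ ω η, Star.star (m.pairing (C.tmul ω η)) = m.pairing (C.tmul (C.star₁ η) (C.star₁ ω))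

variable (m : C.Pairing)

theorem pairing_smul (b : B) (ω η : C.OneForms) :
    m.pairing (C.tmul (b • ω) η) = b * m.pairing (C.tmul ω η) := by
  rw [← lmul₂_tmul, m.pairing_lmul]

theorem pairing_rmul' (b : B) (ω η : C.OneForms) :
    m.pairing (C.tmul ω (C.rmul b η)) = m.pairing (C.tmul ω η) * b := by
  rw [← rmul₂_tmul, m.pairing_rmul]

/-- The map `ω ⊗ t ↦ ((ω, ) ⊗_B id) t`. -/
noncomputable def contractLeftT : C.OneForms ⊗[ℂ] C.TwoTensors →ₗ[ℂ] C.OneForms :=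
  TensorProduct.lift
    { toFun := m.contractLeft
      map_add' := fun ω η => LinearMap.ext fun t => by
        rw [LinearMap.add_apply]
        induction t using TwoTensors.induction with
        | h0 => simp
        | ha s t hs ht => simp only [map_add, hs, ht]; abel
        | ht α β => simp only [contractLeft_tmul, ← add_smul, ← map_add, add_tmul]
      map_smul' := fun r ω => LinearMap.ext fun t => by
        rw [LinearMap.smul_apply, RingHom.id_apply]
        induction t using TwoTensors.induction with
        | h0 => simp
        | ha s t hs ht => simp only [map_add, hs, ht, smul_add]
        | ht α β => rw [contractLeft_tmul, contractLeft_tmul, smul_tmul, map_smul, smul_assoc] }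

theorem contractLeftT_tmul (ω : C.OneForms) (t : C.TwoTensors) :
    m.contractLeftT (ω ⊗ₜ t) = m.contractLeft ω t := rfl

/-- The map `t ⊗ ω ↦ (id ⊗_B ( , ω)) t`. -/
noncomputable def contractRightT : C.TwoTensors ⊗[ℂ] C.OneForms →ₗ[ℂ] C.OneForms :=
  TensorProduct.lift <| LinearMap.flip
    { toFun := m.contractRight
      map_add' := fun ω η => LinearMap.ext fun t => by
        rw [LinearMap.add_apply]
        induction t using TwoTensors.induction with
        | h0 => simp
        | ha s t hs ht => simp only [map_add, hs, ht]; abel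
        | ht α β =>
          simp only [contractRight_tmul, tmul_add, map_add, TensorProduct.tmul_add, ← rmulT_tmul]
      map_smul' := fun r ω => LinearMap.ext fun t => by
        rw [LinearMap.smul_apply, RingHom.id_apply]
        induction t using TwoTensors.induction with
        | h0 => simp
        | ha s t hs ht => simp only [map_add, hs, ht, smul_add]
        | ht α β =>
          simp only [contractRight_tmul, tmul_smul, map_smul, TensorProduct.tmul_smul,
            ← rmulT_tmul] }

theorem contractRightT_tmul (t : C.TwoTensors) (ω : C.OneForms) :
    m.contractRightT (t ⊗ₜ ω) = m.contractRight ω t := rfl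

/-- Covariance of a pairing, as a statement on `Ω¹ ⊗ Ω¹`. -/
theorem isCovariant_iff_proj : m.IsCovariant ↔ ∀ t, coact A ((m.pairing ∘ₗ C.proj) t) =
    TensorProduct.map (LinearMap.mul' ℂ A) (m.pairing ∘ₗ C.proj) (tcoact C.coact₁ C.coact₁ t) := by
  have h : ∀ s, TensorProduct.map (LinearMap.mul' ℂ A) (m.pairing ∘ₗ C.proj) s =
      m.pairing.lTensor A (TensorProduct.map (LinearMap.mul' ℂ A) C.proj s) := by
    intro s
    induction s with
    | zero => simp
    | add x y hx hy => simp only [map_add, hx, hy]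
    | tmul a t => simp
  simp only [h, ← coact₂_proj]
  exact C.proj_surjective.forall

variable {m}

/-- Covariance of a pairing in terms of the maps `( , ω)`: applying the antipode turns
`(e, ω)₍₋₁₎ ⊗ (e, ω)₍₀₎ = e₍₋₁₎ ω₍₋₁₎ ⊗ (e₍₀₎, ω₍₀₎)` into
`S(e₍₋₁₎) (e₍₀₎, ω)₍₋₁₎ ⊗ (e₍₀₎, ω)₍₀₎ = ω₍₋₁₎ ⊗ (e, ω₍₀₎)`. -/
theorem isCovariant_iff_convAct : m.IsCovariant ↔ ∀ ω e,
    convAct C.coact₁ (HopfAlgebra.antipode ℂ) (coact A ∘ₗ m.right ω) e =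
      (m.left e).lTensor A (C.coact₁ ω) := by
  let F : C.OneForms → C.OneForms →ₗ[ℂ] A ⊗[ℂ] B := fun ω =>
    (TensorProduct.map LinearMap.id (m.pairing ∘ₗ C.proj) ∘ₗ
      (TensorProduct.leftComm ℂ C.OneForms A C.OneForms).toLinearMap) ∘ₗ
        (TensorProduct.mk ℂ _ _).flip (C.coact₁ ω)
  have hF : ∀ ω e, F ω e = (m.left e).lTensor A (C.coact₁ ω) := by
    intro ω e
    simp only [F, LinearMap.comp_apply, LinearMap.flip_apply, TensorProduct.mk_apply]
    generalize C.coact₁ ω = t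
    induction t with
    | zero => simp
    | add x y hx hy => simp only [map_add, TensorProduct.tmul_add, hx, hy]
    | tmul a η => simp [left_apply, proj_tmul]
  have hG : ∀ ω e, convAct C.coact₁ LinearMap.id (F ω) e =
      m.pairing.lTensor A (C.coact₂ (C.tmul e ω)) := by
    intro ω e
    rw [← proj_tmul, coact₂_proj, tcoact_tmul]
    simp only [convAct, LinearMap.comp_apply]
    have : ∀ η, F ω η = TensorProduct.map LinearMap.id (m.pairing ∘ₗ C.proj)
      (TensorProduct.leftComm ℂ C.OneForms A C.OneForms (η ⊗ₜ C.coact₁ ω)) := fun _ => rfl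
    generalize C.coact₁ e = s
    induction s with
    | zero => simp
    | add x y hx hy => simp only [map_add, TensorProduct.add_tmul, hx, hy]
    | tmul a η =>
      rw [LinearMap.lTensor_tmul, this]
      generalize C.coact₁ ω = t
      induction t with
      | zero => simp
      | add x y hx hy => simp only [map_add, TensorProduct.tmul_add, hx, hy]
      | tmul b ν => simp
  constructor
  · intro h ω e
    have : coact A ∘ₗ m.right ω = convAct C.coact₁ LinearMap.id (F ω) :=
      LinearMap.ext fun e => by rw [hG, ← h]; rfl
    rw [this, convAct_antipode_convAct_id C.isCoaction_coact₁, hF]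
  · intro h t
    have h' : ∀ ω, convAct C.coact₁ (HopfAlgebra.antipode ℂ) (coact A ∘ₗ m.right ω) = F ω :=
      fun ω => LinearMap.ext fun e => by rw [h, hF]
    induction t using TwoTensors.induction with
    | h0 => simp
    | ha s t hs ht => simp only [map_add, hs, ht]
    | ht e ω =>
      rw [← hG, ← h', convAct_id_convAct_antipode C.isCoaction_coact₁]
      rfl

theorem coact₁_contractLeft (h : m.IsCovariant) (ω : C.OneForms) (t : C.TwoTensors) :
    C.coact₁ (m.contractLeft ω t) = TensorProduct.map (LinearMap.mul' ℂ A) m.contractLeftT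
      (tcoact C.coact₁ C.coact₂ (ω ⊗ₜ t)) := by
  rw [isCovariant_iff_proj] at h
  induction t using TwoTensors.induction with
  | h0 => simp
  | ha s t hs ht => simp only [map_add, TensorProduct.tmul_add, hs, ht]
  | ht α β =>
    have h' := h (ω ⊗ₜ α)
    rw [contractLeft_tmul, ← lmulT_tmul, coact₁_lmulT, tcoact_tmul, tcoact_tmul, ← proj_tmul,
      ← proj_tmul]
    rw [LinearMap.comp_apply] at h'
    rw [h', coact₂_proj, tcoact_tmul, tcoact_tmul]
    generalize C.coact₁ ω = r, C.coact₁ α = s, C.coact₁ β = t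
    induction r with
    | zero => simp
    | add x y hx hy => simp only [map_add, TensorProduct.add_tmul, hx, hy]
    | tmul a ω =>
      induction s with
      | zero => simp
      | add x y hx hy => simp only [map_add, TensorProduct.tmul_add, TensorProduct.add_tmul, hx, hy]
      | tmul b α =>
        induction t with
        | zero => simp
        | add x y hx hy => simp only [map_add, TensorProduct.tmul_add, hx, hy]
        | tmul c β =>
          simp only [TensorProduct.tensorTensorTensorComm_tmul, TensorProduct.map_tmul,
            LinearMap.mul'_apply, LinearMap.comp_apply, lmulT_tmul, contractLeftT_tmul, mul_assoc,
            proj_tmul, contractLeft_tmul]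

theorem star_contractRight (h : m.IsHermitian) (ω : C.OneForms) (t : C.TwoTensors) :
    C.star₁ (m.contractRight ω t) = m.contractLeft (C.star₁ ω) (C.dagger t) := by
  induction t using TwoTensors.induction with
  | h0 => simp
  | ha s t hs ht => simp only [map_add, hs, ht]
  | ht α β => rw [contractRight_tmul, star₁_rmul, h, dagger_tmul, contractLeft_tmul]

end Pairing

namespace Metric

variable {m : C.Metric}

/-- If `g = ∑ αᵢ ⊗_B βᵢ` then `t = ∑ αᵢ ⊗_B ((βᵢ, ) ⊗_B id) t`. -/
theorem sum_tmulL_contractLeft {S : Finset (C.OneForms × C.OneForms)}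
    (hS : m.g = ∑ i ∈ S, C.tmul i.1 i.2) (t : C.TwoTensors) :
    ∑ i ∈ S, C.tmulL i.1 (m.contractLeft i.2 t) = t := by
  induction t using TwoTensors.induction with
  | h0 => simp
  | ha s t hs ht => simp only [map_add, Finset.sum_add_distrib, hs, ht]
  | ht ω η =>
    have h := m.contractRight_g ω
    rw [hS, map_sum] at h
    simp only [m.contractRight_tmul, m.contractLeft_tmul, tmulL_apply, ← tmul_balanced] at h ⊢
    conv_rhs => rw [← h]
    simp only [tmul, TensorProduct.sum_tmul, map_sum]

/-- An element of `D ⊗ (Ω¹ ⊗_B Ω¹)` is determined by its contractions. -/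
theorem lTensor_contractLeft_ext {D : Type*} [AddCommGroup D] [Module ℂ D]
    {s t : D ⊗[ℂ] C.TwoTensors}
    (h : ∀ ω, (m.contractLeft ω).lTensor D s = (m.contractLeft ω).lTensor D t) : s = t := by
  obtain ⟨S, hS⟩ := exists_sum_tmul m.g
  have key : ∀ u : D ⊗[ℂ] C.TwoTensors,
      ∑ i ∈ S, (C.tmulL i.1).lTensor D ((m.contractLeft i.2).lTensor D u) = u := by
    intro u
    induction u with
    | zero => simp
    | add x y hx hy => simp only [map_add, Finset.sum_add_distrib, hx, hy]
    | tmul d u =>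
      simp only [LinearMap.lTensor_tmul, ← TensorProduct.tmul_sum, sum_tmulL_contractLeft hS]
  rw [← key s, ← key t]
  exact Finset.sum_congr rfl fun i _ => by rw [h]

theorem contractLeft_ext {s t : C.TwoTensors}
    (h : ∀ ω, m.contractLeft ω s = m.contractLeft ω t) : s = t := by
  obtain ⟨S, hS⟩ := exists_sum_tmul m.g
  rw [← sum_tmulL_contractLeft hS s, ← sum_tmulL_contractLeft hS t]
  exact Finset.sum_congr rfl fun i _ => by rw [h]

/-- A metric is determined by its pairing. -/
theorem ext_pairing {m m' : C.Metric} (h : m.pairing = m'.pairing) : m = m' := by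
  obtain ⟨p, g, hl, hr⟩ := m
  obtain ⟨p', g', hl', hr'⟩ := m'
  obtain rfl : p = p' := by
    obtain ⟨_, _, _⟩ := p
    obtain ⟨_, _, _⟩ := p'
    congr
  obtain rfl : g = g' :=
    contractLeft_ext (m := ⟨p, g, hl, hr⟩) fun ω => (hl ω).trans (hl' ω).symm
  rfl

/-- If the pairing is covariant then `g` is coinvariant: `g₍₋₁₎ ⊗ g₍₀₎` and `1 ⊗ g` have the same
contractions, because `ω₍₋₁₎ g₍₋₁₎ ⊗ ((ω₍₀₎, ) ⊗_B id) g₍₀₎ = ω₍₋₁₎ ⊗ ω₍₀₎`. -/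
theorem coact₂_g (h : m.toPairing.IsCovariant) : C.coact₂ m.g = 1 ⊗ₜ m.g := by
  refine lTensor_contractLeft_ext (m := m) fun ω => ?_
  rw [LinearMap.lTensor_tmul, m.contractLeft_g]
  -- `F t ω` is the contraction of the second factor of `t` with `ω`
  let F : A ⊗[ℂ] C.TwoTensors → C.OneForms →ₗ[ℂ] A ⊗[ℂ] C.OneForms := fun t =>
    TensorProduct.map LinearMap.id m.contractLeftT ∘ₗ
      (TensorProduct.leftComm ℂ C.OneForms A C.TwoTensors).toLinearMap ∘ₗ
        (TensorProduct.mk ℂ _ _).flip t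
  have hF : ∀ t ω, F t ω = (m.contractLeft ω).lTensor A t := by
    intro t ω
    simp only [F, LinearMap.comp_apply, LinearMap.flip_apply, TensorProduct.mk_apply]
    induction t with
    | zero => simp
    | add x y hx hy => simp only [map_add, TensorProduct.tmul_add, hx, hy]
    | tmul a η => simp [m.contractLeftT_tmul]
  have hG : ∀ t, ∀ s : A ⊗[ℂ] C.OneForms,
      (LinearMap.mul' ℂ A ∘ₗ LinearMap.id.rTensor A).rTensor C.OneForms
        ((TensorProduct.assoc ℂ A A C.OneForms).symm ((F t).lTensor A s)) =
      TensorProduct.map (LinearMap.mul' ℂ A) m.contractLeftT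
        (TensorProduct.tensorTensorTensorComm ℂ A C.OneForms A C.TwoTensors (s ⊗ₜ t)) := by
    intro t s
    induction s with
    | zero => simp
    | add x y hx hy => simp only [map_add, TensorProduct.add_tmul, hx, hy]
    | tmul a ω =>
      rw [LinearMap.lTensor_tmul, hF]
      induction t with
      | zero => simp
      | add x y hx hy => simp only [map_add, TensorProduct.tmul_add, hx, hy]
      | tmul b t => simp [m.contractLeftT_tmul]
  -- `F t` is recovered from `ω ↦ ω₍₋₁₎ (F t)(ω₍₀₎)`, which is the coaction for both tensors `t`
  have h1 : ∀ t, (∀ ω, TensorProduct.map (LinearMap.mul' ℂ A) m.contractLeftT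
      (TensorProduct.tensorTensorTensorComm ℂ A C.OneForms A C.TwoTensors (C.coact₁ ω ⊗ₜ t)) =
        C.coact₁ ω) → F t = convAct C.coact₁ (HopfAlgebra.antipode ℂ) C.coact₁ := by
    intro t ht
    rw [← convAct_antipode_convAct_id C.isCoaction_coact₁ (F t)]
    congr 1
    exact LinearMap.ext fun ω => (hG t (C.coact₁ ω)).trans (ht ω)
  have h2 := h1 (C.coact₂ m.g) fun ω => by
    rw [← tcoact_tmul, ← m.coact₁_contractLeft h, m.contractLeft_g]
  have h3 := h1 (1 ⊗ₜ m.g) fun ω => by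
    generalize C.coact₁ ω = s
    induction s with
    | zero => simp
    | add x y hx hy => simp only [map_add, TensorProduct.add_tmul, hx, hy]
    | tmul a ω => simp [m.contractLeftT_tmul, m.contractLeft_g]
  have h4 := LinearMap.congr_fun (h2.trans h3.symm) ω
  rw [hF, hF, LinearMap.lTensor_tmul, m.contractLeft_g] at h4
  exact h4

/-- A metric is covariant as soon as its pairing is. -/
theorem isCovariant_of_pairing (h : m.toPairing.IsCovariant) : m.IsCovariant := by
  refine ⟨h, fun b => ?_⟩
  have key : ∀ t : C.TwoTensors, C.coact₂ (C.lmul₂ b t) =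
      TensorProduct.map (LinearMap.mul' ℂ A) C.lmul₂T
        (TensorProduct.tensorTensorTensorComm ℂ A B A C.TwoTensors (coact A b ⊗ₜ C.coact₂ t)) := by
    intro t
    induction t using TwoTensors.induction with
    | h0 => simp
    | ha s t hs ht => simp only [map_add, TensorProduct.tmul_add, hs, ht]
    | ht α β =>
      rw [lmul₂_tmul, ← proj_tmul, ← proj_tmul, coact₂_proj, coact₂_proj, tcoact_tmul, tcoact_tmul,
        ← lmulT_tmul, coact₁_lmulT, tcoact_tmul]
      generalize coact A b = r, C.coact₁ α = s, C.coact₁ β = t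
      induction r with
      | zero => simp
      | add x y hx hy => simp only [map_add, TensorProduct.add_tmul, hx, hy]
      | tmul a b =>
        induction s with
        | zero => simp
        | add x y hx hy =>
          simp only [map_add, TensorProduct.tmul_add, TensorProduct.add_tmul, hx, hy]
        | tmul a' α =>
          induction t with
          | zero => simp
          | add x y hx hy => simp only [map_add, TensorProduct.tmul_add, hx, hy]
          | tmul c β =>
            simp only [TensorProduct.tensorTensorTensorComm_tmul, TensorProduct.map_tmul,
              LinearMap.mul'_apply, lmulT_tmul, mul_assoc, lmul₂T_tmul, proj_tmul, lmul₂_tmul]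
  rw [coev_apply, key, coact₂_g h]
  generalize coact A b = s
  induction s with
  | zero => simp
  | add x y hx hy => simp only [map_add, TensorProduct.add_tmul, hx, hy]
  | tmul a b => simp [coev_apply, lmul₂T_tmul]

/-- A metric is real if and only if its pairing is Hermitian. -/
theorem isReal_iff : m.IsReal ↔ m.toPairing.IsHermitian := by
  constructor
  · intro h ω η
    obtain ⟨S, hS⟩ := exists_sum_tmul m.g
    have h1 := m.contractLeft_g (C.star₁ η)
    have h2 := m.contractLeft_g ω
    rw [hS, map_sum] at h1
    rw [← h, hS, map_sum, map_sum] at h2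
    simp only [m.contractLeft_tmul, dagger_tmul] at h1 h2
    have h3 := congrArg C.star₁ h1
    have h4 := congrArg C.star₁ h2
    simp only [map_sum, star₁_smul, star₁_star₁] at h3 h4
    conv_lhs => rw [← h3]
    conv_rhs => rw [← h4]
    simp only [← tmulL_apply, map_sum, star_sum]
    simp only [tmulL_apply, m.pairing_rmul', StarMul.star_mul, _root_.star_star]
  · intro h
    refine contractLeft_ext (m := m) fun ω => ?_
    rw [m.contractLeft_g, ← star₁_star₁ ω, ← m.star_contractRight h, m.contractRight_g]

end Metric

end CovariantStarCalculus

end MetricLemmas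

/-! ### Real metrics and Hermitian metrics -/

section HermitianMetrics

variable {A : Type u} {B : Type v} {Ω : Type w} [Ring A] [StarRing A]
  [HopfAlgebra ℂ A] [StarModule ℂ A] [Ring B] [StarRing B] [Algebra ℂ B]
  [StarModule ℂ B] [LeftComodule A B] [Ring Ω] [Algebra ℂ Ω]
  [LeftComodule A Ω] [ComoduleAlgebra A Ω] {C : CovariantStarCalculus A B Ω}

namespace CovariantStarCalculus

namespace Pairing

variable (m : C.Pairing)

/-- The conjugate-linear map `ω ↦ ( , ω*)` from `Ω¹` to its left dual. -/
noncomputable def hermitian : C.OneForms →ₗ⋆[ℂ] C.OneForms →ₗ[B] B where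
  toFun ω :=
    { toFun := fun η => m.pairing (C.tmul η (C.star₁ ω))
      map_add' := fun η η' => by rw [add_tmul, map_add]
      map_smul' := fun b η => m.pairing_smul b η (C.star₁ ω) }
  map_add' ω ω' := LinearMap.ext fun η => by
    simp only [LinearMap.coe_mk, AddHom.coe_mk, LinearMap.add_apply, map_add, tmul_add]
  map_smul' r ω := LinearMap.ext fun η => by
    simp only [LinearMap.coe_mk, AddHom.coe_mk, LinearMap.smul_apply, LinearMap.map_smulₛₗ,
      tmul_smul, map_smul]

theorem hermitian_apply (ω η : C.OneForms) :
    m.hermitian ω η = m.pairing (C.tmul η (C.star₁ ω)) := rfl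

/-- Covariance of a pairing is colinearity of the map `ω ↦ ( , ω*)`. -/
theorem isCovariant_iff_hermitian : m.IsCovariant ↔ ∀ y e, dualCoact (m.hermitian y) e =
    TensorProduct.map (starL A) ((evalAt e).comp m.hermitian) (C.coact₁ y) := by
  have key : ∀ y e, TensorProduct.map (starL A) ((evalAt e).comp m.hermitian) (C.coact₁ y) =
      (m.left e).lTensor A (C.coact₁ (C.star₁ y)) := by
    intro y e
    rw [coact₁_star₁]
    generalize C.coact₁ y = t
    induction t with
    | zero => simp
    | add x y hx hy => simp only [map_add, hx, hy]
    | tmul a ω => rfl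
  simp only [key, isCovariant_iff_convAct]
  refine ⟨fun h y e => h (C.star₁ y) e, fun h ω e => ?_⟩
  have := h (C.star₁ ω) e
  rw [star₁_star₁] at this
  rw [← this]
  have h2 : (m.hermitian (C.star₁ ω)).restrictScalars ℂ = m.right ω :=
    LinearMap.ext fun e => by
      rw [LinearMap.restrictScalars_apply, hermitian_apply, star₁_star₁]; rfl
  rw [← h2]
  rfl

end Pairing

namespace Metric

variable (m : C.Metric)

/-- If `g = ∑ αᵢ ⊗_B βᵢ` then `ω = ∑ (ω, αᵢ) βᵢ`. -/
theorem sum_pairing_smul {S : Finset (C.OneForms × C.OneForms)}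
    (hS : m.g = ∑ i ∈ S, C.tmul i.1 i.2) (ω : C.OneForms) :
    ∑ i ∈ S, m.pairing (C.tmul ω i.1) • i.2 = ω := by
  have h := m.contractLeft_g ω
  rwa [hS, map_sum] at h

/-- If `g = ∑ αᵢ ⊗_B βᵢ` then `ω = ∑ αᵢ (βᵢ, ω)`. -/
theorem sum_rmul_pairing {S : Finset (C.OneForms × C.OneForms)}
    (hS : m.g = ∑ i ∈ S, C.tmul i.1 i.2) (ω : C.OneForms) :
    ∑ i ∈ S, C.rmul (m.pairing (C.tmul i.2 ω)) i.1 = ω := by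
  have h := m.contractRight_g ω
  rwa [hS, map_sum] at h

theorem finite (m : C.Metric) : Module.Finite B C.OneForms := by
  classical
  obtain ⟨S, hS⟩ := exists_sum_tmul m.g
  refine ⟨⟨S.image Prod.snd, eq_top_iff.2 fun ω _ => ?_⟩⟩
  rw [← m.sum_pairing_smul hS ω]
  exact Submodule.sum_mem _ fun i hi =>
    Submodule.smul_mem _ _ (Submodule.subset_span (by simpa using ⟨i.1, hi⟩))

/-- If `g = ∑ αᵢ ⊗_B βᵢ` then `βᵢ` and `( , αᵢ)` are dual bases of the left module `Ω¹`. -/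
theorem projective (m : C.Metric) : Module.Projective B C.OneForms := by
  classical
  obtain ⟨S, hS⟩ := exists_sum_tmul m.g
  refine ⟨⟨∑ i ∈ S, (m.hermitian (C.star₁ i.1)).smulRight (Finsupp.single i.2 1), fun ω => ?_⟩⟩
  conv_rhs => rw [← m.sum_pairing_smul hS ω]
  simp [m.hermitian_apply, star₁_star₁]

theorem hermitian_bijective : Function.Bijective m.hermitian := by
  obtain ⟨S, hS⟩ := exists_sum_tmul m.g
  constructor
  · intro ω η h
    have h1 : C.star₁ ω = C.star₁ η := by
      rw [← m.sum_rmul_pairing hS (C.star₁ ω), ← m.sum_rmul_pairing hS (C.star₁ η)]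
      refine Finset.sum_congr rfl fun i _ => ?_
      rw [← m.hermitian_apply, ← m.hermitian_apply, h]
    rw [← star₁_star₁ ω, h1, star₁_star₁]
  · intro f
    -- `f = ( , ∑ αᵢ f(βᵢ))`, since `f(η) = ∑ (η, αᵢ) f(βᵢ)`
    refine ⟨C.star₁ (∑ i ∈ S, C.rmul (f i.2) i.1), LinearMap.ext fun η => ?_⟩
    conv_rhs => rw [← m.sum_pairing_smul hS η]
    rw [m.hermitian_apply, star₁_star₁, map_sum, ← tmulL_apply, map_sum, map_sum]
    refine Finset.sum_congr rfl fun i _ => ?_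
    rw [tmulL_apply, m.pairing_rmul', map_smul, smul_eq_mul]

end Metric

/-- The covariant Hermitian metric `H(ω̄)(η) = (η, ω*)` of a covariant real metric. -/
noncomputable def CovariantRealMetric.toHermitian (m : C.CovariantRealMetric) :
    C.CovariantHermitianMetric where
  finite := m.1.finite
  projective := m.1.projective
  H := m.1.hermitian
  bijective := m.1.hermitian_bijective
  map_lmul b y e := by
    rw [m.1.hermitian_apply, star₁_rmul, _root_.star_star, ← tmul_balanced, m.1.hermitian_apply]
  map_rmul b y e := by
    rw [m.1.hermitian_apply, star₁_smul, _root_.star_star, m.1.pairing_rmul', m.1.hermitian_apply]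
  covariant := m.1.isCovariant_iff_hermitian.1 m.2.1.1
  hermitian x y := by
    rw [m.1.hermitian_apply, m.1.hermitian_apply, Metric.isReal_iff.1 m.2.2, star₁_star₁]

namespace CovariantHermitianMetric

theorem ext_H {h h' : C.CovariantHermitianMetric} (e : h.H = h'.H) : h = h' := by
  cases h; cases h'; congr

variable (h : C.CovariantHermitianMetric)

/-- The map `ω ⊗ η ↦ H(η̄*)(ω)` on `Ω¹ ⊗ Ω¹`. -/
noncomputable def prePairing : C.OneForms ⊗[ℂ] C.OneForms →ₗ[ℂ] B :=
  TensorProduct.lift (LinearMap.mk₂ ℂ (fun ω η => h.H (C.star₁ η) ω)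
    (fun ω ω' η => map_add _ _ _)
    (fun r ω η => (h.H (C.star₁ η)).map_smul_of_tower r ω)
    (fun ω η η' => by rw [map_add, map_add]; rfl)
    (fun r ω η => by
      rw [LinearMap.map_smulₛₗ, LinearMap.map_smulₛₗ, LinearMap.smul_apply, Complex.conj_conj]))

/-- The pairing `(ω, η) = H(η̄*)(ω)` of a covariant Hermitian metric. -/
noncomputable def toPairing : C.Pairing where
  pairing := lift h.prePairing fun ω b η => by
    change h.H (C.star₁ η) (C.rmul b ω) = h.H (C.star₁ (b • η)) ω
    rw [star₁_smul, h.map_lmul]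
  pairing_lmul b t := by
    induction t using TwoTensors.induction with
    | h0 => simp
    | ha s t hs ht => simp only [map_add, hs, ht, mul_add]
    | ht ω η => exact map_smul (h.H (C.star₁ η)) b ω
  pairing_rmul b t := by
    induction t using TwoTensors.induction with
    | h0 => simp
    | ha s t hs ht => simp only [map_add, hs, ht, add_mul]
    | ht ω η =>
      change h.H (C.star₁ (C.rmul b η)) ω = h.H (C.star₁ η) ω * b
      rw [star₁_rmul, h.map_rmul]

theorem toPairing_tmul (ω η : C.OneForms) :
    h.toPairing.pairing (C.tmul ω η) = h.H (C.star₁ η) ω := rfl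

theorem hermitian_toPairing : h.toPairing.hermitian = h.H :=
  LinearMap.ext fun ω => LinearMap.ext fun η => by
    rw [Pairing.hermitian_apply, toPairing_tmul, star₁_star₁]

/-- Every functional on `Ω¹` is of the form `( , α)`, so dual bases of `Ω¹` give elements
`αᵢ`, `βᵢ` with `ω = ∑ (ω, αᵢ) βᵢ` for all `ω`. -/
theorem exists_dual : ∃ (n : ℕ) (α β : Fin n → C.OneForms),
    ∀ ω, ∑ i, h.toPairing.pairing (C.tmul ω (α i)) • β i = ω := by
  have := h.finite
  have := h.projective
  obtain ⟨n, f, s, -, -, hfs⟩ := Module.Finite.exists_comp_eq_id_of_projective B C.OneForms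
  choose y hy using fun i => h.bijective.2 (LinearMap.proj i ∘ₗ s)
  refine ⟨n, fun i => C.star₁ (y i), fun i => f (Pi.single i 1), fun ω => ?_⟩
  have h1 : ∀ i, h.toPairing.pairing (C.tmul ω (C.star₁ (y i))) = s ω i := fun i => by
    rw [toPairing_tmul, star₁_star₁, hy]; rfl
  simp only [h1, ← map_smul, ← map_sum]
  refine Eq.trans ?_ (LinearMap.congr_fun hfs ω)
  rw [LinearMap.comp_apply]
  congr 1
  ext j
  simp [Finset.sum_apply, Pi.single_apply]

theorem exists_metric : ∃ m : C.Metric, m.toPairing = h.toPairing := by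
  obtain ⟨n, α, β, hαβ⟩ := h.exists_dual
  refine ⟨⟨h.toPairing, ∑ i, C.tmul (α i) (β i), fun ω => ?_, fun ω => ?_⟩, rfl⟩
  · rw [map_sum]
    exact hαβ ω
  · -- both sides have the same pairing with every `η`
    have h1 : h.H (C.star₁ (h.toPairing.contractRight ω (∑ i, C.tmul (α i) (β i)))) =
        h.H (C.star₁ ω) := by
      refine LinearMap.ext fun η => ?_
      rw [← toPairing_tmul, ← toPairing_tmul, map_sum, ← tmulL_apply, map_sum, map_sum]
      simp only [Pairing.contractRight_tmul, tmulL_apply, h.toPairing.pairing_rmul',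
        ← h.toPairing.pairing_smul]
      conv_rhs => rw [← hαβ η]
      simp only [tmul, TensorProduct.sum_tmul, map_sum]
    have h2 := congrArg C.star₁ (h.bijective.1 h1)
    rwa [star₁_star₁, star₁_star₁] at h2

end CovariantHermitianMetric

theorem CovariantRealMetric.toHermitian_bijective [ComoduleAlgebra A B] :
    Function.Bijective (CovariantRealMetric.toHermitian (C := C)) := by
  constructor
  · intro m m' e
    apply Subtype.ext
    apply Metric.ext_pairing
    have e' : m.1.hermitian = m'.1.hermitian := congrArg CovariantHermitianMetric.H e
    apply LinearMap.ext
    intro t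
    induction t using TwoTensors.induction with
    | h0 => simp
    | ha s t hs ht => simp only [map_add, hs, ht]
    | ht ω η =>
      rw [← star₁_star₁ η, ← m.1.hermitian_apply, ← m'.1.hermitian_apply, e']
  · intro h
    obtain ⟨m, hm⟩ := h.exists_metric
    have hH : m.toPairing.hermitian = h.H := by rw [hm, h.hermitian_toPairing]
    have hc : m.toPairing.IsCovariant :=
      m.toPairing.isCovariant_iff_hermitian.2 (by rw [hH]; exact h.covariant)
    refine ⟨⟨m, Metric.isCovariant_of_pairing hc, Metric.isReal_iff.2 fun ω η => ?_⟩,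
      CovariantHermitianMetric.ext_H hH⟩
    rw [hm, h.toPairing_tmul, h.hermitian, h.toPairing_tmul, star₁_star₁]

variable (C) in
/-- The bijection between covariant real metrics and covariant Hermitian metrics. -/
noncomputable def realEquivHermitian [ComoduleAlgebra A B] :
    C.CovariantRealMetric ≃ C.CovariantHermitianMetric :=
  Equiv.ofBijective _ CovariantRealMetric.toHermitian_bijective

end CovariantStarCalculus

end HermitianMetrics

/-! ### Twisting of metrics -/

section TwistMetrics

variable {A : Type u} {B : Type v} {Ω : Type w} [Ring A] [StarRing A]
  [HopfAlgebra ℂ A] [StarModule ℂ A] [HopfStarAlgebra A] [Ring B] [StarRing B] [Algebra ℂ B]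
  [StarModule ℂ B] [LeftComodule A B] [ComoduleStarAlgebra A B] [Ring Ω] [Algebra ℂ Ω]
  [LeftComodule A Ω] [ComoduleAlgebra A Ω] {C : CovariantStarCalculus A B Ω}
  {γ : UnitaryTwoCocycle A}

theorem Twist.of₂_injective : Function.Injective (Twist.of₂ γ (B := B)) :=
  (TensorProduct.congr (TwistHopf.of γ) (Twist.of γ (B := B))).injective

namespace CovariantStarCalculus

theorem coact₁_of₁ (ω : C.OneForms) : (C.twist γ).coact₁ (C.of₁ γ ω) =
    TensorProduct.map (TwistHopf.of γ).toLinearMap (C.of₁ γ).toLinearMap (C.coact₁ ω) := by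
  apply (C.twist γ).lTensor_val_injective
  rw [val_coact₁, val_of₁, Twist.coact_of, ← C.val_coact₁]
  generalize C.coact₁ ω = t
  induction t with
  | zero => simp
  | add x y hx hy => simp only [map_add, hx, hy]
  | tmul a η => rfl

theorem star₁_of₁ (ω : C.OneForms) : (C.twist γ).star₁ (C.of₁ γ ω) =
    C.of₁ γ (act C.coact₁ γ.Vinv (C.star₁ ω)) := by
  apply (C.twist γ).val_injective
  rw [val_star₁, val_of₁, val_of₁]
  have h : act (coact A) γ.Vinv (C.val (C.star₁ ω)) = C.val (act C.coact₁ γ.Vinv (C.star₁ ω)) :=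
    act_map LinearMap.id C.val C.coact_val γ.Vinv (C.star₁ ω)
  exact congrArg (fun x : Ω => Twist.of γ x) h

theorem tcoact_of₁ (t : C.OneForms ⊗[ℂ] C.OneForms) :
    tcoact (C.twist γ).coact₁ (C.twist γ).coact₁
      (TensorProduct.map (C.of₁ γ).toLinearMap (C.of₁ γ).toLinearMap t) =
    TensorProduct.map (TwistHopf.of₂ γ)
      (TensorProduct.map (C.of₁ γ).toLinearMap (C.of₁ γ).toLinearMap)
      (tcoact C.coact₁ C.coact₁ t) :=
  tcoact_map (δ := C.coact₁) (δ' := C.coact₁) (η := (C.twist γ).coact₁)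
    (η' := (C.twist γ).coact₁) (TwistHopf.of γ).toLinearMap (TwistHopf.of γ).toLinearMap
    (C.of₁ γ).toLinearMap (C.of₁ γ).toLinearMap coact₁_of₁ coact₁_of₁ t

variable (γ) in
/-- The projection `Ω¹ ⊗ Ω¹ → Ω¹_γ ⊗_{B_γ} Ω¹_γ`. -/
noncomputable def projTwist : C.OneForms ⊗[ℂ] C.OneForms →ₗ[ℂ] (C.twist γ).TwoTensors :=
  (C.twist γ).proj ∘ₗ TensorProduct.map (C.of₁ γ).toLinearMap (C.of₁ γ).toLinearMap

theorem projTwist_tmul (ω η : C.OneForms) :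
    projTwist γ (ω ⊗ₜ η) = (C.twist γ).tmul (C.of₁ γ ω) (C.of₁ γ η) := rfl

theorem projTwist_surjective : Function.Surjective (projTwist (C := C) γ) :=
  (C.twist γ).proj_surjective.comp (TensorProduct.congr (C.of₁ γ) (C.of₁ γ)).surjective

theorem phi_projTwist (t : C.OneForms ⊗[ℂ] C.OneForms) :
    C.phi γ (projTwist γ t) = C.proj (act (tcoact C.coact₁ C.coact₁) γ.fn t) := by
  induction t with
  | zero => simp
  | add x y hx hy => simp only [map_add, hx, hy]
  | tmul ω η => exact C.phi_tmul γ ω η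

theorem phi_surjective : Function.Surjective (C.phi γ) := fun t => by
  obtain ⟨s, rfl⟩ := C.proj_surjective t
  exact ⟨projTwist γ (act (tcoact C.coact₁ C.coact₁) γ.inv s), by
    rw [phi_projTwist, act_fn_act_inv _ C.isCoaction_coact₁ C.isCoaction_coact₁]⟩

/-- The map `φ` is a morphism of comodules over the coalgebra `A`. -/
theorem coact₂_phi (t : (C.twist γ).TwoTensors) :
    (TwistHopf.of γ).toLinearMap.rTensor C.TwoTensors (C.coact₂ (C.phi γ t)) =
      (C.phi γ).lTensor (TwistHopf γ) ((C.twist γ).coact₂ t) := by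
  obtain ⟨s, rfl⟩ := projTwist_surjective t
  rw [phi_projTwist, coact_twisted γ.toTwoCocycle C.isCoaction_coact₁ C.isCoaction_coact₁
    coact₂_proj, projTwist, LinearMap.comp_apply, coact₂_proj, tcoact_of₁]
  generalize tcoact C.coact₁ C.coact₁ s = u
  induction u with
  | zero => simp
  | add x y hx hy => simp only [map_add, hx, hy]
  | tmul a t =>
    simp only [TensorProduct.map_tmul, LinearMap.rTensor_tmul, LinearMap.lTensor_tmul,
      TwistHopf.mul_of₂, LinearMap.comp_apply, ← phi_projTwist]
    rfl

theorem coact₂_phi_coinvariant {t : (C.twist γ).TwoTensors} (h : (C.twist γ).coact₂ t = 1 ⊗ₜ t) :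
    C.coact₂ (C.phi γ t) = 1 ⊗ₜ C.phi γ t := by
  have hinj : Function.Injective ((TwistHopf.of γ).toLinearMap.rTensor C.TwoTensors) :=
    ((TwistHopf.of γ).rTensor C.TwoTensors).injective
  apply hinj
  rw [coact₂_phi, h, LinearMap.lTensor_tmul, LinearMap.rTensor_tmul]
  rfl

namespace Pairing

/-- The pairings `( , )` on `Ω¹` and `( , )_γ` on `Ω¹_γ` are related by `( , )_γ = ( , ) ∘ φ`. -/
def IsTwistOf (p' : (C.twist γ).Pairing) (p : C.Pairing) : Prop :=
  ∀ t, p'.pairing t = Twist.of γ (p.pairing (C.phi γ t))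

variable {p : C.Pairing} {p' : (C.twist γ).Pairing}

theorem IsTwistOf.apply_tmul (h : p'.IsTwistOf p) (ω η : C.OneForms) :
    p'.pairing ((C.twist γ).tmul (C.of₁ γ ω) (C.of₁ γ η)) =
      Twist.of γ ((p.pairing ∘ₗ C.proj) (act (tcoact C.coact₁ C.coact₁) γ.fn (ω ⊗ₜ η))) := by
  rw [h, C.phi_tmul]; rfl

theorem IsTwistOf.isCovariant (h : p'.IsTwistOf p) (hc : p.IsCovariant) : p'.IsCovariant := by
  intro t
  have key : ∀ s : A ⊗[ℂ] C.TwoTensors, Twist.of₂ γ (p.pairing.lTensor A s) =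
      ((Twist.of γ).toLinearMap ∘ₗ p.pairing).lTensor (TwistHopf γ)
        ((TwistHopf.of γ).toLinearMap.rTensor C.TwoTensors s) := by
    intro s
    induction s with
    | zero => simp
    | add x y hx hy => simp only [map_add, hx, hy]
    | tmul a t => rfl
  have hp : p'.pairing = ((Twist.of γ).toLinearMap ∘ₗ p.pairing) ∘ₗ C.phi γ := LinearMap.ext h
  rw [h, Twist.coact_of, hc, key, coact₂_phi, hp, ← LinearMap.lTensor_comp_apply]

/-- A covariant pairing on `Ω¹` induces a pairing on `Ω¹_γ`. -/
theorem exists_isTwistOf (hc : p.IsCovariant) : ∃ p' : (C.twist γ).Pairing, p'.IsTwistOf p := by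
  have hc' := p.isCovariant_iff_proj.1 hc
  refine ⟨⟨(Twist.of γ).toLinearMap ∘ₗ p.pairing ∘ₗ C.phi γ, fun b t => ?_, fun b t => ?_⟩,
    fun t => rfl⟩
  · obtain ⟨b, rfl⟩ := (Twist.of γ).surjective b
    induction t using TwoTensors.induction with
    | h0 => simp
    | ha s t hs ht => simp only [map_add, hs, ht, mul_add]
    | ht ω η =>
      obtain ⟨ω, rfl⟩ := (C.of₁ γ).surjective ω
      obtain ⟨η, rfl⟩ := (C.of₁ γ).surjective η
      rw [lmul₂_tmul, of₁_lmul]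
      simp only [LinearMap.comp_apply, LinearEquiv.coe_coe, phi_tmul, Twist.of_mul]
      exact congrArg (Twist.of γ) ((twist_assoc_iff γ.toTwoCocycle (isCoaction_coact A B)
        C.isCoaction_coact₁ C.isCoaction_coact₁ C.coact₁_lmulT hc' (p.pairing ∘ₗ C.proj)
        (LinearMap.mul' ℂ B)).1 (fun b ω η => p.pairing_smul b ω η) b ω η)
  · obtain ⟨b, rfl⟩ := (Twist.of γ).surjective b
    induction t using TwoTensors.induction with
    | h0 => simp
    | ha s t hs ht => simp only [map_add, hs, ht, add_mul]
    | ht ω η =>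
      obtain ⟨ω, rfl⟩ := (C.of₁ γ).surjective ω
      obtain ⟨η, rfl⟩ := (C.of₁ γ).surjective η
      rw [rmul₂_tmul, of₁_rmul]
      simp only [LinearMap.comp_apply, LinearEquiv.coe_coe, phi_tmul, Twist.of_mul]
      exact congrArg (Twist.of γ) ((twist_assoc_iff γ.toTwoCocycle C.isCoaction_coact₁
        C.isCoaction_coact₁ (isCoaction_coact A B) hc' C.coact₁_rmulT (LinearMap.mul' ℂ B)
        (p.pairing ∘ₗ C.proj)).1 (fun ω η b => (p.pairing_rmul' b ω η).symm) ω η b).symm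

/-- A covariant pairing on `Ω¹_γ` is induced by a covariant pairing on `Ω¹`, namely
`(ω, η) = γ̄(ω₍₋₁₎ ⊗ η₍₋₁₎) (ω₍₀₎, η₍₀₎)_γ`. -/
theorem exists_isTwistOf_of_isCovariant (hc : p'.IsCovariant) :
    ∃ p : C.Pairing, p.IsCovariant ∧ p'.IsTwistOf p := by
  have h11 := C.isCoaction_coact₁
  have hB := isCoaction_coact A B
  let P' : C.OneForms ⊗[ℂ] C.OneForms →ₗ[ℂ] B :=
    (Twist.of γ).symm.toLinearMap ∘ₗ p'.pairing ∘ₗ projTwist γ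
  have hP' : ∀ t, Twist.of γ (P' t) = p'.pairing (projTwist γ t) := fun t =>
    (Twist.of γ).apply_symm_apply _
  have hc' : ∀ t, coact A (P' t) = TensorProduct.map (hopfMul γ.toTwoCocycle) P'
      (tcoact C.coact₁ C.coact₁ t) := by
    intro t
    apply Twist.of₂_injective (γ := γ)
    have h := p'.isCovariant_iff_proj.1 hc
      (TensorProduct.map (C.of₁ γ).toLinearMap (C.of₁ γ).toLinearMap t)
    rw [tcoact_of₁] at h
    rw [← Twist.coact_of, hP']
    refine h.trans ?_
    generalize tcoact C.coact₁ C.coact₁ t = u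
    induction u with
    | zero => simp
    | add x y hx hy => simp only [map_add, hx, hy]
    | tmul a t =>
      rw [TensorProduct.map_tmul, TensorProduct.map_tmul, TensorProduct.map_tmul,
        TwistHopf.mul_of₂]
      rfl
  let P := P' ∘ₗ act (tcoact C.coact₁ C.coact₁) γ.inv
  have hP : ∀ t, P (act (tcoact C.coact₁ C.coact₁) γ.fn t) = P' t := fun t => by
    rw [LinearMap.comp_apply, act_inv_act_fn γ.toTwoCocycle h11 h11]
  have hPc : ∀ t, coact A (P t) = TensorProduct.map (LinearMap.mul' ℂ A) P
      (tcoact C.coact₁ C.coact₁ t) := coact_untwisted γ.toTwoCocycle h11 h11 hc'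
  have hbal : ∀ ω b η, P (C.rmul b ω ⊗ₜ η) = P (ω ⊗ₜ (b • η)) := by
    refine (twist_assoc_iff γ.toTwoCocycle h11 hB h11 C.coact₁_rmulT C.coact₁_lmulT P P).2
      fun ω b η => ?_
    apply (Twist.of γ).injective
    rw [hP, hP, hP', hP', projTwist_tmul, projTwist_tmul, ← of₁_rmul, ← of₁_lmul, tmul_balanced]
  have hleft : ∀ b ω η, P ((b • ω) ⊗ₜ η) = LinearMap.mul' ℂ B (b ⊗ₜ P (ω ⊗ₜ η)) := by
    refine (twist_assoc_iff γ.toTwoCocycle hB h11 h11 C.coact₁_lmulT hPc P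
      (LinearMap.mul' ℂ B)).2 fun b ω η => ?_
    apply (Twist.of γ).injective
    rw [hP, hP, hP', projTwist_tmul, ← of₁_lmul, p'.pairing_smul, ← projTwist_tmul, ← hP']
    rfl
  have hright : ∀ ω η b, LinearMap.mul' ℂ B (P (ω ⊗ₜ η) ⊗ₜ b) = P (ω ⊗ₜ C.rmul b η) := by
    refine (twist_assoc_iff γ.toTwoCocycle h11 h11 hB hPc C.coact₁_rmulT (LinearMap.mul' ℂ B)
      P).2 fun ω η b => ?_
    apply (Twist.of γ).injective
    rw [hP, hP, hP', projTwist_tmul, ← of₁_rmul, p'.pairing_rmul', ← projTwist_tmul, ← hP']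
    rfl
  refine ⟨⟨lift P hbal, fun b t => ?_, fun b t => ?_⟩, ?_, fun t => ?_⟩
  · induction t using TwoTensors.induction with
    | h0 => simp
    | ha s t hs ht => simp only [map_add, hs, ht, mul_add]
    | ht ω η => exact hleft b ω η
  · induction t using TwoTensors.induction with
    | h0 => simp
    | ha s t hs ht => simp only [map_add, hs, ht, add_mul]
    | ht ω η => exact (hright ω η b).symm
  · exact (isCovariant_iff_proj _).2 hPc
  · obtain ⟨t, rfl⟩ := projTwist_surjective t
    rw [phi_projTwist, ← hP']
    exact congrArg (Twist.of γ) (hP t).symm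

/-- The contraction in `Ω¹_γ` is the twist of the contraction in `Ω¹`. -/
theorem IsTwistOf.contractLeft_of₁ (h : p'.IsTwistOf p) (hc : p.IsCovariant) (ω : C.OneForms)
    (t : (C.twist γ).TwoTensors) : p'.contractLeft (C.of₁ γ ω) t =
      C.of₁ γ (p.contractLeftT (act (tcoact C.coact₁ C.coact₂) γ.fn (ω ⊗ₜ C.phi γ t))) := by
  induction t using TwoTensors.induction with
  | h0 => simp
  | ha s t hs ht => simp only [map_add, TensorProduct.tmul_add, hs, ht]
  | ht α β =>
    obtain ⟨α, rfl⟩ := (C.of₁ γ).surjective α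
    obtain ⟨β, rfl⟩ := (C.of₁ γ).surjective β
    rw [contractLeft_tmul, h.apply_tmul, of₁_lmul, phi_tmul]
    exact congrArg (C.of₁ γ) ((twist_assoc_iff γ.toTwoCocycle C.isCoaction_coact₁
      C.isCoaction_coact₁ C.isCoaction_coact₁ (p.isCovariant_iff_proj.1 hc) coact₂_proj C.lmulT
      p.contractLeftT).1 (fun _ _ _ => rfl) ω α β)

theorem IsTwistOf.contractRight_of₁ (h : p'.IsTwistOf p) (hc : p.IsCovariant) (ω : C.OneForms)
    (t : (C.twist γ).TwoTensors) : p'.contractRight (C.of₁ γ ω) t =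
      C.of₁ γ (p.contractRightT (act (tcoact C.coact₂ C.coact₁) γ.fn (C.phi γ t ⊗ₜ ω))) := by
  induction t using TwoTensors.induction with
  | h0 => simp
  | ha s t hs ht => simp only [map_add, TensorProduct.add_tmul, hs, ht]
  | ht α β =>
    obtain ⟨α, rfl⟩ := (C.of₁ γ).surjective α
    obtain ⟨β, rfl⟩ := (C.of₁ γ).surjective β
    rw [contractRight_tmul, h.apply_tmul, of₁_rmul, phi_tmul]
    exact congrArg (C.of₁ γ) ((twist_assoc_iff γ.toTwoCocycle C.isCoaction_coact₁
      C.isCoaction_coact₁ C.isCoaction_coact₁ coact₂_proj (p.isCovariant_iff_proj.1 hc)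
      p.contractRightT C.rmulT).1 (fun _ _ _ => rfl) α β ω).symm

/-- On tensors with coinvariant image under `φ`, contraction in `Ω¹_γ` is contraction in `Ω¹`. -/
theorem IsTwistOf.contractLeft_coinvariant (h : p'.IsTwistOf p) (hc : p.IsCovariant)
    {t : (C.twist γ).TwoTensors} (ht : C.coact₂ (C.phi γ t) = 1 ⊗ₜ C.phi γ t) (ω : C.OneForms) :
    p'.contractLeft (C.of₁ γ ω) t = C.of₁ γ (p.contractLeft ω (C.phi γ t)) := by
  rw [h.contractLeft_of₁ hc, act_fn_tmul_coinvariant _ C.isCoaction_coact₁ ht, contractLeftT_tmul]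

theorem IsTwistOf.contractRight_coinvariant (h : p'.IsTwistOf p) (hc : p.IsCovariant)
    {t : (C.twist γ).TwoTensors} (ht : C.coact₂ (C.phi γ t) = 1 ⊗ₜ C.phi γ t) (ω : C.OneForms) :
    p'.contractRight (C.of₁ γ ω) t = C.of₁ γ (p.contractRight ω (C.phi γ t)) := by
  rw [h.contractRight_of₁ hc, act_fn_coinvariant_tmul _ C.isCoaction_coact₁ ht,
    contractRightT_tmul]

/-- The pairing `( , )_γ` is Hermitian if and only if `( , )` is: both sides of the condition for
`( , )_γ` arise from those for `( , )` by the action of the invertible functionals `γ` and `V̄`,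
because
`V̄(a₍₁₎) V̄(b₍₁₎) γ(a₍₂₎ ⊗ b₍₂₎) = γ(b₍₁₎* ⊗ a₍₁₎*)* V̄(a₍₂₎ b₍₂₎)`. -/
theorem IsTwistOf.isHermitian_iff (h : p'.IsTwistOf p) (hc : p.IsCovariant) :
    p'.IsHermitian ↔ p.IsHermitian := by
  have h1 := C.isCoaction_coact₁
  have h2 := isCoaction_tcoact h1 h1
  have hB := isCoaction_coact A B
  set P := p.pairing ∘ₗ C.proj with hP
  have hl : ∀ ω η, Star.star (p'.pairing ((C.twist γ).tmul (C.of₁ γ ω) (C.of₁ γ η))) =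
      Twist.of γ (act (coact A) γ.Vinv (Star.star
        (P (act (tcoact C.coact₁ C.coact₁) γ.fn (ω ⊗ₜ η))))) := by
    intro ω η
    rw [h.apply_tmul, Twist.star_of]; rfl
  have hr : ∀ ω η, p'.pairing ((C.twist γ).tmul ((C.twist γ).star₁ (C.of₁ γ η))
      ((C.twist γ).star₁ (C.of₁ γ ω))) =
      Twist.of γ (act (coact A) γ.Vinv (P (swapMap C.star₁
        (act (tcoact C.coact₁ C.coact₁) γ.fn (ω ⊗ₜ η))))) := by
    intro ω η
    rw [star₁_of₁, star₁_of₁, h.apply_tmul, ← act_tcoact, ← act_mul h2, γ.key₂, act_mul h2,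
      ← hP, act_map (LinearMap.mul' ℂ A) P (p.isCovariant_iff_proj.1 hc), ← swapMap_tmul,
      ← act_semi (swapMap (starL A)) (swapMap C.star₁) (tcoact_swapMap _ _ coact₁_star₁) γ.fn
        γ.dag (dag_swapMap γ)]
  have hV : Function.Injective (act (coact A (M := B)) γ.Vinv) :=
    Function.LeftInverse.injective (g := act (coact A) γ.V) fun b => by
      rw [← act_mul hB, γ.Vinv_mul_V, act_one hB]
  let L : C.OneForms ⊗[ℂ] C.OneForms →ₗ⋆[ℂ] B := (starL B).comp P
  let R : C.OneForms ⊗[ℂ] C.OneForms →ₗ⋆[ℂ] B := P.comp (swapMap C.star₁)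
  have hLR : p.IsHermitian ↔ ∀ t, L t = R t := by
    refine ⟨fun hh t => ?_, fun hh ω η => hh (ω ⊗ₜ η)⟩
    induction t with
    | zero => simp
    | add x y hx hy => simp only [map_add, hx, hy]
    | tmul ω η => exact hh ω η
  rw [hLR]
  constructor
  · intro hh t
    have key : ∀ t, L (act (tcoact C.coact₁ C.coact₁) γ.fn t) =
        R (act (tcoact C.coact₁ C.coact₁) γ.fn t) := by
      intro t
      induction t with
      | zero => simp
      | add x y hx hy => simp only [map_add, hx, hy]
      | tmul ω η =>
        have h3 := hh (C.of₁ γ ω) (C.of₁ γ η)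
        rw [hl, hr] at h3
        exact hV ((Twist.of γ).injective h3)
    rw [← act_fn_act_inv γ.toTwoCocycle h1 h1 t]
    exact key _
  · intro hh ω η
    obtain ⟨ω, rfl⟩ := (C.of₁ γ).surjective ω
    obtain ⟨η, rfl⟩ := (C.of₁ γ).surjective η
    rw [hl, hr]
    exact congrArg (fun b => Twist.of γ (act (coact A) γ.Vinv b)) (hh _)

end Pairing

namespace Metric

/-- Both `φ(g_γ)` and `g` are inverse to the pairing on `Ω¹`, so they agree. -/
theorem phi_g {m : C.Metric} {m' : (C.twist γ).Metric} (h : m'.IsTwistOf m.toPairing)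
    (hc : m.toPairing.IsCovariant) : C.phi γ m'.g = m.g := by
  refine contractLeft_ext (m := m) fun ω => (C.of₁ γ).injective ?_
  rw [← h.contractLeft_coinvariant hc (coact₂_phi_coinvariant (coact₂_g (h.isCovariant hc))),
    m'.contractLeft_g, m.contractLeft_g]

theorem exists_twist (m : C.Metric) (hc : m.toPairing.IsCovariant) :
    ∃ m' : (C.twist γ).Metric, m'.IsTwistOf m.toPairing := by
  obtain ⟨p', h⟩ := Pairing.exists_isTwistOf (γ := γ) hc
  obtain ⟨g', hg'⟩ := phi_surjective (γ := γ) m.g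
  have hg : C.coact₂ (C.phi γ g') = 1 ⊗ₜ C.phi γ g' := by rw [hg', coact₂_g hc]
  refine ⟨⟨p', g', fun ω => ?_, fun ω => ?_⟩, h⟩
  · obtain ⟨ω, rfl⟩ := (C.of₁ γ).surjective ω
    rw [h.contractLeft_coinvariant hc hg, hg', m.contractLeft_g]
  · obtain ⟨ω, rfl⟩ := (C.of₁ γ).surjective ω
    rw [h.contractRight_coinvariant hc hg, hg', m.contractRight_g]

theorem exists_untwist (m' : (C.twist γ).Metric) (hc : m'.toPairing.IsCovariant) :
    ∃ m : C.Metric, m.toPairing.IsCovariant ∧ m'.IsTwistOf m.toPairing := by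
  obtain ⟨p, hp, h⟩ := Pairing.exists_isTwistOf_of_isCovariant hc
  have hg := coact₂_phi_coinvariant (coact₂_g hc)
  refine ⟨⟨p, C.phi γ m'.g, fun ω => (C.of₁ γ).injective ?_, fun ω => (C.of₁ γ).injective ?_⟩,
    hp, h⟩
  · rw [← h.contractLeft_coinvariant hp hg, m'.contractLeft_g]
  · rw [← h.contractRight_coinvariant hp hg, m'.contractRight_g]

end Metric

namespace CovariantRealMetric

theorem exists_twist (m : C.CovariantRealMetric) :
    ∃ m' : (C.twist γ).CovariantRealMetric, m'.1.IsTwistOf m.1.toPairing := by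
  obtain ⟨m', h⟩ := m.1.exists_twist (γ := γ) m.2.1.1
  exact ⟨⟨m', Metric.isCovariant_of_pairing (h.isCovariant m.2.1.1), Metric.isReal_iff.2
    ((h.isHermitian_iff m.2.1.1).2 (Metric.isReal_iff.1 m.2.2))⟩, h⟩

theorem exists_untwist (m' : (C.twist γ).CovariantRealMetric) :
    ∃ m : C.CovariantRealMetric, m'.1.IsTwistOf m.1.toPairing := by
  obtain ⟨m, hc, h⟩ := m'.1.exists_untwist m'.2.1.1
  exact ⟨⟨m, Metric.isCovariant_of_pairing hc, Metric.isReal_iff.2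
    ((h.isHermitian_iff hc).1 (Metric.isReal_iff.1 m'.2.2))⟩, h⟩

variable (γ) in
/-- The covariant real metric on `Ω¹_γ` with `( , )_γ = ( , ) ∘ φ`. -/
noncomputable def twist (m : C.CovariantRealMetric) : (C.twist γ).CovariantRealMetric :=
  (exists_twist (γ := γ) m).choose

theorem isTwistOf_twist (m : C.CovariantRealMetric) : (m.twist γ).1.IsTwistOf m.1.toPairing :=
  (exists_twist (γ := γ) m).choose_spec

theorem twist_bijective : Function.Bijective (twist (C := C) γ) := by
  constructor
  · intro m₁ m₂ e
    refine Subtype.ext (Metric.ext_pairing (LinearMap.ext fun t => ?_))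
    obtain ⟨t, rfl⟩ := phi_surjective (γ := γ) t
    apply (Twist.of γ).injective
    rw [← m₁.isTwistOf_twist, ← m₂.isTwistOf_twist, e]
  · intro m'
    obtain ⟨m, h⟩ := m'.exists_untwist
    exact ⟨m, Subtype.ext (Metric.ext_pairing (LinearMap.ext fun t =>
      (m.isTwistOf_twist t).trans (h t).symm))⟩

end CovariantRealMetric

end CovariantStarCalculus

end TwistMetrics

end CocycleTwist

open CocycleTwist
theorem mainTheorem10 {A : Type*} [Ring A] [StarRing A] [HopfAlgebra ℂ A] [StarModule ℂ A]
    [HopfStarAlgebra A] {B : Type*} [Ring B] [StarRing B] [Algebra ℂ B] [StarModule ℂ B]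
    [LeftComodule A B] [ComoduleStarAlgebra A B] {Ω : Type*} [Ring Ω] [Algebra ℂ Ω]
    [LeftComodule A Ω] [ComoduleAlgebra A Ω] (C : CovariantStarCalculus A B Ω)
    (γ : UnitaryTwoCocycle A) :
    ∃ (e₁₂ : C.CovariantRealMetric ≃ C.CovariantHermitianMetric)
      (e₃₄ : (C.twist γ).CovariantRealMetric ≃ (C.twist γ).CovariantHermitianMetric)
      (e₁₃ : C.CovariantRealMetric ≃ (C.twist γ).CovariantRealMetric)
      (e₂₄ : C.CovariantHermitianMetric ≃ (C.twist γ).CovariantHermitianMetric),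
      (∀ m ω η, (e₁₂ m).H ω η = m.1.pairing (C.tmul η (C.star₁ ω))) ∧
      (∀ m ω η, (e₃₄ m).H ω η = m.1.pairing ((C.twist γ).tmul η ((C.twist γ).star₁ ω))) ∧
      (∀ m, C.phi γ (e₁₃ m).1.g = m.1.g ∧
        ∀ t, (e₁₃ m).1.pairing t = Twist.of γ (m.1.pairing (C.phi γ t))) ∧
      (∀ m, e₂₄ (e₁₂ m) = e₃₄ (e₁₃ m)) := by
  let e₁₃ := Equiv.ofBijective _ (CovariantStarCalculus.CovariantRealMetric.twist_bijective
    (C := C) (γ := γ))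
  exact ⟨C.realEquivHermitian, (C.twist γ).realEquivHermitian, e₁₃,
    C.realEquivHermitian.symm.trans (e₁₃.trans (C.twist γ).realEquivHermitian),
    fun _ _ _ => rfl, fun _ _ _ => rfl,
    fun m => ⟨CovariantStarCalculus.Metric.phi_g m.isTwistOf_twist m.2.1.1, m.isTwistOf_twist⟩,
    fun m => by simp⟩
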